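/- **Setting.** Let $\lambda,k,r,\eta,\alpha_1,\dots,\alpha_\lambda$ be integers with $k\ge r\ge\lambda\ge 2$, $k>\lambda$, $0<\alpha_1<\cdots<\alpha_\lambda<\eta$ and $\alpha_i+\alpha_{\lambda+1-i}=\eta$ for $1\le i\le\lambda$. Parts of overpartitions $\pi=(\pi_1\ge\pi_2\ge\cdots\ge\pi_\ell)$ (positive integers, possibly overlined, each overlined number occurring at most once) are ordered by $1<\overline 1<2<\overline 2<\cdots$; $|\pi|$ is the sum of the parts; $x\pm\eta$ is overlined iff $x$ is; $f_\pi(0,\eta]$ is the number of parts of $\pi$ that are $\le\eta$ in this order. $\overline{\mathcal B}_1(\alpha_2,\dots,\alpha_\lambda;\eta,k,r)$ is the set of overpartitions $\pi$ whose parts are $\equiv 0,\alpha_2,\dots,\alpha_\lambda\pmod\eta$, in which only multiples of $\eta$ may be non-overlined, with $\pi_i\ge\pi_{i+k-1}+\eta$ (strictly if $\pi_i$ is non-overlined) for all $i$, and $f_\pi(0,\eta]\le r-1$. *Markings.* The Gordon marking gives each part, starting with the smallest, the least positive integer not used for the earlier treated parts $y$ (those after $x$ in the list) with $y\ge x-\eta$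 (strictly if $x$ is overlined). The reverse Gordon marking gives each part $x$, starting with the largest, the least positive integer not used for the preceding parts $y$ with $y\le x+\eta$ (strictly if $x$ is overlined). Let $\tilde g_1(\pi)>\tilde g_2(\pi)>\cdots$ and $\tilde r_1(\pi)>\tilde r_2(\pi)>\cdots$ be the parts marked $k-1$ in the Gordon, respectively reverse Gordon, marking. The set $\{\tilde r_p(\pi)\}_{k-1}$ consists of $\tilde r_p(\pi)$ and the parts $y$ preceding it with $y\le\tilde r_p(\pi)+\eta$ (strictly if $\tilde r_p(\pi)$ is overlined). A $(k-1)$-set of $\pi$ consists of $k-1$ consecutive parts $\pi_m\ge\cdots\ge\pi_{m+k-2}$ with $\pi_m\le\pi_{m+k-2}+\eta$ (strictly if $\pi_m$ is overlined). *Moves.* If the reverse Gordon marking of the overpartition $\pi$ uses only marks $\le k-1$ and there are at least $p$ parts $\tilde r_i(\pi)$, the forward move $\phi_p$ adds $\eta$ to $\tilde r_1(\pi),\dots,\tilde r_p(\pi)$. If the Gordon marking of the overpartition $\omega$ uses only marks $\le k-1$, there are at least $p$ parts $\tilde g_i(\omega)$ and, in case $p\ge1$, (a) $\tilde g_p(\omega)\ge\overline{\eta+\alpha_1}$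 and (b) no $(k-1)$-set of $\omega$ lies in $[\tilde g_p(\omega)-2\eta,\tilde g_p(\omega))$ (in $(\tilde g_p(\omega)-2\eta,\tilde g_p(\omega))$ if $\tilde g_p(\omega)$ is overlined), then the backward move $\psi_p$ may be applied: it subtracts $\eta$ from $\tilde g_1(\omega),\dots,\tilde g_p(\omega)$. $\phi_0,\psi_0$ are identities. *Degenerate overpartitions.* Let $\tau\in\overline{\mathcal B}_1(\alpha_2,\dots,\alpha_\lambda;\eta,k,r)$. A $(k-1)$-set of $\tau$ is non-degenerate if none of its parts is $\equiv\alpha_\lambda\pmod\eta$. The largest non-overlined part of a non-degenerate $(k-1)$-set (its last occurrence $\tau_j$, with $\tau_j>\tau_{j+1}$) is called a non-degenerate part. If $f_\tau(0,\eta]=r-1$, $\overline{\alpha_\lambda}$ is not a part of $\tau$, and no $(k-1)$-set of $\tau$ lies in $(0,\overline{\eta+\alpha_\lambda})$, then (the last occurrence of) the non-overlined part $\eta$ is called the non-degenerate $(r-1)$-part. For $0\le p\le N$ the degenerate overpartition $\hat\tau$ is obtained by subtracting $\alpha_1$, generating an overlined part, from the smallest non-degenerate part of $\tau$ if $p<N$,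 and from the non-degenerate $(r-1)$-part of $\tau$ if $p=N$. *The two sets.* $\overline{\mathcal B}_\lambda(\alpha_2,\dots,\alpha_\lambda;\eta,k,r|N,p)$ is the set of $\pi\in\overline{\mathcal B}_1(\alpha_2,\dots,\alpha_\lambda;\eta,k,r)$ with exactly $N$ parts $\tilde r_i(\pi)$ such that: if $p<N$, then $\{\tilde r_{p+1}(\pi)\}_{k-1}$ contains a part $\tilde{\tilde r}_{p+1}(\pi)\equiv\alpha_\lambda\pmod\eta$, and every $(k-1)$-set of $\pi$ all of whose parts are less than $\tilde{\tilde r}_{p+1}(\pi)$ contains a part $\equiv\alpha_\lambda\pmod\eta$; if $p=N$, then $f_\pi(0,\eta]=r-1$, $\tilde r_N(\pi)>\eta$ and $\tilde{\tilde r}_{N+1}(\pi):=\overline{\alpha_\lambda}$ is a part of $\pi$. $\overline{\mathcal B}_\eta(\alpha_2,\dots,\alpha_\lambda;\eta,k,r|N,p)$ is the set of $\tau\in\overline{\mathcal B}_1(\alpha_2,\dots,\alpha_\lambda;\eta,k,r)$ such that: if $p<N$, then $\tau$ has a non-degenerate $(k-1)$-set, and $\tilde g_{p+1}(\hat\tau)<\tau_m+\eta<\tilde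 g_p(\hat\tau)$, where $\tau_m$ is the largest part of the smallest non-degenerate $(k-1)$-set (the one with the largest index $m$) and $\tilde g_0=+\infty$; if $p=N$, then $\tau$ has a non-degenerate $(r-1)$-part; and in both cases there are exactly $N$ parts $\tilde g_i(\hat\tau)$. **Theorem.** Let $N\ge1$ and $0\le p\le N$. (1) For $\pi\in\overline{\mathcal B}_\lambda(\alpha_2,\dots,\alpha_\lambda;\eta,k,r|N,p)$ the forward move $\phi_p$ can be applied to $\pi$ and gives an overpartition $\phi_p(\pi)$, of which $\tilde{\tilde r}_{p+1}(\pi)$ is a part. Let the $(k-1)$-addition $\tau=A_{p\eta+\alpha_1}(\pi)$ be obtained from $\phi_p(\pi)$ by adding $\alpha_1$ to the part $\tilde{\tilde r}_{p+1}(\pi)$, generating a non-overlined multiple of $\eta$. Then $\tau\in\overline{\mathcal B}_\eta(\alpha_2,\dots,\alpha_\lambda;\eta,k,r|N,p)$ and $|\tau|=|\pi|+p\eta+\alpha_1$. (2) For $\tau\in\overline{\mathcal B}_\eta(\alpha_2,\dots,\alpha_\lambda;\eta,k,r|N,p)$ the backward move $\psi_p$ can be applied to $\hat\tau$, and the $(k-1)$-subtraction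 $S_{p\eta+\alpha_1}(\tau):=\psi_p(\hat\tau)$ lies in $\overline{\mathcal B}_\lambda(\alpha_2,\dots,\alpha_\lambda;\eta,k,r|N,p)$. (3) The maps $A_{p\eta+\alpha_1}$ and $S_{p\eta+\alpha_1}$ are inverse to each other; in particular $A_{p\eta+\alpha_1}$ is a bijection from $\overline{\mathcal B}_\lambda(\alpha_2,\dots,\alpha_\lambda;\eta,k,r|N,p)$ onto $\overline{\mathcal B}_\eta(\alpha_2,\dots,\alpha_\lambda;\eta,k,r|N,p)$. -/

import Mathlib

namespace Bressoud

/-- A part of an overpartition: its size, together with a flag telling whether it is overlined.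
The lexicographic order is `1 < 1̄ < 2 < 2̄ < ⋯`. -/
abbrev Part : Type := ℕ ×ₗ Bool

/-- The non-overlined part of size `n`. -/
def plain (n : ℕ) : Part := toLex (n, false)

/-- The overlined part of size `n`. -/
def bar (n : ℕ) : Part := toLex (n, true)

/-- The size of a part. -/
def size (x : Part) : ℕ := (ofLex x).1

/-- The part is overlined. -/
abbrev Over (x : Part) : Prop := (ofLex x).2 = true

/-- The part `x + e`, overlined exactly when `x` is. -/
def raise (e : ℕ) (x : Part) : Part := toLex (size x + e, (ofLex x).2)

/-- The part `x - e`, overlined exactly when `x` is (only used when `e < size x`). -/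
def lower (e : ℕ) (x : Part) : Part := toLex (size x - e, (ofLex x).2)

/-- An overpartition, written as the list `π₁ ≥ π₂ ≥ ⋯ ≥ π_ℓ` of its parts: the sizes are positive
and an overlined part is not repeated. -/
structure IsOverpartition (π : List Part) : Prop where
  sorted : π.Pairwise (· ≥ ·)
  pos : ∀ x ∈ π, 0 < size x
  over_once : ∀ x ∈ π, Over x → π.count x = 1

/-- The weight `|π|`, the sum of all parts. -/
def weight (π : List Part) : ℕ := (π.map size).sum

/-- The list of parts rearranged in non-increasing order. -/
def sortParts (π : List Part) : List Part := π.insertionSort (· ≥ ·)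

/-- Replace one occurrence of the part `x` by the part `y`. -/
def replacePart (x y : Part) (π : List Part) : List Part := sortParts (y :: π.erase x)

/-- `x ≤ y + η`, with strict inequality if the larger part `x` is overlined. -/
def NearTop (η : ℕ) (x y : Part) : Prop := if Over x then x < raise η y else x ≤ raise η y

/-- `x ≤ y + η`, with strict inequality if the smaller part `y` is overlined. -/
def NearBot (η : ℕ) (x y : Part) : Prop := if Over y then x < raise η y else x ≤ raise η y

instance (η : ℕ) (x y : Part) : Decidable (NearTop η x y) := by
  unfold NearTop; infer_instance

instance (η : ℕ) (x y : Part) : Decidable (NearBot η x y) := by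
  unfold NearBot; infer_instance

/-- The set `B̄₁(A; η, k, r)` of overpartitions, where `A` is the set of admissible non-zero residues.
(The further parity condition in the definition of `B̄_j` is a congruence modulo `2 - j`, which is
empty for `j = 1`.)  The parts counted in the last condition are those `≤ η` in the order of parts,
so the overlined `η` is not counted. -/
structure IsB1 (A : Set ℕ) (η k r : ℕ) (π : List Part) : Prop where
  isOverpartition : IsOverpartition π
  residue : ∀ x ∈ π, size x ≡ 0 [MOD η] ∨ ∃ a ∈ A, size x ≡ a [MOD η]
  plain_dvd : ∀ x ∈ π, ¬ Over x → η ∣ size x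
  gap : ∀ i : ℕ, ∀ x ∈ π[i]?, ∀ y ∈ π[i + (k - 1)]?,
    if Over x then raise η y ≤ x else raise η y < x
  small : π.countP (· ≤ plain η) ≤ r - 1

/-! ### Gordon marking and reverse Gordon marking -/

theorem exists_unused (l : List ℕ) : ∃ q, 0 < q ∧ q ∉ l := by
  obtain ⟨q, hq⟩ := Infinite.exists_notMem_finset (insert 0 l.toFinset)
  simp only [Finset.mem_insert, List.mem_toFinset, not_or] at hq
  exact ⟨q, Nat.pos_of_ne_zero hq.1, hq.2⟩

/-- The least positive integer that does not occur in `l`. -/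
def leastUnused (l : List ℕ) : ℕ := Nat.find (exists_unused l)

/-- The Gordon marking: the list of the marks of `π₁ ≥ ⋯ ≥ π_ℓ`, assigned from the smallest part
on; `x` gets the least positive integer not used for the later parts `y` with `y ≥ x - η` (strictly
if `x` is overlined). -/
def gordonMarks (η : ℕ) : List Part → List ℕ
  | [] => []
  | x :: ys =>
    leastUnused (((ys.zip (gordonMarks η ys)).filter fun ym => NearTop η x ym.1).map Prod.snd)
      :: gordonMarks η ys

/-- Auxiliary form of the reverse Gordon marking, on the list `π_ℓ, …, π₁` of parts in increasing
order: `x` gets the least positive integer not used for the larger parts `y` with `y ≤ x + η`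
(strictly if `x` is overlined). -/
def reverseMarksAux (η : ℕ) : List Part → List ℕ
  | [] => []
  | x :: ys =>
    leastUnused (((ys.zip (reverseMarksAux η ys)).filter fun ym => NearBot η ym.1 x).map Prod.snd)
      :: reverseMarksAux η ys

/-- The reverse Gordon marking: the list of the marks of `π₁ ≥ ⋯ ≥ π_ℓ`, assigned from the largest
part on. -/
def reverseGordonMarks (η : ℕ) (π : List Part) : List ℕ := (reverseMarksAux η π.reverse).reverse

/-- The positions (from `0`) of the mark `m` in a list of marks. -/
def positions (m : ℕ) (ms : List ℕ) : List ℕ :=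
  (List.range ms.length).filter fun i => ms[i]? = some m

/-- The positions of the `(k-1)`-marked parts `g̃₁(π) > g̃₂(π) > ⋯` of the Gordon marking. -/
def gPos (η k : ℕ) (π : List Part) : List ℕ := positions (k - 1) (gordonMarks η π)

/-- The positions of the `(k-1)`-marked parts `r̃₁(π) > r̃₂(π) > ⋯` of the reverse Gordon marking. -/
def rPos (η k : ℕ) (π : List Part) : List ℕ := positions (k - 1) (reverseGordonMarks η π)

/-- The list `g̃₁(π), g̃₂(π), …`; the entry of index `p` is `g̃_{p+1}(π)`. -/
def gParts (η k : ℕ) (π : List Part) : List Part := (gPos η k π).filterMap (π[·]?)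

/-- The list `r̃₁(π), r̃₂(π), …`; the entry of index `p` is `r̃_{p+1}(π)`. -/
def rParts (η k : ℕ) (π : List Part) : List Part := (rPos η k π).filterMap (π[·]?)

/-- The set `{r̃}_{k-1}` of a `(k-1)`-marked part `r̃` of the reverse Gordon marking, at position
`i`: the part `r̃` with the parts `y` before it such that `y ≤ r̃ + η` (strictly if `r̃` is
overlined). -/
def rSet (η : ℕ) (π : List Part) (i : ℕ) : List Part :=
  match π[i]? with
  | some x => (π.take i).filter (fun y => NearBot η y x) ++ [x]
  | none => []

/-! ### Forward and backward moves -/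

/-- The forward move `φ_p`: add `η` to `r̃₁(π), …, r̃_p(π)`. -/
def forwardMove (η k p : ℕ) (π : List Part) : List Part :=
  sortParts (π.mapIdx fun i x => if i ∈ (rPos η k π).take p then raise η x else x)

/-- The backward move `ψ_p`: subtract `η` from `g̃₁(ω), …, g̃_p(ω)`. -/
def backwardMove (η k p : ℕ) (ω : List Part) : List Part :=
  sortParts (ω.mapIdx fun i x => if i ∈ (gPos η k ω).take p then lower η x else x)

/-- `φ_p` may be applied to `π`. -/
structure CanForward (η k p : ℕ) (π : List Part) : Prop where
  isOverpartition : IsOverpartition π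
  marks : ∀ m ∈ reverseGordonMarks η π, m ≤ k - 1
  le : p ≤ (rParts η k π).length

/-- The `k - 1` consecutive parts `π_m ≥ ⋯ ≥ π_{m+k-2}`. -/
def window (k : ℕ) (π : List Part) (m : ℕ) : List Part := (π.drop m).take (k - 1)

/-- `π_m ≥ ⋯ ≥ π_{m+k-2}` is a `(k-1)`-set of `π`: all `k - 1` parts exist and
`π_m ≤ π_{m+k-2} + η`, strictly if `π_m` is overlined. -/
def IsKSet (η k : ℕ) (π : List Part) (m : ℕ) : Prop :=
  ∃ x ∈ π[m]?, ∃ y ∈ π[m + (k - 2)]?, NearTop η x y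

instance (η k : ℕ) (π : List Part) (m : ℕ) : Decidable (IsKSet η k π m) := by
  unfold IsKSet; infer_instance

/-- `ψ_p` may be applied to `ω`: for `p ≥ 1`, the part `g = g̃_p(ω)` is at least the overlined part
of size `η + a`, and there is no `(k-1)`-set of `ω` in `[g - 2η, g)` if `g` is non-overlined, in
`(g - 2η, g)` if `g` is overlined. -/
structure CanBackward (a η k p : ℕ) (ω : List Part) : Prop where
  isOverpartition : IsOverpartition ω
  marks : ∀ m ∈ gordonMarks η ω, m ≤ k - 1
  le : p ≤ (gParts η k ω).length
  ge : 1 ≤ p → ∀ g ∈ (gParts η k ω)[p - 1]?, bar (η + a) ≤ g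
  no_set : 1 ≤ p → ∀ g ∈ (gParts η k ω)[p - 1]?, ∀ m, IsKSet η k ω m →
    ¬ ((∀ x ∈ window k ω m, x < g) ∧
      ∀ x ∈ window k ω m, if Over g then g < raise (2 * η) x else g ≤ raise (2 * η) x)

/-! ### Non-degenerate sets and parts

In what follows `a` stands for `α₁` and `c` for `α_λ`, so that `a + c = η`. -/

/-- The `(k-1)`-set at position `m` is non-degenerate: it has no part congruent to `c` mod `η`. -/
def IsNonDegSet (c η k : ℕ) (π : List Part) (m : ℕ) : Prop :=
  IsKSet η k π m ∧ ∀ y ∈ window k π m, ¬ size y ≡ c [MOD η]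

instance (c η k : ℕ) (π : List Part) (m : ℕ) : Decidable (IsNonDegSet c η k π m) := by
  unfold IsNonDegSet; infer_instance

/-- `x` is a non-degenerate part of `π`: it is the largest non-overlined part `π_j` of a
non-degenerate `(k-1)`-set, and `π_j > π_{j+1}` (or `π_j` is the last part of `π`). -/
def IsNonDegPart (c η k : ℕ) (π : List Part) (x : Part) : Prop :=
  ∃ m < π.length, IsNonDegSet c η k π m ∧ ∃ j < π.length, m ≤ j ∧ j ≤ m + (k - 2) ∧
    π[j]? = some x ∧ ¬ Over x ∧ (∀ y ∈ window k π m, ¬ Over y → y ≤ x) ∧ ∀ y ∈ π[j + 1]?, y < x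

instance (c η k : ℕ) (π : List Part) (x : Part) : Decidable (IsNonDegPart c η k π x) := by
  unfold IsNonDegPart; infer_instance

/-- The smallest non-degenerate part of `π`, if there is one. -/
def smallestNonDegPart (c η k : ℕ) (π : List Part) : Option Part :=
  (π.filter fun x => IsNonDegPart c η k π x).min?

/-- The non-overlined part `η` is a non-degenerate `(r-1)`-part of `π`: there are `r - 1` parts
`≤ η`, the overlined part `c` does not occur, and no `(k-1)`-set lies below the overlined part
`η + c`. -/
def HasNonDegRPart (c η k r : ℕ) (π : List Part) : Prop :=
  π.countP (· ≤ plain η) = r - 1 ∧ bar c ∉ π ∧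
    ∀ m, IsKSet η k π m → ¬ ∀ x ∈ window k π m, x < bar (η + c)

/-- Subtract `a` from the non-overlined part `x` of `π`, generating an overlined part. -/
def subtractPart (a : ℕ) (x : Part) (π : List Part) : List Part :=
  replacePart x (bar (size x - a)) π

/-- The degenerate overpartition used for the index pair `N, p`: subtract `a` from the smallest
non-degenerate part if `p < N`, and from the non-degenerate `(r-1)`-part `η` if `p = N`. -/
def degenerate (a c η k N p : ℕ) (π : List Part) : List Part :=
  if p < N then
    match smallestNonDegPart c η k π with
    | some x => subtractPart a x π
    | none => π
  else subtractPart a (plain η) π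

/-! ### The two sets, the `(k-1)`-addition and the `(k-1)`-subtraction -/

/-- The set `B̄_λ(α₂, …, α_λ; η, k, r | N, p)`, with `A = {α₂, …, α_λ}` and `c = α_λ`. -/
structure IsBLambda (A : Set ℕ) (c η k r N p : ℕ) (π : List Part) : Prop where
  isB1 : IsB1 A η k r π
  count : (rParts η k π).length = N
  lt : p < N → ∃ i ∈ (rPos η k π)[p]?, ∃ x ∈ rSet η π i, size x ≡ c [MOD η] ∧
    ∀ m, IsKSet η k π m → (∀ y ∈ window k π m, y < x) → ∃ y ∈ window k π m, size y ≡ c [MOD η]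
  eq : p = N → π.countP (· ≤ plain η) = r - 1 ∧ bar c ∈ π ∧ ∀ x ∈ rParts η k π, plain η < x

/-- The set `B̄_η(α₂, …, α_λ; η, k, r | N, p)`, with `A = {α₂, …, α_λ}`, `a = α₁`, `c = α_λ`.
The convention is `g̃₀ = +∞`. -/
structure IsBEta (A : Set ℕ) (a c η k r N p : ℕ) (τ : List Part) : Prop where
  isB1 : IsB1 A η k r τ
  count : (gParts η k (degenerate a c η k N p τ)).length = N
  lt : p < N → ∃ m, IsNonDegSet c η k τ m ∧ (∀ m', IsNonDegSet c η k τ m' → m' ≤ m) ∧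
    ∀ x ∈ τ[m]?,
      (∀ g ∈ (gParts η k (degenerate a c η k N p τ))[p]?, g < raise η x) ∧
      (1 ≤ p → ∀ g ∈ (gParts η k (degenerate a c η k N p τ))[p - 1]?, raise η x < g)
  eq : p = N → HasNonDegRPart c η k r τ

/-- The part to which `a` is added: the part congruent to `c` in the set of `r̃_{p+1}(π)` if there are
more than `p` parts `r̃_i(π)`, and the overlined part `c` otherwise. -/
def additionPart (c η k p : ℕ) (π : List Part) : Part :=
  match (rPos η k π)[p]? with
  | some i => ((rSet η π i).find? fun x => size x ≡ c [MOD η]).getD (bar c)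
  | none => bar c

/-- The `(k-1)`-addition: apply `φ_p` and then add `a` to the above part, generating a non-overlined
part. -/
def addition (a c η k p : ℕ) (π : List Part) : List Part :=
  replacePart (additionPart c η k p π) (plain (size (additionPart c η k p π) + a))
    (forwardMove η k p π)

/-- The `(k-1)`-subtraction: pass to the degenerate overpartition and then apply `ψ_p`. -/
def subtraction (a c η k N p : ℕ) (τ : List Part) : List Part :=
  backwardMove η k p (degenerate a c η k N p τ)

end Bressoud

namespace Bressoud

/-! ### Slot sequences -/

/-! The admissible parts form a periodic chain. Each period of length `η` has `L = lam + 1` slots: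
the non-overlined multiple of `η`, the overlined multiple, and the overlined parts of residues `α
2`, ..., `α lam`. Adding `η` shifts a slot by `L`; because `α 1 + α lam = η`, adding `α 1` to a part
of residue `α lam` moves it exactly one slot up. Both versions of nearness become the single
relation `Nr`. With `K = k - 1`, an overpartition in `B̄₁` is then a non-increasing sequence of
slots in which only multiples of `L` repeat and `u i` is never near `u (i + K)` (`Adm`), together
with the bound on the small parts. A `(k-1)`-set is a window of `K` near entries (`KS`).

The gap condition bounds all marks by `K`, and the mark `K` selects disjoint windows greedily
(`IsGreedy.eq_iff`): the Gordon marking works from the bottom and marks first entries, the reverse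
marking works from the top and marks last entries. Adding `η` to the last entry of a chosen window
carries it to the front of that window. Hence `φ_p` rotates the first `p` top-greedy windows (`fw`)
and `ψ_p` rotates windows back (`bw`). Old and new sequences interlace, which keeps the sequence
admissible (`fw_adm`, `bw_adm`). The rotated windows are exactly the first `p` greedy windows for
the opposite marking of the result (`fw_mem_bot`, `fw_bot_mem`, `bw_mem_top`, `bw_top_mem`), so each
move selects the windows that the other one has to undo. The number of marked parts is preserved
since every window of one greedy family meets one of the other.

It remains to recover the position `j` of the entry that is moved by one slot. For `p < N` the
addition removes the only entry congruent to `-1` from the first unrotated window, so non-degenerate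
windows appear; the last one contains `j`, and the new entry is its largest multiple of `L`
(`AddAt.lastND`). Its place between the rotated and the unrotated windows is what determines `p`
(`AddAt.lt_start`, `AddAt.lt_next`). Conversely these inequalities must allow `ψ_p`
(`SubAt.lowerable`) and reproduce the data of an addition (`SubAt.addAt`). Both rest on a count of
distinct slots that needs `L ≤ K + 1`, that is `lam < k` (`not_nr_of_windows`). For `p = N` all
windows are rotated, the moved entry passes between the slots `L - 1` and `L`, and `lam ≤ r` forces
the slot `L` to be occupied (`exists_last_eta`). -/

/-- The slot `a` is at most `L` above the slot `b`, strictly unless `a` is a multiple of `L`. -/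
def Nr (L a b : ℕ) : Prop := a < b + L ∨ (a = b + L ∧ a % L = 0)

theorem Nr.mono {L a b a' b' : ℕ} (h : Nr L a b) (ha : a' ≤ a) (hb : b ≤ b') : Nr L a' b' := by
  rcases h with h | ⟨h, h0⟩
  · left; omega
  · by_cases h1 : a' = a ∧ b' = b
    · obtain ⟨rfl, rfl⟩ := h1
      exact Or.inr ⟨h, h0⟩
    · left; omega

theorem Nr.le {L a b : ℕ} (h : Nr L a b) : a ≤ b + L := by
  rcases h with h | ⟨h, _⟩ <;> omega

theorem Nr.lt {L a b : ℕ} (h : Nr L a b) (ha : a % L ≠ 0) : a < b + L := by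
  rcases h with h | ⟨_, h⟩
  · exact h
  · exact absurd h ha

theorem nr_add {L a b : ℕ} : Nr L (a + L) (b + L) ↔ Nr L a b := by
  simp only [Nr, Nat.add_mod_right]
  constructor <;> rintro (h | ⟨h, h'⟩)
  · left; omega
  · right; exact ⟨by omega, h'⟩
  · left; omega
  · right; exact ⟨by omega, h'⟩

theorem add_le_of_mod_zero {L a b : ℕ} (ha : a % L = 0) (hb : b % L = 0) (h : a < b) :
    a + L ≤ b := by
  obtain ⟨x, rfl⟩ := Nat.dvd_of_mod_eq_zero ha
  obtain ⟨y, rfl⟩ := Nat.dvd_of_mod_eq_zero hb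
  have : x < y := lt_of_mul_lt_mul_left h (Nat.zero_le _)
  calc L * x + L = L * (x + 1) := by ring
    _ ≤ L * y := Nat.mul_le_mul_left _ this

theorem mod_ne_zero_of_between {L Q a : ℕ} (hQ : Q % L = 0) (h1 : Q < a) (h2 : a < Q + L) :
    a % L ≠ 0 := fun h => by
  have := add_le_of_mod_zero hQ h h1
  omega

/-- The sequence `u 0 ≥ ⋯ ≥ u (n - 1)` of slots describes an overpartition without `K + 1`
consecutive parts that are pairwise near. -/
structure Adm (L K n : ℕ) (u : ℕ → ℕ) : Prop where
  anti : ∀ i j, i ≤ j → j < n → u j ≤ u i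
  strict : ∀ i, i + 1 < n → u (i + 1) = u i → u i % L = 0
  gap : ∀ i, i + K < n → ¬ Nr L (u i) (u (i + K))
  pos : ∀ i < n, 2 ≤ u i

/-- The `K` consecutive entries from `i` on exist and are pairwise near. -/
def KS (L K n : ℕ) (u : ℕ → ℕ) (i : ℕ) : Prop := i + K ≤ n ∧ Nr L (u i) (u (i + K - 1))

theorem Adm.lt_of_strict {L K n : ℕ} {u : ℕ → ℕ} (h : Adm L K n u) {i : ℕ} (hi : i + 1 < n)
    (h0 : u (i + 1) % L ≠ 0) : u (i + 1) < u i := by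
  have h1 := h.anti i (i + 1) (by omega) hi
  rcases h1.lt_or_eq with h2 | h2
  · exact h2
  · exact absurd (h2 ▸ h.strict i hi h2) h0

theorem Adm.lt_of_strict' {L K n : ℕ} {u : ℕ → ℕ} (h : Adm L K n u) {i j : ℕ} (hij : i < j)
    (hj : j < n) (h0 : u j % L ≠ 0) : u j < u i := by
  obtain ⟨j, rfl⟩ : ∃ j', j = j' + 1 := ⟨j - 1, by omega⟩
  exact (h.lt_of_strict hj h0).trans_le (h.anti _ _ (by omega) (by omega))

theorem Adm.lt_of_strict_left {L K n : ℕ} {u : ℕ → ℕ} (h : Adm L K n u) {i j : ℕ} (hij : i < j)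
    (hj : j < n) (h0 : u i % L ≠ 0) : u j < u i := by
  have h1 := h.anti i (i + 1) (by omega) (by omega)
  have h2 := h.anti (i + 1) j (by omega) hj
  rcases h1.lt_or_eq with h3 | h3
  · omega
  · exact absurd (h.strict i (by omega) h3) h0

/-- Entries that are no multiples of `L` decrease strictly. -/
theorem Adm.add_le {L K n : ℕ} {u : ℕ → ℕ} (h : Adm L K n u) (i d : ℕ) (hd : i + d < n)
    (h0 : ∀ l, i < l → l ≤ i + d → u l % L ≠ 0) : u (i + d) + d ≤ u i := by
  induction d with
  | zero => simp
  | succ d ih =>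
    have h1 := ih (by omega) fun l hl hl' => h0 l hl (by omega)
    have h2 := h.lt_of_strict (i := i + d) (by omega) (h0 _ (by omega) (by omega))
    have : i + (d + 1) = i + d + 1 := by omega
    rw [this]
    omega

/-! ### Greedy families of disjoint windows -/

/-- Greedy choice, from the top of the list, of starts with disjoint windows of length `K`. -/
def TopGreedy (K : ℕ) (S r : ℕ → Prop) : Prop :=
  ∀ i, r i ↔ S i ∧ ∀ i', i' < i → i < i' + K → ¬ r i'

/-- Greedy choice, from the bottom of the list, of starts with disjoint windows of length `K`. -/
def BotGreedy (K : ℕ) (S g : ℕ → Prop) : Prop :=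
  ∀ i, g i ↔ S i ∧ ∀ i', i < i' → i' < i + K → ¬ g i'

theorem TopGreedy.sep {K : ℕ} {S r : ℕ → Prop} (h : TopGreedy K S r) {i j : ℕ} (hi : r i)
    (hj : r j) (hij : i < j) : i + K ≤ j := by
  by_contra hc
  exact ((h j).1 hj).2 i hij (by omega) hi

theorem BotGreedy.sep {K : ℕ} {S g : ℕ → Prop} (h : BotGreedy K S g) {i j : ℕ} (hi : g i)
    (hj : g j) (hij : i < j) : i + K ≤ j := by
  by_contra hc
  exact ((h i).1 hi).2 j hij (by omega) hj

theorem TopGreedy.exists_le {K : ℕ} (hK : 0 < K) {S r : ℕ → Prop} (h : TopGreedy K S r) {i : ℕ}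
    (hi : S i) : ∃ i', r i' ∧ i' ≤ i ∧ i < i' + K := by
  by_cases hr : r i
  · exact ⟨i, hr, le_rfl, by omega⟩
  · have := mt (h i).2 hr
    push Not at this
    obtain ⟨i', h1, h2, h3⟩ := this hi
    exact ⟨i', h3, h1.le, h2⟩

theorem BotGreedy.exists_ge {K : ℕ} (hK : 0 < K) {S g : ℕ → Prop} (h : BotGreedy K S g) {i : ℕ}
    (hi : S i) : ∃ i', g i' ∧ i ≤ i' ∧ i' < i + K := by
  by_cases hr : g i
  · exact ⟨i, hr, le_rfl, by omega⟩
  · have := mt (h i).2 hr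
    push Not at this
    obtain ⟨i', h1, h2, h3⟩ := this hi
    exact ⟨i', h3, h1.le, h2⟩

/-- `M` is an initial segment of `r`. -/
structure Ini (r M : ℕ → Prop) : Prop where
  sub : ∀ i, M i → r i
  down : ∀ i i', M i → r i' → i' ≤ i → M i'

/-! ### Forward rotation -/

open Classical in
/-- Rotate the windows that start in `M`: the last entry, raised by `L`, comes first. -/
noncomputable def fw (L K : ℕ) (M : ℕ → Prop) (u : ℕ → ℕ) (i : ℕ) : ℕ :=
  if M i then u (i + K - 1) + L else if ∃ m, M m ∧ m < i ∧ i < m + K then u (i - 1) else u i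

/-- The index `i` is in no window that starts in `M`. -/
def Off (K : ℕ) (M : ℕ → Prop) (i : ℕ) : Prop := ∀ m, M m → i < m ∨ m + K ≤ i

section forward

variable {L K n : ℕ} {u : ℕ → ℕ} {r M : ℕ → Prop}

theorem fw_start {i : ℕ} (h : M i) : fw L K M u i = u (i + K - 1) + L := by
  simp [fw, h]

theorem fw_inside (hr : TopGreedy K (KS L K n u) r) (hM : Ini r M) {m i : ℕ} (hm : M m)
    (h1 : m < i) (h2 : i < m + K) : fw L K M u i = u (i - 1) := by
  have h : ¬ M i := fun hi => by
    have := hr.sep (hM.sub _ hm) (hM.sub _ hi) h1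
    omega
  rw [fw, if_neg h, if_pos ⟨m, hm, h1, h2⟩]

theorem fw_off (hK : 0 < K) {i : ℕ} (h : Off K M i) : fw L K M u i = u i := by
  rw [fw, if_neg fun hi => by have := h i hi; omega, if_neg]
  rintro ⟨m, hm, h1, h2⟩
  have := h m hm
  omega

theorem off_cases (K : ℕ) (M : ℕ → Prop) (i : ℕ) :
    M i ∨ (∃ m, M m ∧ m < i ∧ i < m + K) ∨ Off K M i := by
  by_cases h : Off K M i
  · exact Or.inr (Or.inr h)
  · simp only [Off, not_forall, not_or, not_lt, not_le] at h
    obtain ⟨m, hm, h1, h2⟩ := h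
    rcases h1.lt_or_eq with h3 | rfl
    · exact Or.inr (Or.inl ⟨m, hm, h3, h2⟩)
    · exact Or.inl hm

theorem ks_of_mem (hr : TopGreedy K (KS L K n u) r) (hM : Ini r M) {m : ℕ} (hm : M m) :
    KS L K n u m := ((hr m).1 (hM.sub m hm)).1

theorem le_fw (hK : 2 ≤ K) (hu : Adm L K n u) (hr : TopGreedy K (KS L K n u) r) (hM : Ini r M)
    {i : ℕ} (hi : i < n) : u i ≤ fw L K M u i := by
  rcases off_cases K M i with h | ⟨m, hm, h1, h2⟩ | h
  · rw [fw_start h]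
    exact (ks_of_mem hr hM h).2.le
  · rw [fw_inside hr hM hm h1 h2]
    exact hu.anti _ _ (by omega) hi
  · rw [fw_off (by omega) h]

/-- A window start above a rotated window is not near the end of the window before it. -/
theorem not_ks_of_off (hr : TopGreedy K (KS L K n u) r) (hM : Ini r M) (hK : 2 ≤ K)
    {i m : ℕ} (h : Off K M i) (hm : M m) (him : i < m) : ¬ KS L K n u i := fun hS => by
  obtain ⟨i', h1, h2, h3⟩ := hr.exists_le (by omega) hS
  have := h i' (hM.down m i' hm h1 (by omega))
  omega

/-- The gap condition at the entry just before a rotated window leaves room for its raised last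
entry. With `le_fw`, old and new values interlace: `u (i + 1) ≤ fw (i + 1) ≤ u i ≤ fw i`. -/
theorem fw_le (hK : 2 ≤ K) (hu : Adm L K n u) (hr : TopGreedy K (KS L K n u) r) (hM : Ini r M)
    {i : ℕ} (hi : i + 1 < n) : fw L K M u (i + 1) ≤ u i := by
  rcases off_cases K M (i + 1) with h | ⟨m, hm, h1, h2⟩ | h
  · rw [fw_start h]
    have h1 := (ks_of_mem hr hM h).1
    have h2 := hu.gap i (by omega)
    have e : i + 1 + K - 1 = i + K := by omega
    rw [e]
    simp only [Nr, not_or] at h2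
    omega
  · rw [fw_inside hr hM hm h1 h2]; simp
  · rw [fw_off (by omega) h]
    exact hu.anti _ _ (by omega) hi

theorem fw_anti (hK : 2 ≤ K) (hu : Adm L K n u) (hr : TopGreedy K (KS L K n u) r) (hM : Ini r M)
    (i j : ℕ) (hij : i ≤ j) (hj : j < n) : fw L K M u j ≤ fw L K M u i := by
  induction j, hij using Nat.le_induction with
  | base => exact le_rfl
  | succ j hij ih =>
    exact ((fw_le hK hu hr hM hj).trans (le_fw hK hu hr hM (by omega))).trans (ih (by omega))

theorem fw_adm (hK : 2 ≤ K) (hu : Adm L K n u) (hr : TopGreedy K (KS L K n u) r)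
    (hM : Ini r M) : Adm L K n (fw L K M u) where
  anti := fw_anti hK hu hr hM
  pos i hi := (hu.pos i hi).trans (le_fw hK hu hr hM hi)
  strict i hi he := by
    -- Interlacing squeezes two equal neighbours to the common value `u i`.
    have h1 := fw_le hK hu hr hM hi
    have h2 := le_fw hK hu hr hM (i := i) (by omega)
    have h3 : fw L K M u i = u i := by omega
    have h4 : fw L K M u (i + 1) = u i := by omega
    rw [h3]
    by_contra h0
    rcases off_cases K M i with h | ⟨m, hm, h5, h6⟩ | h
    · rw [fw_start h] at h3
      have := (ks_of_mem hr hM h).2.lt h0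
      omega
    · rw [fw_inside hr hM hm h5 h6] at h3
      have := hu.strict (i - 1) (by omega) (by rw [Nat.sub_add_cancel (by omega)]; exact h3.symm)
      rw [h3] at this
      exact h0 this
    · rcases off_cases K M (i + 1) with h' | ⟨m, hm, h5, h6⟩ | h'
      · apply not_ks_of_off hr hM hK h h' (by omega)
        have h7 := (ks_of_mem hr hM h').1
        refine ⟨by omega, Or.inl ?_⟩
        rw [fw_start h'] at h4
        have h8 : u (i + 1 + K - 1) % L ≠ 0 := by
          rw [← h4, Nat.add_mod_right] at h0
          exact h0
        have := hu.lt_of_strict' (i := i + K - 1) (j := i + 1 + K - 1) (by omega) (by omega) h8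
        omega
      · have := h m hm
        omega
      · rw [fw_off (by omega) h'] at h4
        exact h0 (hu.strict i hi h4)
  gap i hi hn := by
    -- By interlacing, nearness to the new entry `i + K` implies nearness to the old entry `i + K -
    -- 1`. This gives either a forbidden pair of old entries or a window that the greedy choice
    -- would have taken.
    have h1 := fw_le hK hu hr hM (i := i + K - 1) (by omega)
    rw [show i + K - 1 + 1 = i + K by omega] at h1
    rcases off_cases K M i with h | ⟨m, hm, h5, h6⟩ | h
    · rw [fw_start h] at hn
      have h0 := ks_of_mem hr hM h
      rcases off_cases K M (i + K) with h' | ⟨m, hm, h5, h6⟩ | h'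
      · rw [fw_start h', nr_add] at hn
        have := (ks_of_mem hr hM h').1
        refine hu.gap (i + K - 1) (by omega) ?_
        rw [show i + K - 1 + K = i + K + K - 1 by omega]
        exact hn
      · rcases lt_or_ge i m with h7 | h7
        · have := hr.sep (hM.sub _ h) (hM.sub _ hm) h7
          omega
        · omega
      · rw [fw_off (by omega) h'] at hn
        have h7 := hn.le
        have h8 := hu.anti (i + K - 1) (i + K) (by omega) hi
        have h9 : u (i + K) = u (i + K - 1) := by omega
        exact hu.gap i hi (h9 ▸ h0.2)
    · rw [fw_inside hr hM hm h5 h6] at hn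
      refine hu.gap (i - 1) (by omega) (hn.mono le_rfl ?_)
      rw [show i - 1 + K = i + K - 1 by omega]
      exact h1
    · rw [fw_off (by omega) h] at hn
      rcases off_cases K M (i + K) with h' | ⟨m, hm, h5, h6⟩ | h'
      · exact not_ks_of_off hr hM hK h h' (by omega) ⟨by omega, hn.mono le_rfl h1⟩
      · have := h m hm
        exact not_ks_of_off hr hM hK h hm (by omega) ⟨by omega, hn.mono le_rfl h1⟩
      · rw [fw_off (by omega) h'] at hn
        exact hu.gap i hi hn

/-- Rotated windows remain windows of near entries. -/
theorem fw_ks_start (hK : 2 ≤ K) (hu : Adm L K n u) (hr : TopGreedy K (KS L K n u) r)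
    (hM : Ini r M) {m : ℕ} (hm : M m) : KS L K n (fw L K M u) m := by
  have h0 := ks_of_mem hr hM hm
  refine ⟨h0.1, ?_⟩
  have := h0.1
  rw [fw_start hm, fw_inside hr hM hm (i := m + K - 1) (by omega) (by omega)]
  have h1 := hu.anti (m + K - 1 - 1) (m + K - 1) (by omega) (by omega)
  rcases h1.lt_or_eq with h2 | h2
  · left; omega
  · right
    refine ⟨by omega, ?_⟩
    rw [Nat.add_mod_right, h2]
    have := hu.strict (m + K - 1 - 1) (by omega) (by rw [show m + K - 1 - 1 + 1 = m + K - 1 by omega, h2])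
    exact this

theorem fw_eq_of_ge (hK : 2 ≤ K) {i : ℕ} (h : ∀ m, M m → m + K ≤ i) : fw L K M u i = u i :=
  fw_off (by omega) fun m hm => Or.inr (h m hm)

theorem fw_ks_of_ge (hK : 2 ≤ K) {i : ℕ} (h : ∀ m, M m → m + K ≤ i) :
    KS L K n (fw L K M u) i ↔ KS L K n u i := by
  rw [KS, KS, fw_eq_of_ge hK h, fw_eq_of_ge hK fun m hm => (h m hm).trans (by omega)]

/-- A window of the rotated sequence that starts strictly inside a rotated window meets another
rotated window. -/
theorem fw_ks_inside (hK : 2 ≤ K) (hu : Adm L K n u) (hr : TopGreedy K (KS L K n u) r)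
    (hM : Ini r M) {m i : ℕ} (hm : M m) (h1 : m < i) (h2 : i < m + K)
    (hS : KS L K n (fw L K M u) i) : ∃ m', M m' ∧ i < m' ∧ m' < i + K := by
  by_contra hc
  push Not at hc
  have hoff : Off K M (i + K - 1) := fun m' hm' => by
    rcases lt_or_ge i m' with h | h
    · have := hc m' hm' h
      omega
    · rcases lt_trichotomy m m' with h' | rfl | h'
      · have := hr.sep (hM.sub _ hm) (hM.sub _ hm') h'
        omega
      · omega
      · have := hr.sep (hM.sub _ hm') (hM.sub _ hm) h'
        omega
  have h3 := hS.2
  have h4 := hS.1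
  rw [fw_off (by omega) hoff, fw_inside hr hM hm h1 h2] at h3
  refine hu.gap (i - 1) (by omega) ?_
  rw [show i - 1 + K = i + K - 1 by omega]
  exact h3

variable {g : ℕ → Prop}

/-- Induction from the bottom. A bottom-greedy start inside the rotated window would have a window
meeting a later rotated one by `fw_ks_inside`; the start of the latter is bottom-greedy by
induction, and greedy windows are disjoint. -/
theorem fw_mem_bot (hK : 2 ≤ K) (hu : Adm L K n u) (hr : TopGreedy K (KS L K n u) r)
    (hM : Ini r M) (hg : BotGreedy K (KS L K n (fw L K M u)) g) {m : ℕ} (hm : M m) : g m := by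
  have hn := (ks_of_mem hr hM hm).1
  induction hd : n - m using Nat.strong_induction_on generalizing m with
  | _ d ih =>
    refine (hg m).2 ⟨fw_ks_start hK hu hr hM hm, fun i h1 h2 hi => ?_⟩
    obtain ⟨m', hm', h3, h4⟩ := fw_ks_inside hK hu hr hM hm h1 h2 ((hg i).1 hi).1
    have h5 := (ks_of_mem hr hM hm').1
    exact ((hg i).1 hi).2 m' h3 h4 (ih (n - m') (by omega) hm' h5 rfl)

/-- Together with `fw_mem_bot`, this makes `M` an initial segment of the bottom-greedy starts, so
the backward move picks exactly the rotated windows. An intruding start outside all rotated windows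
would give an untouched window of `u`, which the top-greedy choice cannot have skipped. -/
theorem fw_bot_mem (hK : 2 ≤ K) (hu : Adm L K n u) (hr : TopGreedy K (KS L K n u) r)
    (hM : Ini r M) (hg : BotGreedy K (KS L K n (fw L K M u)) g) {m i : ℕ} (hm : M m) (hi : g i)
    (him : i < m + K) : M i := by
  by_contra hc
  have hno : ∀ m', M m' → i < m' → m' < i + K → False := fun m' hm' h1 h2 =>
    ((hg i).1 hi).2 m' h1 h2 (fw_mem_bot hK hu hr hM hg hm')
  have hS := ((hg i).1 hi).1
  rcases off_cases K M i with h | ⟨m', hm', h1, h2⟩ | h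
  · exact hc h
  · obtain ⟨m'', hm'', h3, h4⟩ := fw_ks_inside hK hu hr hM hm' h1 h2 hS
    exact hno m'' hm'' h3 h4
  · have him' : i < m := by have := h m hm; omega
    have h' : Off K M (i + K - 1) := fun m' hm' => by
      have h3 := h m' hm'
      have h4 := hno m' hm'
      by_contra h5
      rcases h3 with h3 | h3
      · exact h4 h3 (by omega)
      · omega
    refine not_ks_of_off hr hM hK h hm him' ⟨hS.1, ?_⟩
    have := hS.2
    rwa [fw_off (by omega) h, fw_off (by omega) h'] at this

theorem fw_bot_ge (hK : 2 ≤ K) (hu : Adm L K n u) (hr : TopGreedy K (KS L K n u) r)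
    (hM : Ini r M) (hg : BotGreedy K (KS L K n (fw L K M u)) g) {i : ℕ} (hi : g i) (hiM : ¬ M i)
    (m : ℕ) (hm : M m) : m + K ≤ i := by
  by_contra hc
  exact hiM (fw_bot_mem hK hu hr hM hg hm hi (by omega))

/-- Each top-greedy window of `u` meets a bottom-greedy window of the rotated sequence. -/
theorem fw_exists_bot (hK : 2 ≤ K) (hu : Adm L K n u) (hr : TopGreedy K (KS L K n u) r)
    (hM : Ini r M) (hg : BotGreedy K (KS L K n (fw L K M u)) g) {i : ℕ} (hi : r i) :
    ∃ i', g i' ∧ i ≤ i' ∧ i' < i + K := by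
  by_cases h : M i
  · exact ⟨i, fw_mem_bot hK hu hr hM hg h, le_rfl, by omega⟩
  · refine hg.exists_ge (by omega) ((fw_ks_of_ge hK fun m hm => ?_).2 ((hr i).1 hi).1)
    rcases lt_trichotomy m i with h' | rfl | h'
    · exact hr.sep (hM.sub _ hm) hi h'
    · exact absurd hm h
    · exact absurd (hM.down m i hm hi h'.le) h

theorem fw_exists_top (hK : 2 ≤ K) (hu : Adm L K n u) (hr : TopGreedy K (KS L K n u) r)
    (hM : Ini r M) (hg : BotGreedy K (KS L K n (fw L K M u)) g) {i : ℕ} (hi : g i) :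
    ∃ i', r i' ∧ i' ≤ i ∧ i < i' + K := by
  by_cases h : M i
  · exact ⟨i, hM.sub i h, le_rfl, by omega⟩
  · exact hr.exists_le (by omega) ((fw_ks_of_ge hK (fw_bot_ge hK hu hr hM hg hi h)).1
      ((hg i).1 hi).1)

end forward

/-! ### Backward rotation -/

open Classical in
/-- Rotate the windows that start in `M`: the first entry, lowered by `L`, comes last. -/
noncomputable def bw (L K : ℕ) (M : ℕ → Prop) (u : ℕ → ℕ) (i : ℕ) : ℕ :=
  if ∃ m, M m ∧ i + 1 = m + K then u (i + 1 - K) - L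
  else if ∃ m, M m ∧ m ≤ i ∧ i + 1 < m + K then u (i + 1) else u i

section backward

variable {L K n : ℕ} {u : ℕ → ℕ} {g M : ℕ → Prop}

theorem Ini.ks_bot (hg : BotGreedy K (KS L K n u) g) (hM : Ini g M) {m : ℕ} (hm : M m) :
    KS L K n u m := ((hg m).1 (hM.sub m hm)).1

theorem bw_last (hK : 2 ≤ K) {m : ℕ} (hm : M m) : bw L K M u (m + K - 1) = u m - L := by
  rw [bw, if_pos ⟨m, hm, by omega⟩]
  congr 2
  omega

theorem bw_inside (hg : BotGreedy K (KS L K n u) g) (hM : Ini g M) {m i : ℕ}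
    (hm : M m) (h1 : m ≤ i) (h2 : i + 1 < m + K) : bw L K M u i = u (i + 1) := by
  rw [bw, if_neg, if_pos ⟨m, hm, h1, h2⟩]
  rintro ⟨m', hm', h⟩
  rcases lt_trichotomy m m' with h' | rfl | h'
  · have := hg.sep (hM.sub _ hm) (hM.sub _ hm') h'
    omega
  · omega
  · have := hg.sep (hM.sub _ hm') (hM.sub _ hm) h'
    omega

theorem bw_off (hK : 2 ≤ K) {i : ℕ} (h : Off K M i) : bw L K M u i = u i := by
  rw [bw, if_neg, if_neg]
  · rintro ⟨m, hm, h1, h2⟩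
    have := h m hm
    omega
  · rintro ⟨m, hm, h1⟩
    have := h m hm
    omega

theorem off_cases' (hK : 2 ≤ K) (M : ℕ → Prop) (i : ℕ) :
    (∃ m, M m ∧ i = m + K - 1) ∨ (∃ m, M m ∧ m ≤ i ∧ i + 1 < m + K) ∨ Off K M i := by
  rcases off_cases K M i with h | ⟨m, hm, h1, h2⟩ | h
  · exact Or.inr (Or.inl ⟨i, h, le_rfl, by omega⟩)
  · by_cases h3 : i + 1 < m + K
    · exact Or.inr (Or.inl ⟨m, hm, h1.le, h3⟩)
    · exact Or.inl ⟨m, hm, by omega⟩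
  · exact Or.inr (Or.inr h)

/-- The condition for a backward move: the entries in `M` can be lowered, and no window lies
strictly below the last of them and at most `2 L` below it. -/
structure Lowerable (L K n : ℕ) (u : ℕ → ℕ) (M : ℕ → Prop) : Prop where
  ge : ∀ m, M m → L + 2 ≤ u m
  no_set : ∀ m, M m → (∀ m', M m' → m' ≤ m) → ∀ i, KS L K n u i → u i < u m →
    ¬ Nr L (u m) (u (i + K - 1) + L)

variable (hK : 2 ≤ K) (hu : Adm L K n u) (hg : BotGreedy K (KS L K n u) g) (hM : Ini g M)
  (hl : Lowerable L K n u M)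

include hK hu hg hM in
theorem bw_le {i : ℕ} (hi : i < n) : bw L K M u i ≤ u i := by
  rcases off_cases' hK M i with ⟨m, hm, rfl⟩ | ⟨m, hm, h1, h2⟩ | h
  · rw [bw_last hK hm]
    have := (hM.ks_bot hg hm).2.le
    omega
  · rw [bw_inside hg hM hm h1 h2]
    exact hu.anti _ _ (by omega) (by have := (hM.ks_bot hg hm).1; omega)
  · rw [bw_off hK h]

include hK hu hg hM hl in
-- The mirror image of the forward interlacing: the gap condition after a window leaves room for its
-- lowered first entry.
theorem le_bw {i : ℕ} (hi : i + 1 < n) : u (i + 1) ≤ bw L K M u i := by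
  rcases off_cases' hK M i with ⟨m, hm, rfl⟩ | ⟨m, hm, h1, h2⟩ | h
  · rw [bw_last hK hm]
    have := hu.gap m (by omega)
    have h3 := hl.ge m hm
    rw [show m + K - 1 + 1 = m + K by omega]
    simp only [Nr, not_or] at this
    omega
  · rw [bw_inside hg hM hm h1 h2]
  · rw [bw_off hK h]
    exact hu.anti _ _ (by omega) hi

include hK hu hg hM hl in
theorem bw_anti (i j : ℕ) (hij : i ≤ j) (hj : j < n) : bw L K M u j ≤ bw L K M u i := by
  induction j, hij using Nat.le_induction with
  | base => exact le_rfl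
  | succ j hij ih =>
    exact ((bw_le hK hu hg hM hj).trans (le_bw hK hu hg hM hl hj)).trans (ih (by omega))

include hK hu hg hM hl in
/-- If the entry `K` after an interior position of a rotated window is not moved, there is no
window between the two. -/
theorem not_ks_of_inside {m i : ℕ} (hm : M m) (h1 : m ≤ i) (h2 : i + 1 < m + K)
    (h3 : Off K M (i + K)) : ¬ KS L K n u (i + 1) := fun hS => by
  obtain ⟨i', hi', h4, h5⟩ := hg.exists_ge (by omega) hS
  have hMi' : ¬ M i' := fun h => by have := h3 i' h; omega
  -- The bottom-greedy window just found is not rotated. Since `M` is an initial segment, no rotated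
  -- window comes after `m`, so `no_set` applies to `m`.
  have hmax : ∀ m', M m' → m' ≤ m := fun m' hm' => by
    by_contra hc
    have h6 := hg.sep (hM.sub _ hm) (hM.sub _ hm') (by omega)
    have h7 : m' < i' := by
      by_contra h8
      exact hMi' (hM.down _ _ hm' hi' (by omega))
    have := h3 m' hm'
    omega
  have hSn := hS.1
  have hm0 := hM.ks_bot hg hm
  refine hl.no_set m hm hmax _ hS ?_ ?_
  · by_contra hc
    refine hu.gap m (by omega) (hS.2.mono (by omega) (hu.anti _ _ (by omega) (by omega)))
  · have h6 := hu.anti (i + 1) (m + K - 1) (by omega) (by omega)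
    exact hm0.2.mono le_rfl (h6.trans hS.2.le)

include hK hu hg hM hl in
-- Interlacing does most of the work. The one new danger is an unrotated window directly below the
-- last rotated one; `Lowerable.no_set` excludes it, mostly through `not_ks_of_inside`.
theorem bw_adm : Adm L K n (bw L K M u) where
  anti := bw_anti hK hu hg hM hl
  pos i hi := by
    rcases off_cases' hK M i with ⟨m, hm, rfl⟩ | ⟨m, hm, h1, h2⟩ | h
    · rw [bw_last hK hm]
      have := hl.ge m hm
      omega
    · rw [bw_inside hg hM hm h1 h2]
      exact hu.pos _ (by have := (hM.ks_bot hg hm).1; omega)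
    · rw [bw_off hK h]
      exact hu.pos i hi
  strict i hi he := by
    have h1 := bw_le hK hu hg hM hi
    have h2 := le_bw hK hu hg hM hl hi
    have h3 : u (i + 1) = bw L K M u i := by omega
    have h4 : bw L K M u (i + 1) = u (i + 1) := by omega
    rw [← h3]
    by_contra h0
    rcases off_cases' hK M i with ⟨m, hm, rfl⟩ | ⟨m, hm, h5, h6⟩ | h
    · rw [bw_last hK hm] at h3
      rw [show m + K - 1 + 1 = m + K by omega] at h0 h3 h4 hi
      have h7 := hl.ge m hm
      have h8 : u m = u (m + K) + L := by omega
      have h9 : u m % L ≠ 0 := by rwa [h8, Nat.add_mod_right]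
      rcases off_cases' hK M (m + K) with ⟨m', hm', h5⟩ | ⟨m', hm', h5, h6⟩ | h
      · have := hg.sep (hM.sub _ hm) (hM.sub _ hm') (by omega)
        omega
      · have h6' := (hM.ks_bot hg hm').1
        rw [bw_inside hg hM hm' h5 h6] at h4
        have := hu.strict (m + K) (by omega) h4
        exact h0 this
      · refine not_ks_of_inside hK hu hg hM hl hm le_rfl (by omega) h ⟨by omega, Or.inl ?_⟩
        rw [show m + 1 + K - 1 = m + K by omega, ← h8]
        exact hu.lt_of_strict_left (by omega) (by omega) h9
    · rcases off_cases' hK M (i + 1) with ⟨m', hm', h7⟩ | ⟨m', hm', h7, h8⟩ | h'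
      · rw [h7, bw_last hK hm'] at h4
        have h8 := hl.ge m' hm'
        rw [h7] at h0
        have h9 : u m' = u (m' + K - 1) + L := by omega
        have := (hM.ks_bot hg hm').2.lt (by rwa [h9, Nat.add_mod_right])
        omega
      · rw [bw_inside hg hM hm' h7 h8] at h4
        exact h0 (hu.strict _ (by have := (hM.ks_bot hg hm').1; omega) h4)
      · have := h' m hm
        omega
    · rw [bw_off hK h] at h3
      exact h0 (h3 ▸ hu.strict i hi h3)
  gap i hi hn := by
    have hle := bw_le hK hu hg hM hi
    rcases off_cases' hK M i with ⟨m, hm, rfl⟩ | ⟨m, hm, h1, h2⟩ | h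
    · rw [bw_last hK hm] at hn
      have hge := hl.ge m hm
      rw [show m + K - 1 + K = m + K + K - 1 by omega] at hi hn
      have h0 : u (m + K) ≤ u m - L := by
        have := hu.gap m (by omega)
        simp only [Nr, not_or] at this
        omega
      rcases off_cases' hK M (m + K + K - 1) with ⟨m', hm', h1⟩ | ⟨m', hm', h1, h2⟩ | h
      · obtain rfl : m' = m + K := by omega
        rw [bw_last hK hm'] at hn
        have := hl.ge _ hm'
        have h5 : Nr L (u m) (u (m + K)) := by
          rw [← nr_add (a := u m - L) (b := u (m + K) - L)] at hn
          rwa [Nat.sub_add_cancel (by omega), Nat.sub_add_cancel (by omega)] at hn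
        exact hu.gap m (by omega) h5
      · have hn' := (hM.ks_bot hg hm').1
        rw [bw_inside hg hM hm' h1 h2] at hn
        refine hu.gap (m + K) (by omega) (hn.mono h0 (le_of_eq ?_))
        congr 1
        omega
      · rw [bw_off hK h] at hn
        have hS : KS L K n u (m + K) := ⟨by omega, hn.mono h0 le_rfl⟩
        obtain ⟨i', hi', h4, h5⟩ := hg.exists_ge (by omega) hS
        have hMi' : ¬ M i' := fun h' => by have := h i' h'; omega
        have hmax : ∀ m', M m' → m' ≤ m := fun m' hm' => by
          by_contra hc
          have h6 := hg.sep (hM.sub _ hm) (hM.sub _ hm') (by omega)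
          have h7 : m' < i' := by
            by_contra h8
            exact hMi' (hM.down _ _ hm' hi' (by omega))
          have := h m' hm'
          omega
        refine hl.no_set m hm hmax _ hS ?_ ?_
        -- Here `L` may be zero, but then no window of positive entries exists.
        · rcases Nat.eq_zero_or_pos L with rfl | hL
          · rcases (hM.ks_bot hg hm).2 with h6 | ⟨_, h6⟩
            · have := hu.anti m (m + K - 1) (by omega) (by omega)
              omega
            · rw [Nat.mod_zero] at h6
              omega
          · omega
        have := (nr_add (L := L)).2 hn
        rwa [Nat.sub_add_cancel (by omega)] at this
    · have hn' := (hM.ks_bot hg hm).1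
      rw [bw_inside hg hM hm h1 h2] at hn
      rcases off_cases' hK M (i + K) with ⟨m', hm', h3⟩ | ⟨m', hm', h3, h4⟩ | h
      · have := hg.sep (hM.sub _ hm) (hM.sub _ hm') (by omega)
        omega
      · have hn'' := (hM.ks_bot hg hm').1
        rw [bw_inside hg hM hm' h3 h4] at hn
        refine hu.gap (i + 1) (by omega) (hn.mono le_rfl (le_of_eq ?_))
        congr 1
        omega
      · rw [bw_off hK h] at hn
        refine not_ks_of_inside hK hu hg hM hl hm h1 h2 h ⟨by omega, hn.mono le_rfl (le_of_eq ?_)⟩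
        congr 1
        omega
    · rw [bw_off hK h] at hn
      exact hu.gap i hi (hn.mono le_rfl hle)

include hK hu hg hM hl in
theorem bw_ks_start {m : ℕ} (hm : M m) : KS L K n (bw L K M u) m := by
  have h0 := hM.ks_bot hg hm
  have h1 := h0.1
  have h3 := hl.ge m hm
  refine ⟨h1, ?_⟩
  rw [bw_last hK hm, bw_inside hg hM hm le_rfl (by omega)]
  have h2 := hu.anti m (m + 1) (by omega) (by omega)
  rcases h2.lt_or_eq with h2 | h2
  · left; omega
  · exact Or.inr ⟨by omega, h2 ▸ hu.strict m (by omega) h2⟩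

theorem bw_eq_of_ge (hK : 2 ≤ K) {i : ℕ} (h : ∀ m, M m → m + K ≤ i) : bw L K M u i = u i :=
  bw_off hK fun m hm => Or.inr (h m hm)

theorem bw_ks_of_ge (hK : 2 ≤ K) {i : ℕ} (h : ∀ m, M m → m + K ≤ i) :
    KS L K n (bw L K M u) i ↔ KS L K n u i := by
  rw [KS, KS, bw_eq_of_ge hK h, bw_eq_of_ge hK fun m hm => (h m hm).trans (by omega)]

include hK hu hg hM in
/-- A window of the lowered sequence that is off the rotated windows does not reach into one. -/
theorem bw_not_ks_overlap {m i : ℕ} (hm : M m) (h1 : i < m) (h2 : m < i + K) (h : Off K M i) :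
    ¬ KS L K n (bw L K M u) i := fun hS => by
  have h3 := (hM.ks_bot hg hm).1
  have h4 := hS.2
  rw [bw_off hK h, bw_inside hg hM hm (i := i + K - 1) (by omega) (by omega)] at h4
  refine hu.gap i (by omega) (h4.mono le_rfl (le_of_eq ?_))
  congr 1
  omega

variable {r : ℕ → Prop} (hr : TopGreedy K (KS L K n (bw L K M u)) r)

include hK hu hg hM hl hr in
-- Induction from the top: an earlier top-greedy window overlapping `m` would start inside a rotated
-- window, already known to be top-greedy, or outside all of them, contrary to `bw_not_ks_overlap`.
theorem bw_mem_top {m : ℕ} (hm : M m) : r m := by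
  induction m using Nat.strong_induction_on with
  | _ m ih =>
    refine (hr m).2 ⟨bw_ks_start hK hu hg hM hl hm, fun i h1 h2 hi => ?_⟩
    rcases off_cases K M i with h | ⟨m', hm', h3, h4⟩ | h
    · have := hg.sep (hM.sub _ h) (hM.sub _ hm) h1
      omega
    · have := hr.sep (ih m' (by omega) hm') hi h3
      omega
    · exact bw_not_ks_overlap hK hu hg hM hm h1 h2 h ((hr i).1 hi).1

include hK hu hg hM hl hr in
theorem bw_top_mem {m i : ℕ} (hm : M m) (hi : r i) (him : i < m + K) : M i := by
  by_contra hc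
  rcases off_cases K M i with h | ⟨m', hm', h3, h4⟩ | h
  · exact hc h
  · have := hr.sep (bw_mem_top hK hu hg hM hl hr hm') hi h3
    omega
  · have hS := ((hr i).1 hi).1
    have h0 : i < m := by have := h m hm; omega
    have hno : ∀ m', M m' → i < m' → i + K ≤ m' := fun m' hm' h1 => by
      by_contra h2
      exact bw_not_ks_overlap hK hu hg hM hm' h1 (by omega) h hS
    have h' : Off K M (i + K - 1) := fun m' hm' => by
      have h3 := h m' hm'
      have h4 := hno m' hm'
      omega
    have hS' : KS L K n u i := by
      have := hS.2
      rw [bw_off hK h, bw_off hK h'] at this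
      exact ⟨hS.1, this⟩
    obtain ⟨i', hi', h1, h2⟩ := hg.exists_ge (by omega) hS'
    have h5 := hno m hm h0
    have hMi := hM.down m i' hm hi' (by omega)
    rcases h1.lt_or_eq with h1 | rfl
    · have := hno i' hMi h1
      omega
    · exact hc hMi

include hK hu hg hM hl hr in
theorem bw_top_ge {i : ℕ} (hi : r i) (hiM : ¬ M i) (m : ℕ) (hm : M m) : m + K ≤ i := by
  by_contra hc
  exact hiM (bw_top_mem hK hu hg hM hl hr hm hi (by omega))

include hK hu hg hM hl hr in
theorem bw_exists_top {i : ℕ} (hi : g i) : ∃ i', r i' ∧ i' ≤ i ∧ i < i' + K := by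
  by_cases h : M i
  · exact ⟨i, bw_mem_top hK hu hg hM hl hr h, le_rfl, by omega⟩
  · refine hr.exists_le (by omega) ((bw_ks_of_ge hK fun m hm => ?_).2 ((hg i).1 hi).1)
    rcases lt_trichotomy m i with h' | rfl | h'
    · exact hg.sep (hM.sub _ hm) hi h'
    · exact absurd hm h
    · exact absurd (hM.down m i hm hi h'.le) h

include hK hu hg hM hl hr in
theorem bw_exists_bot {i : ℕ} (hi : r i) : ∃ i', g i' ∧ i ≤ i' ∧ i' < i + K := by
  by_cases h : M i
  · exact ⟨i, hM.sub i h, le_rfl, by omega⟩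
  · exact hg.exists_ge (by omega) ((bw_ks_of_ge hK (bw_top_ge hK hu hg hM hl hr hi h)).1
      ((hr i).1 hi).1)

end backward

/-! ### The two rotations undo each other -/

section inverse

variable {L K n : ℕ} {u : ℕ → ℕ} {M : ℕ → Prop}

theorem bw_fw {r : ℕ → Prop} (hK : 2 ≤ K) (hr : TopGreedy K (KS L K n u) r) (hM : Ini r M)
    (i : ℕ) : bw L K M (fw L K M u) i = u i := by
  have hsep : ∀ m m', M m → M m' → m < m' → m + K ≤ m' := fun m m' hm hm' h =>
    hr.sep (hM.sub _ hm) (hM.sub _ hm') h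
  rcases off_cases' hK M i with ⟨m, hm, rfl⟩ | ⟨m, hm, h1, h2⟩ | h
  · rw [bw_last hK hm, fw_start hm]; omega
  · rw [bw, if_neg, if_pos ⟨m, hm, h1, h2⟩, fw_inside hr hM hm (by omega) h2]
    · simp
    · rintro ⟨m', hm', h3⟩
      rcases lt_trichotomy m m' with h' | rfl | h'
      · have := hsep _ _ hm hm' h'
        omega
      · omega
      · have := hsep _ _ hm' hm h'
        omega
  · rw [bw_off hK h, fw_off (by omega) h]

theorem fw_bw {g : ℕ → Prop} (hK : 2 ≤ K) (hg : BotGreedy K (KS L K n u) g) (hM : Ini g M)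
    (hl : Lowerable L K n u M) (i : ℕ) : fw L K M (bw L K M u) i = u i := by
  have hsep : ∀ m m', M m → M m' → m < m' → m + K ≤ m' := fun m m' hm hm' h =>
    hg.sep (hM.sub _ hm) (hM.sub _ hm') h
  rcases off_cases K M i with h | ⟨m, hm, h1, h2⟩ | h
  · rw [fw_start h, bw_last hK h]
    have := hl.ge i h
    omega
  · rw [fw, if_neg, if_pos ⟨m, hm, h1, h2⟩, bw_inside hg hM hm (by omega) (by omega),
      Nat.sub_add_cancel (by omega)]
    intro hi
    have := hsep _ _ hm hi h1
    omega
  · rw [fw_off (by omega) h, bw_off hK h]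

end inverse

/-! ### Moving one entry to the neighbouring slot -/

theorem add_one_mod_eq_zero {L a : ℕ} (hL : 3 ≤ L) (h : a % L = L - 1) : (a + 1) % L = 0 := by
  rw [Nat.add_mod, h, Nat.mod_eq_of_lt (a := 1) (by omega), Nat.sub_add_cancel (by omega),
    Nat.mod_self]

theorem sub_one_mod_eq {L a : ℕ} (hL : 3 ≤ L) (h : a % L = 0) (ha : 0 < a) :
    (a - 1) % L = L - 1 := by
  obtain ⟨x, rfl⟩ := Nat.dvd_of_mod_eq_zero h
  obtain ⟨x, rfl⟩ : ∃ y, x = y + 1 := ⟨x - 1, by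
    rcases Nat.eq_zero_or_pos x with rfl | h'
    · simp at ha
    · omega⟩
  rw [show L * (x + 1) - 1 = L - 1 + L * x by rw [mul_add]; omega, Nat.add_mul_mod_self_left,
    Nat.mod_eq_of_lt (by omega)]

/-- A slot congruent to `-1` must be strictly closer than `L`, while the next slot, a multiple of
`L`, may be at distance exactly `L`. The two conditions coincide, so bumping the upper entry never
changes nearness. -/
theorem nr_succ_iff {L a b : ℕ} (hL : 3 ≤ L) (h : a % L = L - 1) : Nr L (a + 1) b ↔ Nr L a b := by
  constructor
  · intro h1
    left
    have := h1.le
    omega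
  · intro h1
    have := h1.lt (by omega)
    rcases Nat.lt_or_ge (a + 1) (b + L) with h2 | h2
    · exact Or.inl h2
    · exact Or.inr ⟨by omega, add_one_mod_eq_zero hL h⟩

theorem Nr.trans_add {L a b d c : ℕ} (h1 : Nr L a b) (h2 : b ≤ d) (h3 : Nr L d c) :
    Nr L a (c + L) := by
  have h4 := h3.le
  rcases h1 with h | ⟨h, h0⟩
  · left; omega
  · by_cases h5 : a < c + L + L
    · exact Or.inl h5
    · exact Or.inr ⟨by omega, h0⟩

section

variable {L K n : ℕ} {u : ℕ → ℕ}

/-- Distinct congruent slots differ by at least `L`, and a window spans `L` only if its first entry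
is a multiple of `L`. In particular a window has at most one entry congruent to `-1`. -/
theorem eq_of_mod_eq_of_ks (hu : Adm L K n u) {s i j : ℕ} (hs : KS L K n u s)
    (hi : s ≤ i) (hi' : i < s + K) (hj : s ≤ j) (hj' : j < s + K) (hm : u i % L = u j % L)
    (h0 : u j % L ≠ 0) : i = j := by
  have hn := hs.1
  have main : ∀ i j, s ≤ i → i < j → j < s + K → u i % L = u j % L → u j % L ≠ 0 → False := by
    intro i j hi hij hj hm h0
    have h1 := hu.lt_of_strict' hij (by omega) h0
    have h2 : u j + L ≤ u i := by
      have hd : L ∣ u i - u j := (Nat.modEq_iff_dvd' h1.le).1 hm.symm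
      have := Nat.le_of_dvd (by omega) hd
      omega
    have h3 := hu.anti s i hi (by omega)
    have h4 := hu.anti j (s + K - 1) (by omega) (by omega)
    have h5 := hs.2.le
    have h6 : u s = u i := by omega
    have := hs.2.lt (by rw [h6, hm]; exact h0)
    omega
  rcases lt_trichotomy i j with h | h | h
  · exact (main i j hi h hj' hm h0).elim
  · exact h
  · exact (main j i hj h hi' hm.symm (hm ▸ h0)).elim

/-- By `nr_succ_iff` the bump creates no nearness downwards; only nearness to the entry `K` places
above has to be excluded by `hgap`. -/
theorem bump_adm (hL : 3 ≤ L) (hK : 2 ≤ K) (hu : Adm L K n u) {j : ℕ} (hj : j < n)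
    (h0 : u j % L = L - 1) (hgap : ∀ i, i + K = j → ¬ Nr L (u i) (u j + 1)) :
    Adm L K n (Function.update u j (u j + 1)) where
  anti i i' hi hi' := by
    have h1 := hu.anti i i' hi hi'
    simp only [Function.update_apply]
    split_ifs with h2 h3 h3
    · exact le_rfl
    · subst h2
      exact hu.lt_of_strict' (by omega) hj (by omega)
    · subst h3; omega
    · exact h1
  pos i hi := by
    have h1 := hu.pos i hi
    simp only [Function.update_apply]
    split_ifs with h
    · subst h; omega
    · exact h1
  strict i hi := by
    simp only [Function.update_apply]
    split_ifs with h2 h3 h3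
    · omega
    · intro _
      have := hu.lt_of_strict hi (by rw [h2]; omega)
      rename_i h
      rw [← h]
      exact add_one_mod_eq_zero hL h0
    · intro _
      exact add_one_mod_eq_zero hL h0
    · exact hu.strict i hi
  gap i hi := by
    simp only [Function.update_apply]
    split_ifs with h2 h3 h3
    · omega
    · subst h2
      rw [nr_succ_iff hL h0]
      exact hu.gap _ hi
    · exact hgap i h3
    · exact hu.gap i hi

theorem unbump_adm (hL : 3 ≤ L) (hK : 2 ≤ K) (hu : Adm L K n u) {j : ℕ} (hj : j < n)
    (h0 : u j % L = 0) (hlt : j + 1 < n → u (j + 1) + 1 < u j) :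
    Adm L K n (Function.update u j (u j - 1)) := by
  have hp := hu.pos j hj
  have hjL : L ≤ u j := Nat.le_of_dvd (by omega) (Nat.dvd_of_mod_eq_zero h0)
  have hm := sub_one_mod_eq hL h0 (by omega)
  have hlt' : ∀ i, j < i → i < n → u i + 1 < u j := fun i h1 h2 => by
    have := hu.anti (j + 1) i h1 h2
    have := hlt (by omega)
    omega
  constructor
  · intro i i' hi hi'
    have h1 := hu.anti i i' hi hi'
    simp only [Function.update_apply]
    split_ifs with h2 h3 h3
    · exact le_rfl
    · subst h2; omega
    · subst h3
      have := hlt' i' (by omega) hi'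
      omega
    · exact h1
  · intro i hi
    simp only [Function.update_apply]
    split_ifs with h2 h3 h3
    · omega
    · intro h4
      subst h2
      have := hu.anti i (i + 1) (by omega) hi
      omega
    · subst h3
      have := hlt hi
      omega
    · exact hu.strict i hi
  · intro i hi
    simp only [Function.update_apply]
    split_ifs with h2 h3 h3
    · omega
    · subst h2
      rw [← nr_succ_iff hL hm, Nat.sub_add_cancel (by omega)]
      exact hu.gap _ hi
    · intro h
      exact hu.gap i hi (h.mono le_rfl (by rw [h3]; omega))
    · exact hu.gap i hi
  · intro i hi
    have h1 := hu.pos i hi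
    simp only [Function.update_apply]
    split_ifs with h
    · omega
    · exact h1

theorem bump_ks (hL : 3 ≤ L) {j : ℕ} (h0 : u j % L = L - 1) {i : ℕ} (h : KS L K n u i) :
    KS L K n (Function.update u j (u j + 1)) i := by
  refine ⟨h.1, ?_⟩
  have h1 : Nr L (Function.update u j (u j + 1) i) (u (i + K - 1)) := by
    simp only [Function.update_apply]
    split_ifs with h2
    · subst h2
      exact (nr_succ_iff hL h0).2 h.2
    · exact h.2
  refine h1.mono le_rfl ?_
  simp only [Function.update_apply]
  split_ifs with h2
  · rw [h2]; omega
  · exact le_rfl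

theorem ks_of_bump (hL : 3 ≤ L) {j : ℕ} (h0 : u j % L = L - 1) {i : ℕ}
    (h : KS L K n (Function.update u j (u j + 1)) i)
    (hj : i + K - 1 = j → Nr L (u i) (u j)) : KS L K n u i := by
  refine ⟨h.1, ?_⟩
  by_cases h2 : i + K - 1 = j
  · rw [h2]; exact hj h2
  · have h3 := h.2
    rw [Function.update_of_ne h2] at h3
    by_cases h4 : i = j
    · subst h4
      rw [Function.update_self] at h3
      exact (nr_succ_iff hL h0).1 h3
    · rwa [Function.update_of_ne h4] at h3

/-! ### Slot counts in windows and the last non-degenerate window -/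

/-- Two windows on the two sides of a bumped entry are far from each other. -/
theorem not_nr_of_windows (hKL : L ≤ K + 1) (hu : Adm L K n u) {Q x y j : ℕ} (hQ : Q % L = 0)
    (hj : u j + 1 = Q + L) (hxj : x + K ≤ j) (hjK : Q + 2 * L + 1 ≤ u (j - K))
    (hx : KS L K n u x) (hy : KS L K n u y) (hyj : y ≤ j) (hjy : j < y + K) :
    ¬ Nr L (u x) (u (y + K - 1) + L) := fun hn => by
  have hyn := hy.1
  have hQ1 : (Q + L) % L = 0 := by rw [Nat.add_mod_right]; exact hQ
  have hQ2 : (Q + 2 * L) % L = 0 := by rw [two_mul, ← add_assoc, Nat.add_mod_right]; exact hQ1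
  have h1 : u (y + K - 1) ≤ u j := hu.anti _ _ (by omega) (by omega)
  have h2 : u (j - K) ≤ u x := hu.anti _ _ (by omega) (by omega)
  have h3 := hn.le
  have hx0 : u x % L ≠ 0 := mod_ne_zero_of_between hQ2 (by omega) (by omega)
  have h4 := hn.lt hx0
  -- The entries from `j` to `y + K - 1` lie in `(Q, Q + L)` and those from `x` to `j - K` in `(Q +
  -- 2 L, Q + 3 L)`. Both ranges contain no multiple of `L`, so every step drops by at least one
  -- slot.
  have h5 := hu.add_le j (y + K - 1 - j) (by omega) fun l hl hl' => by
    have h6 := hu.lt_of_strict_left hl (by omega)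
      (mod_ne_zero_of_between hQ (by omega) (by omega))
    have h7 := hu.anti l (y + K - 1) (by omega) (by omega)
    exact mod_ne_zero_of_between hQ (by omega) (by omega)
  have h8 := hu.add_le x (j - K - x) (by omega) fun l hl hl' => by
    have h6 := hu.anti l (j - K) (by omega) (by omega)
    have h7 := hu.anti x l (by omega) (by omega)
    exact mod_ne_zero_of_between hQ2 (by omega) (by omega)
  rw [show j + (y + K - 1 - j) = y + K - 1 by omega] at h5
  rw [show x + (j - K - x) = j - K by omega] at h8
  -- If the windows are disjoint, the total drop is at least `L + 1 + K ≥ 2 L`, too much for the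
  -- assumed nearness.
  by_cases hxy : x + K ≤ y
  · omega
  · have h9 := hx.2.lt hx0
    have h10 := hy.2.le
    have h11 : u (x + K - 1) ≤ u y := hu.anti _ _ (by omega) (by omega)
    -- Overlapping windows share the entries from `y` to `x + K - 1`, which lie in `(Q + L, Q + 2
    -- L)`. Counting strict drops there as well leaves `K ≤ L - 2`.
    have h12 := hu.add_le y (x + K - 1 - y) (by omega) fun l hl hl' => by
      have h6 := hu.anti l (x + K - 1) (by omega) (by omega)
      have h7 := hu.anti y l (by omega) (by omega)
      exact mod_ne_zero_of_between hQ1 (by omega) (by omega)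
    rw [show y + (x + K - 1 - y) = x + K - 1 by omega] at h12
    have h13 := hy.2.lt (mod_ne_zero_of_between hQ1 (by omega) (by omega))
    omega

/-- The window at `i` exists and has no entry congruent to `-1` modulo `L`. -/
def ND (L K n : ℕ) (u : ℕ → ℕ) (i : ℕ) : Prop :=
  KS L K n u i ∧ ∀ l, i ≤ l → l < i + K → u l % L ≠ L - 1

/-- Without multiples of `L` the entries of the window would be `K ≥ L - 1` distinct slots within
one period, avoiding the two residues `0` and `-1`. -/
theorem ND.exists_mod_zero (hL : 3 ≤ L) (hKL : L ≤ K + 1) (hu : Adm L K n u) {e : ℕ}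
    (he : ND L K n u e) : ∃ i, e ≤ i ∧ i < e + K ∧ u i % L = 0 := by
  by_contra hc
  push Not at hc
  have hn := he.1.1
  obtain ⟨Q, hQ⟩ : ∃ Q, Q + u (e + K - 1) % L = u (e + K - 1) :=
    ⟨_, Nat.sub_add_cancel (Nat.mod_le _ _)⟩
  have hb0 := hc (e + K - 1) (by omega) (by omega)
  have hb1 := he.2 (e + K - 1) (by omega) (by omega)
  have hb2 := Nat.mod_lt (u (e + K - 1)) (show 0 < L by omega)
  have hQ0 : Q % L = 0 := by
    have := Nat.div_add_mod (u (e + K - 1)) L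
    have h : Q = L * (u (e + K - 1) / L) := by omega
    rw [h, Nat.mul_mod_right]
  have h1 := he.1.2.lt (hc e le_rfl (by omega))
  have hneQ : ∀ l, e ≤ l → l < e + K → u l ≠ Q + L ∧ u l ≠ Q + L - 1 := fun l hl hl' => by
    constructor <;> intro h
    · exact hc l hl hl' (by rw [h, Nat.add_mod_right, hQ0])
    · refine he.2 l hl hl' ?_
      rw [h, Nat.add_sub_assoc (by omega), Nat.add_mod, hQ0, zero_add, Nat.mod_mod,
        Nat.mod_eq_of_lt (by omega)]
  have hstep : ∀ a d, e ≤ a → a + d < e + K → u (a + d) + d ≤ u a := fun a d ha hd =>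
    hu.add_le a d (by omega) fun l hl hl' => hc l (by omega) (by omega)
  have h2 := hstep e (K - 1) le_rfl (by omega)
  rw [show e + (K - 1) = e + K - 1 by omega] at h2
  -- Either the window stays between two consecutive multiples of `L`, where only `L - 2` slots are
  -- available, or it crosses `Q + L`.
  by_cases h3 : u e < Q + L
  · have := hneQ e le_rfl (by omega)
    omega
  · have hex : ∃ i, e ≤ i ∧ u i < Q + L := ⟨e + K - 1, by omega, by omega⟩
    classical
    have h4 := Nat.find_spec hex
    have h5 := fun i => Nat.find_min hex (m := i)
    have h6 : Nat.find hex ≤ e + K - 1 := Nat.find_min' hex ⟨by omega, by omega⟩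
    generalize Nat.find hex = f at h4 h5 h6
    have h7 : e < f := by
      rcases h4.1.lt_or_eq with h | h
      · exact h
      · rw [h] at h3; exact absurd h4.2 h3
    have h8 := h5 (f - 1) (by omega)
    have h9 := hneQ (f - 1) (by omega) (by omega)
    have h10 := hneQ f (by omega) (by omega)
    have h11 := hstep e (f - 1 - e) le_rfl (by omega)
    have h12 := hstep f (e + K - 1 - f) (by omega) (by omega)
    rw [show e + (f - 1 - e) = f - 1 by omega] at h11
    rw [show f + (e + K - 1 - f) = e + K - 1 by omega] at h12
    -- The crossing skips both `Q + L - 1` and `Q + L`, so the window drops by at least `K + 1 ≥ L`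
    -- in total.
    have h13 : Q + L ≤ u (f - 1) := by
      by_contra h
      exact h8 ⟨by omega, by omega⟩
    omega

/-- `e` is the last non-degenerate window and `j` the last position of its largest multiple
of `L`. -/
structure LastND (L K n : ℕ) (u : ℕ → ℕ) (e j : ℕ) : Prop where
  nd : ND L K n u e
  max : ∀ i, ND L K n u i → i ≤ e
  le : e ≤ j
  lt : j < e + K
  mod : u j % L = 0
  largest : ∀ i, e ≤ i → i < e + K → u i % L = 0 → u i ≤ u j
  next : j + 1 < n → u (j + 1) < u j

theorem exists_lastND (hL : 3 ≤ L) (hKL : L ≤ K + 1) (hu : Adm L K n u) {e : ℕ}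
    (he : ND L K n u e) (hmax : ∀ i, ND L K n u i → i ≤ e) : ∃ j, LastND L K n u e j := by
  classical
  have hn := he.1.1
  have hex := he.exists_mod_zero hL hKL hu
  obtain ⟨h1, h2, h3⟩ := Nat.find_spec hex
  have h4 := fun i => Nat.find_min hex (m := i)
  generalize Nat.find hex = f at h1 h2 h3 h4
  obtain ⟨j, ⟨hfj, hj, hjf⟩, hjmax⟩ : ∃ j, (f ≤ j ∧ j < e + K ∧ u j = u f) ∧
      ∀ i, f ≤ i → i < e + K → u i = u f → i ≤ j := by
    have hne : ((Finset.range (e + K)).filter fun j => f ≤ j ∧ u j = u f).Nonempty :=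
      ⟨f, Finset.mem_filter.2 ⟨Finset.mem_range.2 h2, le_rfl, rfl⟩⟩
    refine ⟨Finset.max' _ hne, ?_, fun i hi hi' h => Finset.le_max' _ i
      (Finset.mem_filter.2 ⟨Finset.mem_range.2 hi', hi, h⟩)⟩
    have := Finset.max'_mem _ hne
    simp only [Finset.mem_filter, Finset.mem_range] at this
    exact ⟨this.2.1, this.1, this.2.2⟩
  refine ⟨j, he, hmax, by omega, hj, by rw [hjf, h3], fun i hi hi' h0 => ?_, fun hjn => ?_⟩
  · rw [hjf]
    refine hu.anti f i ?_ (by omega)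
    by_contra h
    exact h4 i (by omega) ⟨hi, hi', h0⟩
  · refine lt_of_le_of_ne (hu.anti _ _ (by omega) hjn) fun h => ?_
    by_cases h5 : j + 1 < e + K
    · have := hjmax (j + 1) (by omega) h5 (h.trans hjf)
      omega
    -- An equal entry just behind the window would make the window at `e + 1` non-degenerate,
    -- against the choice of `e`.
    · have h6 : j + 1 = e + K := by omega
      have : e + 1 ≤ e := by
        refine hmax (e + 1) ⟨⟨by omega, ?_⟩, fun l hl hl' => ?_⟩
        · refine he.1.2.mono (hu.anti _ _ (by omega) (by omega)) (le_of_eq ?_)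
          rw [show e + 1 + K - 1 = j + 1 by omega, h]
          congr 1
          omega
        · by_cases h7 : l < e + K
          · exact he.2 l (by omega) h7
          · obtain rfl : l = j + 1 := by omega
            rw [h, hjf, h3]
            omega
      omega

/-- The window allows at most `u j + L` for its first entry. That value would be a multiple of `L`
larger than `u j`, and the slot below it is congruent to `-1`. -/
theorem LastND.eq_last (h : LastND L K n u e j) (hL : 3 ≤ L) (hu : Adm L K n u) :
    u e + 1 < u j + L := by
  have hn := h.nd.1.1
  have h1 := h.nd.1.2.le
  have h2 := hu.anti j (e + K - 1) (by have := h.lt; omega) (by have := h.le; have := h.lt; omega)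
  have h3 := h.nd.2 e le_rfl (by have := h.le; have := h.lt; omega)
  have h4 := h.largest e le_rfl (by have := h.le; have := h.lt; omega)
  by_contra hc
  have h5 : u e = u j + L ∨ u e + 1 = u j + L := by omega
  rcases h5 with h5 | h5
  · have := h4 (by rw [h5, Nat.add_mod_right, h.mod])
    omega
  · apply h3
    have : u e = u j + (L - 1) := by omega
    rw [this, Nat.add_mod, h.mod, zero_add, Nat.mod_mod, Nat.mod_eq_of_lt (by omega)]

/-- This makes room for lowering `u j`. A neighbour in the slot `u j - 1` is congruent to `-1`,
hence lies outside the window; by `eq_last` it would then be near `u e`, at distance `K`. -/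
theorem LastND.next_lt (h : LastND L K n u e j) (hL : 3 ≤ L) (hu : Adm L K n u)
    (hj : j + 1 < n) : u (j + 1) + 1 < u j := by
  have h1 := h.next hj
  have hp := hu.pos j (by omega)
  by_contra hc
  have h2 : u (j + 1) = u j - 1 := by omega
  have h3 := sub_one_mod_eq hL h.mod (by omega)
  rw [← h2] at h3
  have h4 : e + K = j + 1 := by
    have := h.lt
    by_contra h5
    exact h.nd.2 (j + 1) (by have := h.le; omega) (by omega) h3
  refine hu.gap e (by omega) (Or.inl ?_)
  rw [h4]
  have := h.eq_last hL hu
  omega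

theorem LastND.unbump_ks (h : LastND L K n u e j) (hL : 3 ≤ L) (hK : 2 ≤ K) (hu : Adm L K n u) :
    KS L K n (Function.update u j (u j - 1)) e := by
  have hn := h.nd.1.1
  have hp := hu.pos j (by have := h.lt; omega)
  have h3 := sub_one_mod_eq hL h.mod (by omega)
  refine ⟨hn, ?_⟩
  by_cases h1 : e + K - 1 = j
  · rw [← h1, Function.update_of_ne (by omega), Function.update_self, h1]
    left
    have := h.eq_last hL hu
    omega
  · rw [Function.update_of_ne h1]
    by_cases h2 : e = j
    · subst h2
      rw [Function.update_self, ← nr_succ_iff hL h3, Nat.sub_add_cancel (by omega)]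
      exact h.nd.1.2
    · rw [Function.update_of_ne h2]
      exact h.nd.1.2

end

/-! ### The addition on slot sequences -/

section addition

variable {L K n : ℕ} {u : ℕ → ℕ} {r M : ℕ → Prop} {j : ℕ}
  (hL : 3 ≤ L) (hK : 2 ≤ K) (hu : Adm L K n u) (hr : TopGreedy K (KS L K n u) r) (hM : Ini r M)
  (hj : j < n) (h0 : u j % L = L - 1) (hMj : ∀ m, M m → m + K ≤ j)

include hK hu hr hM hj h0 hMj hL in
-- A new near pair of entries `j - K` and `j` would come from a rotated window ending right before
-- `j` with last entry `u j + 1`, from an old near pair, or from an old window ending before `j`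
-- that the greedy choice skipped.
theorem fw_bump_gap (h1 : ∀ i, r i → i + K ≤ j → M i)
    (h2 : ∀ m, M m → m + K = j → u (j - 1) ≠ u j + 1) (i : ℕ) (hij : i + K = j) :
    ¬ Nr L (fw L K M u i) (fw L K M u j + 1) := fun hn => by
  rw [fw_eq_of_ge hK hMj] at hn
  have h3 : u j < u (j - 1) := hu.lt_of_strict' (by omega) hj (by omega)
  rcases off_cases K M i with h | ⟨m, hm, h5, h6⟩ | h
  · rw [fw_start h, show i + K - 1 = j - 1 by omega] at hn
    have h4 := hn.le
    exact h2 i h hij (by omega)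
  · rw [fw_inside hr hM hm h5 h6] at hn
    refine hu.gap (i - 1) (by omega) (hn.mono le_rfl ?_)
    rw [show i - 1 + K = j - 1 by omega]
    exact h3
  · rw [fw_off (by omega) h] at hn
    have hS : KS L K n u i := ⟨by omega, hn.mono le_rfl (by rw [show i + K - 1 = j - 1 by omega]; exact h3)⟩
    obtain ⟨i', hi', h5, h6⟩ := hr.exists_le (by omega) hS
    have := h i' (h1 i' hi' (by omega))
    omega

/-- The sequence after forward rotation and bumping the entry `j`. -/
noncomputable def addSeq (L K : ℕ) (M : ℕ → Prop) (u : ℕ → ℕ) (j : ℕ) : ℕ → ℕ :=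
  Function.update (fw L K M u) j (fw L K M u j + 1)

theorem addSeq_self (hK : 2 ≤ K) (hMj : ∀ m, M m → m + K ≤ j) :
    addSeq L K M u j j = u j + 1 := by
  rw [addSeq, Function.update_self, fw_eq_of_ge hK hMj]

theorem addSeq_of_ne {i : ℕ} (h : i ≠ j) : addSeq L K M u j i = fw L K M u i := by
  rw [addSeq, Function.update_of_ne h]

theorem addSeq_eq_of_ge (hK : 2 ≤ K) {i : ℕ} (h : ∀ m, M m → m + K ≤ i) (hij : i ≠ j) :
    addSeq L K M u j i = u i := by
  rw [addSeq_of_ne hij, fw_eq_of_ge hK h]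

include hK hu hr hM hj h0 hMj hL in
theorem addSeq_adm (h1 : ∀ i, r i → i + K ≤ j → M i)
    (h2 : ∀ m, M m → m + K = j → u (j - 1) ≠ u j + 1) : Adm L K n (addSeq L K M u j) :=
  bump_adm hL hK (fw_adm hK hu hr hM) hj (by rw [fw_eq_of_ge hK hMj]; exact h0)
    (fw_bump_gap hL hK hu hr hM hj h0 hMj h1 h2)

/-- `j` is the position of an entry congruent to `-1` in the first window that is not rotated, and
every later window has such an entry. -/
structure AddAt (L K n : ℕ) (u : ℕ → ℕ) (r M : ℕ → Prop) (m' j : ℕ) : Prop where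
  mem : r m'
  notMem : ¬ M m'
  min : ∀ i, r i → ¬ M i → m' ≤ i
  le : m' ≤ j
  lt : j < m' + K
  mod : u j % L = L - 1
  deg : ∀ i, j < i → KS L K n u i → ∃ l, i ≤ l ∧ l < i + K ∧ u l % L = L - 1

variable {m' : ℕ} (ha : AddAt L K n u r M m' j)

include hr ha in
theorem AddAt.ks : KS L K n u m' := ((hr m').1 ha.mem).1

include hr ha hM in
theorem AddAt.add_le (m : ℕ) (hm : M m) : m + K ≤ m' := by
  rcases lt_trichotomy m m' with h | rfl | h
  · exact hr.sep (hM.sub _ hm) ha.mem h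
  · exact absurd hm ha.notMem
  · exact absurd (hM.down m m' hm ha.mem h.le) ha.notMem

include hr ha hM in
theorem AddAt.add_le_j (m : ℕ) (hm : M m) : m + K ≤ j :=
  (ha.add_le hr hM m hm).trans ha.le

include hr ha in
theorem AddAt.j_lt : j < n := by
  have := (ha.ks hr).1
  have := ha.lt
  omega

include hL hK hu hr hM ha in
theorem AddAt.adm : Adm L K n (addSeq L K M u j) := by
  have hj := ha.j_lt hr
  refine addSeq_adm hL hK hu hr hM hj ha.mod (ha.add_le_j hr hM) (fun i hi hij => ?_)
    fun m hm hmj h => ?_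
  · by_contra hc
    have h1 := ha.min i hi hc
    have h2 := ha.lt
    omega
  · have h1 := ha.add_le hr hM m hm
    obtain rfl : m' = j := le_antisymm ha.le (by omega)
    have h2 := (ha.ks hr).1
    refine hu.gap (m' - 1) (by omega) ?_
    rw [h, nr_succ_iff hL ha.mod, show m' - 1 + K = m' + K - 1 by omega]
    exact (ha.ks hr).2

include hL hK hu hr hM ha in
-- The bumped entry was the only one congruent to `-1` in this window, by `eq_of_mod_eq_of_ks`.
theorem AddAt.nd_start : ND L K n (addSeq L K M u j) m' := by
  have hmod : fw L K M u j % L = L - 1 := by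
    rw [fw_eq_of_ge hK (ha.add_le_j hr hM)]; exact ha.mod
  refine ⟨bump_ks hL hmod ((fw_ks_of_ge hK (ha.add_le hr hM)).2 (ha.ks hr)), fun l h1 h2 h3 => ?_⟩
  by_cases hlj : l = j
  · subst hlj
    rw [addSeq_self hK (ha.add_le_j hr hM), add_one_mod_eq_zero hL ha.mod] at h3
    omega
  · rw [addSeq_eq_of_ge hK (fun m hm => (ha.add_le hr hM m hm).trans h1) hlj] at h3
    exact hlj (eq_of_mod_eq_of_ks hu (ha.ks hr) h1 h2 ha.le ha.lt (h3.trans ha.mod.symm)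
      (by rw [ha.mod]; omega))

include hK hr hM ha in
theorem AddAt.le_of_nd {e : ℕ} (he : ND L K n (addSeq L K M u j) e) : e ≤ j := by
  by_contra hc
  have hge : ∀ i, e ≤ i → addSeq L K M u j i = u i := fun i hi =>
    addSeq_eq_of_ge hK (fun m hm => (ha.add_le_j hr hM m hm).trans (by omega)) (by omega)
  have hS : KS L K n u e := by
    have := he.1.2
    rw [hge _ le_rfl, hge _ (by omega)] at this
    exact ⟨he.1.1, this⟩
  obtain ⟨l, h1, h2, h3⟩ := ha.deg e (by omega) hS
  exact he.2 l h1 h2 (by rw [hge l h1]; exact h3)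

include hL hK hu hr hM ha in
theorem AddAt.exists_last : ∃ e, m' ≤ e ∧ e ≤ j ∧ ND L K n (addSeq L K M u j) e ∧
    ∀ i, ND L K n (addSeq L K M u j) i → i ≤ e := by
  classical
  have hle := fun e => ha.le_of_nd hK hr hM (e := e)
  have h0 := ha.nd_start hL hK hu hr hM
  have h1 := Nat.findGreatest_spec (P := ND L K n (addSeq L K M u j)) (hle _ h0) h0
  exact ⟨_, Nat.le_findGreatest (hle _ h0) h0, Nat.findGreatest_le j, h1,
    fun i hi => Nat.le_findGreatest (hle i hi) hi⟩

include hL hK hu hr hM ha in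
-- This is how the subtraction finds `j` again. A multiple of `L` above the bumped entry would be
-- larger by at least `L`, hence more than `L` above the old entry `u j`; the window at `m'`, which
-- contains both, forbids this.
theorem AddAt.lastND {e : ℕ} (h1 : m' ≤ e) (h2 : e ≤ j) (he : ND L K n (addSeq L K M u j) e)
    (hmax : ∀ i, ND L K n (addSeq L K M u j) i → i ≤ e) :
    LastND L K n (addSeq L K M u j) e j where
  nd := he
  max := hmax
  le := h2
  lt := ha.lt.trans_le (by omega)
  mod := by
    rw [addSeq_self hK (ha.add_le_j hr hM)]
    exact add_one_mod_eq_zero hL ha.mod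
  largest i hi hi' h0 := by
    rw [addSeq_self hK (ha.add_le_j hr hM)]
    by_contra hc
    have hij : i < j := by
      by_contra h
      have h3 := (ha.adm hL hK hu hr hM).anti j i (by omega) (by have := he.1.1; omega)
      rw [addSeq_self hK (ha.add_le_j hr hM)] at h3
      omega
    rw [addSeq_eq_of_ge hK (fun m hm => (ha.add_le hr hM m hm).trans (by omega)) (by omega)]
      at h0 hc
    have h4 := add_le_of_mod_zero (add_one_mod_eq_zero hL ha.mod) h0 (by omega)
    have h5 := (ha.ks hr).2.le
    have h6 := hu.anti m' i (by omega) (by have := he.1.1; omega)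
    have h7 := hu.anti j (m' + K - 1) (by have := ha.lt; omega) (by have := (ha.ks hr).1; omega)
    omega
  next h := by
    have h3 := hu.lt_of_strict_left (i := j) (j := j + 1) (by omega) h (by rw [ha.mod]; omega)
    rw [addSeq_self hK (ha.add_le_j hr hM), addSeq_eq_of_ge hK (fun m hm =>
      (ha.add_le_j hr hM m hm).trans (by omega)) (by omega)]
    omega

include hL hK hu hr hM ha in
-- Cancelling `L`, the claim compares `e` with the old last entry of a rotated window. If that entry
-- were not larger, it would be near `u (e + K - 1)`, which is at least `K` places below it.
theorem AddAt.lt_start {e : ℕ} (h1 : m' ≤ e) (h2 : e ≤ j)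
    (he : ND L K n (addSeq L K M u j) e) (m : ℕ) (hm : M m) :
    addSeq L K M u j e + L < fw L K M u m := by
  have hn := he.1.1
  have hme := ha.add_le hr hM m hm
  have h3 : Nr L (addSeq L K M u j e) (u (e + K - 1)) := by
    rcases h1.lt_or_eq with h | rfl
    · have h4 := he.1.2
      rwa [addSeq_eq_of_ge hK (i := e + K - 1) (fun m hm =>
        (ha.add_le hr hM m hm).trans (by omega)) (by have := ha.lt; omega)] at h4
    · by_cases h4 : m' = j
      · subst h4
        rw [addSeq_self hK (ha.add_le_j hr hM), nr_succ_iff hL ha.mod]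
        exact (ha.ks hr).2
      · rw [addSeq_eq_of_ge hK (ha.add_le hr hM) h4]
        exact (ha.ks hr).2
  rw [fw_start hm]
  by_contra hc
  refine hu.gap (m + K - 1) (by omega) (h3.mono (by omega) (hu.anti _ _ (by omega) (by omega)))

include hL hK hu hr hM ha in
-- An unrotated bottom-greedy window starts no earlier than `m'`, whose window contains `j`; hence
-- its first entry is at most `u j + L`, below the bumped entry raised by `L`.
theorem AddAt.lt_next {g : ℕ → Prop} (hg : BotGreedy K (KS L K n (fw L K M u)) g) {e : ℕ}
    (h2 : e ≤ j) (d : ℕ) (hd : g d) (hdM : ¬ M d) :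
    fw L K M u d < addSeq L K M u j e + L := by
  have hge := fw_bot_ge hK hu hr hM hg hd hdM
  have hS := (fw_ks_of_ge hK hge).1 ((hg d).1 hd).1
  rw [fw_eq_of_ge hK hge]
  obtain ⟨i, hi, h3, h4⟩ := hr.exists_le (by omega) hS
  have hiM : ¬ M i := fun h => by have := hge i h; omega
  have h5 := ha.min i hi hiM
  have h6 := hu.anti m' d (by omega) (by have := hS.1; omega)
  have h7 := (ha.ks hr).2.le
  have h8 := hu.anti j (m' + K - 1) (by have := ha.lt; omega) (by have := (ha.ks hr).1; omega)
  have h9 := (ha.adm hL hK hu hr hM).anti e j h2 (ha.j_lt hr)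
  rw [addSeq_self hK (ha.add_le_j hr hM)] at h9
  omega

include hL hK hu hr hM hj in
/-- The addition to the slot `L - 1` after all windows have been rotated: no window of the result
lies below the slot `2 L - 1`. -/
theorem not_ks_addSeq_of_all (hall : ∀ i, r i → M i) (hlow : ∀ m, M m → L < u (m + K - 1))
    (h0 : u j = L - 1) (hMj : ∀ m, M m → m + K ≤ j) (x : ℕ)
    (hx : KS L K n (addSeq L K M u j) x) : 2 * L - 1 ≤ addSeq L K M u j x := by
  by_contra hc
  have hmod : fw L K M u j % L = L - 1 := by
    rw [fw_eq_of_ge hK hMj, h0, Nat.mod_eq_of_lt (by omega)]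
  have hxle : fw L K M u x ≤ addSeq L K M u j x := by
    by_cases h : x = j
    · subst h
      rw [addSeq, Function.update_self]
      omega
    · rw [addSeq_of_ne h]
  have hS : KS L K n (fw L K M u) x := ks_of_bump hL hmod hx fun h => by
    left
    rw [fw_eq_of_ge hK hMj, h0]
    omega
  -- The rotated windows start above `2 L`, so a low window lies after all of them and is an old
  -- window, which the top-greedy choice must have met.
  have hge : ∀ m, M m → m < x := fun m hm => by
    by_contra h
    have h1 := fw_anti hK hu hr hM x m (by omega) (by have := (ks_of_mem hr hM hm).1; omega)
    rw [fw_start hm] at h1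
    have := hlow m hm
    omega
  have hge' : ∀ m, M m → m + K ≤ x := fun m hm => by
    by_contra h
    obtain ⟨m', hm', h1, h2⟩ := fw_ks_inside hK hu hr hM hm (hge m hm) (by omega) hS
    have := hge m' hm'
    omega
  obtain ⟨i, hi, h3, h4⟩ := hr.exists_le (by omega) ((fw_ks_of_ge hK hge').1 hS)
  have := hge' i (hall i hi)
  omega

end addition

/-! ### The subtraction on slot sequences -/

section subtraction

variable {L K n : ℕ} {u : ℕ → ℕ} {g M : ℕ → Prop} {e j : ℕ}

/-- The sequence with the entry `j` moved one slot down. -/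
def unbump (u : ℕ → ℕ) (j : ℕ) : ℕ → ℕ := Function.update u j (u j - 1)

theorem unbump_of_ne {i : ℕ} (h : i ≠ j) : unbump u j i = u i := by
  rw [unbump, Function.update_of_ne h]

theorem unbump_self : unbump u j j = u j - 1 := by
  rw [unbump, Function.update_self]

theorem unbump_le (i : ℕ) : unbump u j i ≤ u i := by
  by_cases h : i = j
  · subst h; rw [unbump_self]; omega
  · rw [unbump_of_ne h]

theorem bump_unbump (h : 0 < u j) :
    Function.update (unbump u j) j (unbump u j j + 1) = u := by
  ext i
  by_cases hi : i = j
  · subst hi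
    rw [Function.update_self, unbump_self]
    omega
  · rw [Function.update_of_ne hi, unbump_of_ne hi]

/-- The data of the subtraction: the last non-degenerate window `e`, the position `j` of its largest
multiple of `L`, and the first bottom-greedy window `d` that is not rotated. -/
structure SubAt (L K n : ℕ) (u : ℕ → ℕ) (g M : ℕ → Prop) (e j d : ℕ) : Prop where
  last : LastND L K n u e j
  mem : g d
  notMem : ¬ M d
  min : ∀ i, g i → ¬ M i → d ≤ i
  lt : unbump u j d < u e + L
  gt : ∀ m, M m → u e + L < unbump u j m

variable {d : ℕ} (hL : 3 ≤ L) (hK : 2 ≤ K) (hKL : L ≤ K + 1) (hu : Adm L K n u)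

include hL hK hu in
theorem LastND.unbump_adm (h : LastND L K n u e j) : Adm L K n (unbump u j) :=
  Bressoud.unbump_adm hL hK hu (by have := h.lt; have := h.nd.1.1; omega) h.mod
    (h.next_lt hL hu)

include hL in
theorem unbump_mod (hu : Adm L K n u) (hj : j < n) (h : u j % L = 0) :
    unbump u j j % L = L - 1 := by
  have := hu.pos j hj
  rw [unbump_self]
  exact sub_one_mod_eq hL h (by omega)

variable (hg : BotGreedy K (KS L K n (unbump u j)) g) (hM : Ini g M)
  (hs : SubAt L K n u g M e j d)

include hu hg hM hs in
theorem SubAt.add_le (m : ℕ) (hm : M m) : m + K ≤ e := by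
  have h1 := hs.gt m hm
  have h2 := hM.ks_bot hg hm
  have h3 := h2.2.le
  have h4 := unbump_le (u := u) (j := j) (m + K - 1)
  by_contra h
  have h5 := hu.anti e (m + K - 1) (by omega) (by have := h2.1; omega)
  omega

theorem SubAt.j_lt (hs : SubAt L K n u g M e j d) : j < n := by
  have := hs.last.lt
  have := hs.last.nd.1.1
  omega

include hL hK hu hKL in
-- The case of `not_nr_of_windows` in which `Q` is the multiple of `L` one period below `u j`. The
-- gap above the multiple `u j` yields the required `u (j - K) ≥ Q + 2 L + 1`.
theorem SubAt.not_windows (hs : SubAt L K n u g M e j d) {x y : ℕ}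
    (hxj : x + K ≤ j) (hx : KS L K n (unbump u j) x) (hy : KS L K n (unbump u j) y)
    (hyj : y ≤ j) (hjy : j < y + K) :
    ¬ Nr L (unbump u j x) (unbump u j (y + K - 1) + L) := by
  have hj := hs.j_lt
  have hp := hu.pos j hj
  have hjL : L ≤ u j := Nat.le_of_dvd (by omega) (Nat.dvd_of_mod_eq_zero hs.last.mod)
  have hQ : (u j - L) % L = 0 := by
    rw [← Nat.mod_eq_sub_mod hjL]; exact hs.last.mod
  refine not_nr_of_windows hKL (hs.last.unbump_adm hL hK hu) hQ (by rw [unbump_self]; omega) hxj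
    ?_ hx hy hyj hjy
  rw [unbump_of_ne (by omega)]
  have h1 := hu.gap (j - K) (by omega)
  rw [Nat.sub_add_cancel (by omega)] at h1
  by_contra h
  apply h1
  by_cases h2 : u (j - K) < u j + L
  · exact Or.inl h2
  · have h3 : u (j - K) = u j + L := by omega
    exact Or.inr ⟨h3, by rw [h3, Nat.add_mod_right]; exact hs.last.mod⟩

include hL hK hu hKL hg in
-- If the first unrotated window ended before `j`, it and the window at `e` would lie on the two
-- sides of `j`, while `SubAt.lt` places them too close together.
theorem SubAt.lt_add (hs : SubAt L K n u g M e j d) : j < d + K := by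
  by_contra hc
  have hj := hs.j_lt
  have hSd := ((hg d).1 hs.mem).1
  have hSe : KS L K n (unbump u j) e := hs.last.unbump_ks hL hK hu
  refine hs.not_windows hL hK hKL hu (by omega) hSd hSe hs.last.le hs.last.lt ?_
  have h1 := hs.lt
  by_cases he : e = j
  · subst he
    exfalso
    rw [unbump_of_ne (by omega)] at h1
    have h2 := hu.anti d (e - K) (by omega) (by omega)
    refine hu.gap (e - K) (by omega) (Or.inl ?_)
    rw [Nat.sub_add_cancel (by omega)]
    omega
  · rw [← unbump_of_ne (u := u) he] at h1
    left
    have := hSe.2.le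
    omega

include hL hK hu hKL hg in
-- Such a window would meet an unrotated bottom-greedy one, so its last position is not before `d`.
-- Since the window at `d` reaches `j`, the two windows contradict `not_windows`.
theorem SubAt.false_of_window (hs : SubAt L K n u g M e j d) {s : ℕ}
    (hS : KS L K n (unbump u j) s) (hsj : s + K ≤ j) (hM' : ∀ i, s ≤ i → ¬ M i) : False := by
  obtain ⟨i, hi, h1, h2⟩ := hg.exists_ge (by omega) hS
  have h3 := hs.min i hi (hM' i h1)
  have h4 := hs.lt_add hL hK hKL hu hg
  have hSd := ((hg d).1 hs.mem).1
  have hj := hs.j_lt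
  refine hs.not_windows hL hK hKL hu hsj hS hSd (by omega) h4 (hS.2.trans_add ?_ hSd.2)
  exact (hs.last.unbump_adm hL hK hu).anti _ _ (by omega) (by omega)

include hL hK hu hKL hg hM hs in
-- An obstructing window cannot start after `e`, since `u e` would then be near `u (e + K)`. If it
-- reaches `j`, `not_windows` compares it with the last rotated window; if it ends before `j`,
-- `false_of_window` applies.
theorem SubAt.lowerable : Lowerable L K n (unbump u j) M where
  ge m hm := by
    have h1 := hs.gt m hm
    have h2 := hs.last.nd.1.1
    have h3 := hu.pos e (by omega)
    omega
  no_set m hm hmax i hS hi hn := by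
    have hadm := hs.last.unbump_adm hL hK hu
    have hmi : m < i := by
      by_contra h
      have := hadm.anti i m (by omega) (by have := (hM.ks_bot hg hm).1; omega)
      omega
    have hM' : ∀ l, i ≤ l → ¬ M l := fun l hl hMl => by
      have := hmax l hMl
      omega
    have hgt := hs.gt m hm
    have hme := hs.add_le hu hg hM m hm
    have hie : i ≤ e := by
      by_contra h
      have h1 := hn.le
      have h2 := unbump_le (u := u) (j := j) (i + K - 1)
      have h3 := hS.1
      have h4 := hu.anti (e + K) (i + K - 1) (by omega) (by omega)
      exact hu.gap e (by omega) (Or.inl (by omega))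
    by_cases hij : j < i + K
    · exact hs.not_windows hL hK hKL hu (hme.trans hs.last.le) (hM.ks_bot hg hm) hS
        (hie.trans hs.last.le) hij hn
    · exact hs.false_of_window hL hK hKL hu hg hS (by omega) hM'

/-- Every window after `j` has an entry congruent to `-1`. -/
theorem LastND.exists_mod (h : LastND L K n u e j) {i : ℕ} (hi : j < i) (hS : KS L K n u i) :
    ∃ l, i ≤ l ∧ l < i + K ∧ u l % L = L - 1 := by
  by_contra hc
  push Not at hc
  have := h.max i ⟨hS, hc⟩
  have := h.le
  omega

include hL hK hu hKL hg hM hs in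
-- The first unrotated top-greedy window after lowering starts at or before `e`, because the window
-- at `e` survives. It contains `j`, since otherwise `false_of_window` would apply.
theorem SubAt.addAt {r : ℕ → Prop} (hr : TopGreedy K (KS L K n (bw L K M (unbump u j))) r) :
    ∃ m', AddAt L K n (bw L K M (unbump u j)) r M m' j := by
  have hadm := hs.last.unbump_adm hL hK hu
  have hl := hs.lowerable hL hK hKL hu hg hM
  have hSe : KS L K n (unbump u j) e := hs.last.unbump_ks hL hK hu
  have hle := hs.add_le hu hg hM
  have hSe' := (bw_ks_of_ge (n := n) hK hle).2 hSe
  obtain ⟨i, hi, h1, h2⟩ := hr.exists_le (by omega) hSe'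
  have hiM : ¬ M i := fun h => by have := hle i h; omega
  classical
  have hex : ∃ m, r m ∧ ¬ M m := ⟨i, hi, hiM⟩
  obtain ⟨h3, h4⟩ := Nat.find_spec hex
  have h5 := fun l => Nat.find_min' hex (m := l)
  generalize Nat.find hex = m' at h3 h4 h5
  have hge := bw_top_ge hK hadm hg hM hl hr h3 h4
  have hm'e : m' ≤ e := (h5 i ⟨hi, hiM⟩).trans h1
  have hbw : ∀ l, m' ≤ l → bw L K M (unbump u j) l = unbump u j l := fun l hl =>
    bw_eq_of_ge hK fun m hm => (hge m hm).trans hl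
  refine ⟨m', h3, h4, fun l h h' => h5 l ⟨h, h'⟩, hm'e.trans hs.last.le, ?_, ?_, ?_⟩
  · by_contra hc
    refine hs.false_of_window hL hK hKL hu hg ((bw_ks_of_ge hK hge).1 ((hr m').1 h3).1)
      (by omega) fun l hl hMl => ?_
    have := hge l hMl
    omega
  · rw [hbw j (hm'e.trans hs.last.le)]
    exact unbump_mod hL hu hs.j_lt hs.last.mod
  · intro l hl' hS
    have hje := hs.last.le
    have heq : ∀ x, l ≤ x → bw L K M (unbump u j) x = u x := fun x hx => by
      rw [hbw x (by omega), unbump_of_ne (by omega)]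
    have hS' : KS L K n u l := by
      have := hS.2
      rw [heq l le_rfl, heq _ (by omega)] at this
      exact ⟨hS.1, this⟩
    obtain ⟨x, h6, h7, h8⟩ := hs.last.exists_mod hl' hS'
    exact ⟨x, h6, h7, by rw [heq x h6]; exact h8⟩

end subtraction

/-! ### Greedy marks -/

theorem leastUnused_pos (l : List ℕ) : 0 < leastUnused l := (Nat.find_spec (exists_unused l)).1

theorem leastUnused_notMem (l : List ℕ) : leastUnused l ∉ l := (Nat.find_spec (exists_unused l)).2

theorem mem_of_lt_leastUnused {l : List ℕ} {q : ℕ} (h0 : 0 < q) (h : q < leastUnused l) :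
    q ∈ l := by
  by_contra hc
  exact Nat.find_min (exists_unused l) h ⟨h0, hc⟩

/-- Common form of the two markings. -/
def greedyMarks (R : Part → Part → Prop) [DecidableRel R] : List Part → List ℕ
  | [] => []
  | x :: ys =>
    leastUnused (((ys.zip (greedyMarks R ys)).filter fun ym => R x ym.1).map Prod.snd)
      :: greedyMarks R ys

theorem gordonMarks_eq (η : ℕ) (π : List Part) : gordonMarks η π = greedyMarks (NearTop η) π := by
  induction π with
  | nil => rfl
  | cons x ys ih => rw [gordonMarks, greedyMarks, ih]

theorem reverseMarksAux_eq (η : ℕ) (π : List Part) :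
    reverseMarksAux η π = greedyMarks (fun x y => NearBot η y x) π := by
  induction π with
  | nil => rfl
  | cons x ys ih => rw [reverseMarksAux, greedyMarks, ih]

/-- The marks `μ i` are greedy for the relation `R` on the positions below `n`. -/
structure IsGreedy (n : ℕ) (R : ℕ → ℕ → Prop) (μ : ℕ → ℕ) : Prop where
  pos : ∀ i < n, 0 < μ i
  ne : ∀ i j, i < j → j < n → R i j → μ i ≠ μ j
  used : ∀ i < n, ∀ q, 0 < q → q < μ i → ∃ j, i < j ∧ j < n ∧ R i j ∧ μ j = q

theorem exists_greedyMarks (R : Part → Part → Prop) [DecidableRel R] (n : ℕ) (f : ℕ → Part) :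
    ∃ μ : ℕ → ℕ, greedyMarks R ((List.range n).map f) = (List.range n).map μ ∧
      IsGreedy n (fun i j => R (f i) (f j)) μ := by
  induction n generalizing f with
  | zero =>
    exact ⟨fun _ => 0, rfl, ⟨fun i h => absurd h (by omega), fun i j _ h => absurd h (by omega),
      fun i h => absurd h (by omega)⟩⟩
  | succ n ih =>
    obtain ⟨μ, h1, h2⟩ := ih (fun i => f (i + 1))
    have hl : (List.range (n + 1)).map f = f 0 :: (List.range n).map fun i => f (i + 1) := by
      rw [List.range_succ_eq_map, List.map_cons, List.map_map]
      rfl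
    rw [hl, greedyMarks, h1, List.zip_map']
    set l := ((((List.range n).map fun i => (f (i + 1), μ i)).filter
      fun ym => decide (R (f 0) ym.1)).map Prod.snd) with hldef
    have hmem : ∀ q, q ∈ l ↔ ∃ j < n, R (f 0) (f (j + 1)) ∧ μ j = q := fun q => by
      simp [hldef, and_assoc]
    refine ⟨fun i => Nat.casesOn i (leastUnused l) μ, ?_, ?_, ?_, ?_⟩
    · rw [List.range_succ_eq_map, List.map_cons, List.map_map]
      rfl
    · rintro (_ | i) hi
      · exact leastUnused_pos l
      · exact h2.pos i (by omega)
    · rintro (_ | i) (_ | j) hij hj hR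
      · omega
      · intro h
        exact leastUnused_notMem l ((hmem _).2 ⟨j, by omega, hR, h.symm⟩)
      · omega
      · exact h2.ne i j (by omega) (by omega) hR
    · rintro (_ | i) hi q h0 hq
      · obtain ⟨j, h3, h4, h5⟩ := (hmem q).1 (mem_of_lt_leastUnused h0 hq)
        exact ⟨j + 1, by omega, by omega, h4, h5⟩
      · obtain ⟨j, h3, h4, h5, h6⟩ := h2.used i (by omega) q h0 hq
        exact ⟨j + 1, by omega, by omega, h5, h6⟩

section

variable {n K : ℕ} {R : ℕ → ℕ → Prop} {μ : ℕ → ℕ} (hK : 2 ≤ K) (h : IsGreedy n R μ)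
  (h1 : ∀ i j, i < j → j < n → R i j → j < i + K)
  (h2 : ∀ i j i' j', i ≤ i' → i' < j' → j' ≤ j → j < n → R i j → R i' j')

include h h1 in
theorem IsGreedy.aux {i : ℕ} (hi : i < n) :
    ∃ N ⊆ Finset.Ioo i (i + K), (∀ j ∈ N, j < n ∧ R i j) ∧
      Finset.Icc 1 (μ i - 1) ⊆ N.image μ := by
  classical
  refine ⟨(Finset.Ioo i (i + K)).filter fun j => j < n ∧ R i j, Finset.filter_subset _ _,
    fun j hj => (Finset.mem_filter.1 hj).2, fun q hq => ?_⟩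
  rw [Finset.mem_Icc] at hq
  obtain ⟨j, h3, h4, h5, h6⟩ := h.used i hi q (by omega) (by omega)
  exact Finset.mem_image.2 ⟨j, Finset.mem_filter.2
    ⟨Finset.mem_Ioo.2 ⟨h3, h1 i j h3 h4 h5⟩, h4, h5⟩, h6⟩

include hK h h1 in
theorem IsGreedy.le {i : ℕ} (hi : i < n) : μ i ≤ K := by
  obtain ⟨N, h3, _, h5⟩ := h.aux h1 hi
  have h6 := Finset.card_le_card h5
  have h7 := Finset.card_le_card h3
  have h8 := Finset.card_image_le (s := N) (f := μ)
  rw [Nat.card_Icc] at h6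
  rw [Nat.card_Ioo] at h7
  omega

include hK h h1 h2 in
-- Only the next `K - 1` positions can be near. A mark `K` needs all of `1, ..., K - 1` among them,
-- so all are near and use each of these marks once. Conversely, `K - 1` pairwise near positions
-- without the mark `K` exhaust the smaller marks.
theorem IsGreedy.eq_iff {i : ℕ} (hi : i < n) : μ i = K ↔ (i + K ≤ n ∧ R i (i + K - 1)) ∧
    ∀ i', i < i' → i' < i + K → μ i' ≠ K := by
  constructor
  · intro hm
    obtain ⟨N, h3, h4, h5⟩ := h.aux h1 hi
    have h6 := Finset.card_le_card h5
    have h7 := Finset.card_le_card h3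
    have h8 := Finset.card_image_le (s := N) (f := μ)
    rw [Nat.card_Icc] at h6
    have hN : N = Finset.Ioo i (i + K) := Finset.eq_of_subset_of_card_le h3 (by
      rw [Nat.card_Ioo]; omega)
    have hI : Finset.Icc 1 (μ i - 1) = N.image μ := Finset.eq_of_subset_of_card_le h5 (by
      rw [Nat.card_Icc]
      rw [Nat.card_Ioo] at h7
      omega)
    have h9 := h4 (i + K - 1) (by rw [hN, Finset.mem_Ioo]; omega)
    refine ⟨⟨by omega, h9.2⟩, fun i' hi1 hi2 he => ?_⟩
    have : μ i' ∈ Finset.Icc 1 (μ i - 1) := by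
      rw [hI, hN]
      exact Finset.mem_image_of_mem _ (Finset.mem_Ioo.2 ⟨hi1, hi2⟩)
    rw [Finset.mem_Icc] at this
    omega
  · rintro ⟨⟨h3, h4⟩, h5⟩
    have hinj : Set.InjOn μ (Finset.Ioo i (i + K)) := by
      intro a ha b hb hab
      simp only [Finset.coe_Ioo, Set.mem_Ioo] at ha hb
      by_contra hne
      rcases lt_or_gt_of_ne hne with hlt | hlt
      · exact h.ne a b hlt (by omega) (h2 _ _ _ _ (by omega) hlt (by omega) (by omega) h4) hab
      · exact h.ne b a hlt (by omega) (h2 _ _ _ _ (by omega) hlt (by omega) (by omega) h4)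
          hab.symm
    have hsub : (Finset.Ioo i (i + K)).image μ ⊆ Finset.Icc 1 (K - 1) := by
      intro q hq
      obtain ⟨j, hj, rfl⟩ := Finset.mem_image.1 hq
      rw [Finset.mem_Ioo] at hj
      have h6 := h.pos j (by omega)
      have h7 := h.le hK h1 (i := j) (by omega)
      have h8 := h5 j hj.1 hj.2
      rw [Finset.mem_Icc]
      omega
    have heq := Finset.eq_of_subset_of_card_le hsub (by
      rw [Finset.card_image_of_injOn hinj, Nat.card_Ioo, Nat.card_Icc]; omega)
    by_contra hne
    have h6 := h.pos i hi
    have h7 := h.le hK h1 hi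
    have : μ i ∈ (Finset.Ioo i (i + K)).image μ := by
      rw [heq, Finset.mem_Icc]
      omega
    obtain ⟨j, hj, he⟩ := Finset.mem_image.1 this
    rw [Finset.mem_Ioo] at hj
    exact h.ne i j hj.1 (by omega) (h2 _ _ _ _ le_rfl hj.1 (by omega) (by omega) h4) he.symm

end

theorem mem_positions {n m : ℕ} {μ : ℕ → ℕ} {i : ℕ} :
    i ∈ positions m ((List.range n).map μ) ↔ i < n ∧ μ i = m := by
  simp only [positions, List.length_map, List.length_range, List.mem_filter, List.mem_range,
    decide_eq_true_eq, List.getElem?_map]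
  constructor
  · rintro ⟨h, h'⟩
    rw [List.getElem?_range h] at h'
    exact ⟨h, by simpa using h'⟩
  · rintro ⟨h, h'⟩
    rw [List.getElem?_range h]
    exact ⟨h, by simpa using h'⟩

theorem positions_sorted (m : ℕ) (ms : List ℕ) : (positions m ms).Pairwise (· < ·) :=
  List.Pairwise.filter _ List.pairwise_lt_range

/-! ### Overpartitions given by slots -/

/-- The dictionary between slots and the parts that are congruent to `0` or to an element of `A`:
`pt` enumerates these parts in increasing order, with `L` of them in each period `η`. -/
structure SlotMap (A : Set ℕ) (a c η L : ℕ) (pt : ℕ → Part) : Prop where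
  strictMono : StrictMono pt
  raise : ∀ t, raise η (pt t) = pt (t + L)
  isOver : ∀ t, Over (pt t) ↔ t % L ≠ 0
  mod : ∀ t, size (pt t) ≡ c [MOD η] ↔ t % L = L - 1
  size_succ : ∀ t, t % L = L - 1 → size (pt (t + 1)) = size (pt t) + a
  plain_size : ∀ t, t % L = 0 → plain (size (pt t)) = pt t
  bar_size : ∀ t, t % L ≠ 0 → bar (size (pt t)) = pt t
  plain_eta : pt L = plain η
  bar_c : pt (L - 1) = bar c
  bar_add : pt (2 * L - 1) = bar (η + c)
  bar_eta_add : bar (η + a) < pt (2 * L)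
  pos : ∀ t, 0 < size (pt t) ↔ 2 ≤ t
  residue : ∀ t, size (pt t) ≡ 0 [MOD η] ∨ ∃ b ∈ A, size (pt t) ≡ b [MOD η]
  surj : ∀ x, (size x ≡ 0 [MOD η] ∨ ∃ b ∈ A, size x ≡ b [MOD η]) → (¬ Over x → η ∣ size x) →
    ∃ t, pt t = x
  three_le : 3 ≤ L

/-- The list of the parts in the slots `u 0, …, u (n - 1)`. -/
def ofSlots (pt : ℕ → Part) (n : ℕ) (u : ℕ → ℕ) : List Part := (List.range n).map fun i => pt (u i)

@[simp]
theorem length_ofSlots (pt : ℕ → Part) (n : ℕ) (u : ℕ → ℕ) : (ofSlots pt n u).length = n := by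
  simp [ofSlots]

theorem getElem?_ofSlots {pt : ℕ → Part} {n : ℕ} {u : ℕ → ℕ} {i : ℕ} (h : i < n) :
    (ofSlots pt n u)[i]? = some (pt (u i)) := by
  rw [ofSlots, List.getElem?_map, List.getElem?_range h]
  rfl

theorem mem_getElem?_ofSlots {pt : ℕ → Part} {n : ℕ} {u : ℕ → ℕ} {i : ℕ} {x : Part} :
    x ∈ (ofSlots pt n u)[i]? ↔ i < n ∧ pt (u i) = x := by
  by_cases h : i < n
  · rw [getElem?_ofSlots h]
    simp [h]
  · rw [List.getElem?_eq_none (by simpa using h)]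
    simp [h]

theorem mem_ofSlots {pt : ℕ → Part} {n : ℕ} {u : ℕ → ℕ} {x : Part} :
    x ∈ ofSlots pt n u ↔ ∃ i < n, pt (u i) = x := by
  simp [ofSlots]

theorem ofSlots_congr {pt : ℕ → Part} {n : ℕ} {u v : ℕ → ℕ} (h : ∀ i < n, u i = v i) :
    ofSlots pt n u = ofSlots pt n v := by
  refine List.map_congr_left fun i hi => ?_
  rw [h i (List.mem_range.1 hi)]

theorem reverse_ofSlots (pt : ℕ → Part) (n : ℕ) (u : ℕ → ℕ) :
    (ofSlots pt n u).reverse = ofSlots pt n fun i => u (n - 1 - i) := by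
  refine List.ext_getElem? fun i => ?_
  by_cases h : i < n
  · rw [getElem?_ofSlots h, List.getElem?_reverse (by simpa using h), length_ofSlots,
      getElem?_ofSlots (by omega)]
  · rw [List.getElem?_eq_none (by simpa using h), List.getElem?_eq_none (by simpa using h)]

theorem reverse_range_map (n : ℕ) (μ : ℕ → ℕ) :
    ((List.range n).map μ).reverse = (List.range n).map fun i => μ (n - 1 - i) := by
  refine List.ext_getElem? fun i => ?_
  by_cases h : i < n
  · rw [List.getElem?_reverse (by simpa using h)]
    simp only [List.length_map, List.length_range, List.getElem?_map]
    rw [List.getElem?_range h, List.getElem?_range (by omega)]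
    rfl
  · rw [List.getElem?_eq_none (by simpa using h), List.getElem?_eq_none (by simpa using h)]

section

variable {A : Set ℕ} {a c η L : ℕ} {pt : ℕ → Part} (hs : SlotMap A a c η L pt)

include hs

theorem SlotMap.nearTop (s t : ℕ) : NearTop η (pt s) (pt t) ↔ Nr L s t := by
  rw [NearTop, hs.raise, hs.strictMono.lt_iff_lt, hs.strictMono.le_iff_le, Nr]
  simp only [hs.isOver]
  split_ifs with h
  · exact ⟨Or.inl, fun h' => h'.elim id fun h'' => absurd h''.2 h⟩
  · rw [not_not] at h
    simp only [h, and_true]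
    omega

/-- The strictness is tested on the other part than in `nearTop`. This makes no difference, because
at distance exactly `L` both slots have the same residue. -/
theorem SlotMap.nearBot (s t : ℕ) : NearBot η (pt s) (pt t) ↔ Nr L s t := by
  rw [NearBot, hs.raise, hs.strictMono.lt_iff_lt, hs.strictMono.le_iff_le, Nr]
  simp only [hs.isOver]
  split_ifs with h
  · refine ⟨Or.inl, fun h' => h'.elim id ?_⟩
    rintro ⟨rfl, h''⟩
    rw [Nat.add_mod_right] at h''
    exact absurd h'' h
  · rw [not_not] at h
    constructor
    · intro h'
      rcases h'.lt_or_eq with h1 | rfl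
      · exact Or.inl h1
      · exact Or.inr ⟨rfl, by rw [Nat.add_mod_right, h]⟩
    · rintro (h | h) <;> omega

variable {k n : ℕ} {u : ℕ → ℕ}

theorem SlotMap.isKSet (hk : 3 ≤ k) (m : ℕ) :
    IsKSet η k (ofSlots pt n u) m ↔ KS L (k - 1) n u m := by
  simp only [IsKSet, KS, mem_getElem?_ofSlots]
  constructor
  · rintro ⟨x, ⟨h1, rfl⟩, y, ⟨h2, rfl⟩, h3⟩
    rw [hs.nearTop] at h3
    refine ⟨by omega, ?_⟩
    rwa [show m + (k - 1) - 1 = m + (k - 2) by omega]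
  · rintro ⟨h1, h2⟩
    refine ⟨_, ⟨by omega, rfl⟩, _, ⟨by omega, rfl⟩, ?_⟩
    rw [hs.nearTop]
    rwa [show m + (k - 1) - 1 = m + (k - 2) by omega] at h2

omit hs in
theorem mem_window {m : ℕ} {x : Part} : x ∈ window k (ofSlots pt n u) m ↔
    ∃ i, m ≤ i ∧ i < m + (k - 1) ∧ i < n ∧ pt (u i) = x := by
  rw [window, List.mem_iff_getElem?]
  simp only [List.getElem?_take, List.getElem?_drop]
  constructor
  · rintro ⟨i, hi⟩
    split_ifs at hi with h
    exact ⟨m + i, by omega, by omega, mem_getElem?_ofSlots.1 hi⟩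
  · rintro ⟨i, h1, h2, h3, h4⟩
    refine ⟨i - m, ?_⟩
    rw [if_pos (by omega), Nat.add_sub_cancel' h1]
    exact mem_getElem?_ofSlots.2 ⟨h3, h4⟩

theorem SlotMap.exists_gordonMarks (hk : 3 ≤ k) (hu : Adm L (k - 1) n u) :
    ∃ μ : ℕ → ℕ, gordonMarks η (ofSlots pt n u) = (List.range n).map μ ∧ ∀ i < n,
      μ i ≤ k - 1 ∧ (μ i = k - 1 ↔ KS L (k - 1) n u i ∧
        ∀ i', i < i' → i' < i + (k - 1) → μ i' ≠ k - 1) := by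
  obtain ⟨μ, h1, h2⟩ := exists_greedyMarks (NearTop η) n fun i => pt (u i)
  simp only [hs.nearTop] at h2
  have h3 : ∀ i j, i < j → j < n → Nr L (u i) (u j) → j < i + (k - 1) := fun i j hij hj h => by
    by_contra hc
    exact hu.gap i (by omega) (h.mono le_rfl (hu.anti _ _ (by omega) hj))
  have h4 : ∀ i j i' j', i ≤ i' → i' < j' → j' ≤ j → j < n → Nr L (u i) (u j) →
      Nr L (u i') (u j') := fun i j i' j' hi hij hj hjn h =>
    h.mono (hu.anti _ _ hi (by omega)) (hu.anti _ _ hj hjn)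
  refine ⟨μ, by rw [gordonMarks_eq]; exact h1, fun i hi => ?_⟩
  exact ⟨h2.le (by omega) h3 hi, h2.eq_iff (by omega) h3 h4 hi⟩

theorem SlotMap.exists_reverseGordonMarks (hk : 3 ≤ k) (hu : Adm L (k - 1) n u) :
    ∃ μ : ℕ → ℕ, reverseGordonMarks η (ofSlots pt n u) = (List.range n).map μ ∧ ∀ i < n,
      μ i ≤ k - 1 ∧ (μ i = k - 1 ↔ (k - 1 ≤ i + 1 ∧ KS L (k - 1) n u (i + 1 - (k - 1))) ∧
        ∀ i', i' < i → i < i' + (k - 1) → μ i' ≠ k - 1) := by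
  obtain ⟨μ, h1, h2⟩ := exists_greedyMarks (fun x y => NearBot η y x) n
    fun i => pt (u (n - 1 - i))
  simp only [hs.nearBot] at h2
  have h3 : ∀ i j, i < j → j < n → Nr L (u (n - 1 - j)) (u (n - 1 - i)) → j < i + (k - 1) :=
    fun i j hij hj h => by
      by_contra hc
      exact hu.gap (n - 1 - j) (by omega) (h.mono le_rfl (hu.anti _ _ (by omega) (by omega)))
  have h4 : ∀ i j i' j', i ≤ i' → i' < j' → j' ≤ j → j < n →
      Nr L (u (n - 1 - j)) (u (n - 1 - i)) → Nr L (u (n - 1 - j')) (u (n - 1 - i')) :=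
    fun i j i' j' hi hij hj hjn h =>
      h.mono (hu.anti _ _ (by omega) (by omega)) (hu.anti _ _ (by omega) (by omega))
  refine ⟨fun i => μ (n - 1 - i), ?_, fun i hi => ?_⟩
  · rw [reverseGordonMarks, reverse_ofSlots, reverseMarksAux_eq, ← reverse_range_map]
    exact congrArg _ h1
  · refine ⟨h2.le (by omega) h3 (by omega), (h2.eq_iff (by omega) h3 h4 (i := n - 1 - i)
      (by omega)).trans ((and_congr_left' ?_).trans (and_congr_right fun hks => ?_))⟩
    · rw [KS]
      constructor
      · rintro ⟨h5, h6⟩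
        refine ⟨by omega, by omega, ?_⟩
        convert h6 using 2 <;> omega
      · rintro ⟨h5, h5', h6⟩
        refine ⟨by omega, ?_⟩
        convert h6 using 2 <;> omega
    · constructor
      · intro h i' h5 h6
        exact h (n - 1 - i') (by omega) (by omega)
      · intro h i' h5 h6 h7
        refine h (n - 1 - i') (by omega) (by omega) ?_
        show μ (n - 1 - (n - 1 - i')) = k - 1
        rw [show n - 1 - (n - 1 - i') = i' by omega]
        exact h7

end

/-! ### Sorted lists -/

theorem sortParts_eq {l l' : List Part} (h : l.Perm l') (hs : l'.Pairwise (· ≥ ·)) :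
    sortParts l = l' :=
  List.Perm.eq_of_pairwise (fun _ _ _ _ h1 h2 => le_antisymm h2 h1)
    (List.pairwise_insertionSort _ l) hs ((List.perm_insertionSort _ l).trans h)

theorem mem_take_of_le {l : List ℕ} (hl : l.Pairwise (· < ·)) {p i j : ℕ} (hi : i ∈ l.take p)
    (hj : j ∈ l) (hji : j ≤ i) : j ∈ l.take p := by
  rw [← List.take_append_drop p l] at hl hj
  rcases List.mem_append.1 hj with h | h
  · exact h
  · have := (List.pairwise_append.1 hl).2.2 i hi j h
    omega

theorem notMem_take_getElem? {l : List ℕ} (hl : l.Pairwise (· < ·)) {p i : ℕ}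
    (hi : l[p]? = some i) : i ∉ l.take p := fun h => by
  obtain ⟨q, hq⟩ := List.mem_iff_getElem?.1 h
  rw [List.getElem?_take] at hq
  split_ifs at hq with hqp
  obtain ⟨h1, rfl⟩ := List.getElem?_eq_some_iff.1 hi
  obtain ⟨h2, h3⟩ := List.getElem?_eq_some_iff.1 hq
  have := List.pairwise_iff_getElem.1 hl q p h2 h1 hqp
  omega

theorem getElem?_le_of_notMem_take {l : List ℕ} (hl : l.Pairwise (· < ·)) {p i j : ℕ}
    (hi : l[p]? = some i) (hj : j ∈ l) (hj' : j ∉ l.take p) : i ≤ j := by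
  obtain ⟨q, hq⟩ := List.mem_iff_getElem?.1 hj
  have hpq : p ≤ q := by
    by_contra h
    refine hj' (List.mem_iff_getElem?.2 ⟨q, ?_⟩)
    rw [List.getElem?_take, if_pos (by omega), hq]
  obtain ⟨h1, rfl⟩ := List.getElem?_eq_some_iff.1 hi
  obtain ⟨h2, rfl⟩ := List.getElem?_eq_some_iff.1 hq
  rcases hpq.lt_or_eq with h | rfl
  · exact (List.pairwise_iff_getElem.1 hl p q h1 h2 h).le
  · exact le_rfl

/-- An initial segment of a sorted list is determined by its members. -/
theorem take_eq_of_mem_iff {l l' : List ℕ} (hl : l.Pairwise (· < ·)) (hl' : l'.Pairwise (· < ·))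
    (h1 : ∀ i ∈ l', i ∈ l) (h2 : ∀ i ∈ l', ∀ j ∈ l, j ≤ i → j ∈ l') :
    l.take l'.length = l' := by
  induction l generalizing l' with
  | nil =>
    cases l' with
    | nil => rfl
    | cons x l' => exact absurd (h1 x List.mem_cons_self) List.not_mem_nil
  | cons y l ih =>
    cases l' with
    | nil => rfl
    | cons x l' =>
      rw [List.pairwise_cons] at hl hl'
      have hxy : x = y := by
        have h3 : y ≤ x := by
          rcases List.mem_cons.1 (h1 x List.mem_cons_self) with h | h
          · exact h.ge
          · exact (hl.1 x h).le
        have h4 := h2 x List.mem_cons_self y List.mem_cons_self h3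
        rcases List.mem_cons.1 h4 with h | h
        · exact h.symm
        · exact absurd (hl'.1 y h) (by omega)
      subst hxy
      rw [List.length_cons, List.take_succ_cons, ih hl.2 hl'.2]
      · intro i hi
        rcases List.mem_cons.1 (h1 i (List.mem_cons_of_mem _ hi)) with h | h
        · have := hl'.1 i hi
          omega
        · exact h
      · intro i hi j hj hji
        rcases List.mem_cons.1 (h2 i (List.mem_cons_of_mem _ hi) j (List.mem_cons_of_mem _ hj) hji)
          with h | h
        · have := hl.1 j hj
          omega
        · exact h

/-- The chosen points lie in disjoint windows, so the choice is injective. Applied in both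
directions, this compares the numbers of marked parts of the two markings. -/
theorem length_le_of_windows {K : ℕ} {l l' : List ℕ} (hl : l.Nodup)
    (hsep : ∀ i ∈ l, ∀ j ∈ l, i < j → i + K ≤ j) (h : ∀ i ∈ l, ∃ x ∈ l', i ≤ x ∧ x < i + K) :
    l.length ≤ l'.length := by
  classical
  choose! f hf h1 h2 using h
  have hinj : Set.InjOn f l.toFinset := by
    intro i hi j hj hij
    rw [List.coe_toFinset] at hi hj
    have h3 := h1 i hi
    have h4 := h2 i hi
    have h5 := h1 j hj
    have h6 := h2 j hj
    rcases lt_trichotomy i j with h | h | h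
    · have := hsep i hi j hj h
      omega
    · exact h
    · have := hsep j hj i hi h
      omega
  calc l.length = l.toFinset.card := (List.toFinset_card_of_nodup hl).symm
    _ = (l.toFinset.image f).card := (Finset.card_image_of_injOn hinj).symm
    _ ≤ l'.toFinset.card := Finset.card_le_card fun x hx => by
        obtain ⟨i, hi, rfl⟩ := Finset.mem_image.1 hx
        exact List.mem_toFinset.2 (hf i (List.mem_toFinset.1 hi))
    _ ≤ l'.length := List.toFinset_card_le l'

/-- Mirror image of `length_le_of_windows`. -/
theorem length_le_of_windows' {K : ℕ} {l l' : List ℕ} (hl : l.Nodup)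
    (hsep : ∀ i ∈ l, ∀ j ∈ l, i < j → i + K ≤ j) (h : ∀ i ∈ l, ∃ x ∈ l', x ≤ i ∧ i < x + K) :
    l.length ≤ l'.length := by
  classical
  choose! f hf h1 h2 using h
  have hinj : Set.InjOn f l.toFinset := by
    intro i hi j hj hij
    rw [List.coe_toFinset] at hi hj
    have h3 := h1 i hi
    have h4 := h2 i hi
    have h5 := h1 j hj
    have h6 := h2 j hj
    rcases lt_trichotomy i j with h | h | h
    · have := hsep i hi j hj h
      omega
    · exact h
    · have := hsep j hj i hi h
      omega
  calc l.length = l.toFinset.card := (List.toFinset_card_of_nodup hl).symm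
    _ = (l.toFinset.image f).card := (Finset.card_image_of_injOn hinj).symm
    _ ≤ l'.toFinset.card := Finset.card_le_card fun x hx => by
        obtain ⟨i, hi, rfl⟩ := Finset.mem_image.1 hx
        exact List.mem_toFinset.2 (hf i (List.mem_toFinset.1 hi))
    _ ≤ l'.length := List.toFinset_card_le l'

theorem perm_of_injOn {α : Type*} {n : ℕ} (σ : ℕ → ℕ) (hσ : ∀ i < n, σ i < n)
    (hinj : ∀ i < n, ∀ j < n, σ i = σ j → i = j) (f : ℕ → α) :
    ((List.range n).map fun i => f (σ i)).Perm ((List.range n).map f) := by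
  have h : ((List.range n).map σ).Perm (List.range n) := by
    refine (List.Nodup.subperm ?_ fun x hx => ?_).perm_of_length_le (by simp)
    · refine (List.nodup_map_iff_inj_on List.nodup_range).2 fun i hi j hj h => ?_
      exact hinj i (List.mem_range.1 hi) j (List.mem_range.1 hj) h
    · obtain ⟨i, hi, rfl⟩ := List.mem_map.1 hx
      exact List.mem_range.2 (hσ i (List.mem_range.1 hi))
  have := h.map f
  rwa [List.map_map] at this

theorem sum_map_range_add {n η : ℕ} {T : List ℕ} (hT : T.Nodup) (hTn : ∀ i ∈ T, i < n)
    (s : ℕ → ℕ) : ((List.range n).map fun i => s i + if i ∈ T then η else 0).sum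
      = ((List.range n).map s).sum + T.length * η := by
  have key : ∀ (m : ℕ) (f : ℕ → ℕ), ((List.range m).map f).sum = ∑ i ∈ Finset.range m, f i := by
    intro m f
    induction m with
    | zero => simp
    | succ m ih => rw [List.sum_range_succ, ih, Finset.sum_range_succ]
  rw [key, key, Finset.sum_add_distrib]
  congr 1
  rw [← Finset.sum_filter]
  have : (Finset.range n).filter (fun i => i ∈ T) = T.toFinset := by
    ext i
    simp only [Finset.mem_filter, Finset.mem_range, List.mem_toFinset]
    exact ⟨fun h => h.2, fun h => ⟨hTn i h, h⟩⟩
  rw [this, Finset.sum_const, smul_eq_mul, List.toFinset_card_of_nodup hT]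

/-! ### Moves on overpartitions given by slots -/

section

variable {A : Set ℕ} {a c η L : ℕ} {pt : ℕ → Part} {k n p : ℕ} {u : ℕ → ℕ}

theorem two_le_count_iff {l : List Part} {x : Part} :
    2 ≤ l.count x ↔ ∃ i j : ℕ, i < j ∧ l[i]? = some x ∧ l[j]? = some x := by
  rw [← List.replicate_sublist_iff, show List.replicate 2 x = [x, x] from rfl,
    ← List.duplicate_iff_sublist, List.duplicate_iff_exists_distinct_get]
  constructor
  · rintro ⟨i, j, hij, h1, h2⟩
    refine ⟨i, j, hij, ?_, ?_⟩
    · rw [List.getElem?_eq_getElem i.2, Option.some_inj]; exact h1.symm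
    · rw [List.getElem?_eq_getElem j.2, Option.some_inj]; exact h2.symm
  · rintro ⟨i, j, hij, h1, h2⟩
    obtain ⟨h3, h4⟩ := List.getElem?_eq_some_iff.1 h1
    obtain ⟨h5, h6⟩ := List.getElem?_eq_some_iff.1 h2
    exact ⟨⟨i, h3⟩, ⟨j, h5⟩, hij, h4.symm, h6.symm⟩

theorem pairwise_ofSlots (hs : SlotMap A a c η L pt) {K : ℕ} (hu : Adm L K n u) :
    (ofSlots pt n u).Pairwise (· ≥ ·) := by
  rw [ofSlots, List.pairwise_map]
  refine List.pairwise_lt_range.imp_of_mem fun hi hj h => ?_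
  exact hs.strictMono.monotone (hu.anti _ _ h.le (List.mem_range.1 hj))

theorem SlotMap.isOverpartition (hs : SlotMap A a c η L pt) {K : ℕ} (hu : Adm L K n u) :
    IsOverpartition (ofSlots pt n u) where
  sorted := pairwise_ofSlots hs hu
  pos x hx := by
    obtain ⟨i, hi, rfl⟩ := mem_ofSlots.1 hx
    exact (hs.pos _).2 (hu.pos i hi)
  over_once x hx ho := by
    have h1 := List.count_pos_iff.2 hx
    by_contra hc
    have h2 : 2 ≤ (ofSlots pt n u).count x := by omega
    obtain ⟨i, j, hij, h3, h4⟩ := two_le_count_iff.1 h2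
    obtain ⟨hi, h3⟩ := mem_getElem?_ofSlots.1 h3
    obtain ⟨hj, h4⟩ := mem_getElem?_ofSlots.1 h4
    have h5 := hs.strictMono.injective (h3.trans h4.symm)
    rw [← h3, hs.isOver] at ho
    have := hu.lt_of_strict_left (i := i) (j := j) hij hj ho
    omega

theorem SlotMap.botGreedy (hs : SlotMap A a c η L pt) (hk : 3 ≤ k) (hu : Adm L (k - 1) n u) :
    BotGreedy (k - 1) (KS L (k - 1) n u) fun i => i ∈ gPos η k (ofSlots pt n u) := by
  obtain ⟨μ, h1, h2⟩ := hs.exists_gordonMarks hk hu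
  intro i
  simp only [gPos, h1, mem_positions]
  constructor
  · rintro ⟨hi, h3⟩
    have h4 := (h2 i hi).2.1 h3
    exact ⟨h4.1, fun i' h5 h6 h7 => h4.2 i' h5 h6 h7.2⟩
  · rintro ⟨h3, h4⟩
    have h5 := h3.1
    refine ⟨by omega, (h2 i (by omega)).2.2 ⟨h3, fun i' h6 h7 h8 => h4 i' h6 h7 ⟨by omega, h8⟩⟩⟩

theorem SlotMap.gordonMarks_le (hs : SlotMap A a c η L pt) (hk : 3 ≤ k)
    (hu : Adm L (k - 1) n u) : ∀ m ∈ gordonMarks η (ofSlots pt n u), m ≤ k - 1 := by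
  obtain ⟨μ, h1, h2⟩ := hs.exists_gordonMarks hk hu
  rw [h1]
  intro m hm
  obtain ⟨i, hi, rfl⟩ := List.mem_map.1 hm
  exact (h2 i (List.mem_range.1 hi)).1

theorem SlotMap.reverseGordonMarks_le (hs : SlotMap A a c η L pt) (hk : 3 ≤ k)
    (hu : Adm L (k - 1) n u) : ∀ m ∈ reverseGordonMarks η (ofSlots pt n u), m ≤ k - 1 := by
  obtain ⟨μ, h1, h2⟩ := hs.exists_reverseGordonMarks hk hu
  rw [h1]
  intro m hm
  obtain ⟨i, hi, rfl⟩ := List.mem_map.1 hm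
  exact (h2 i (List.mem_range.1 hi)).1

theorem SlotMap.rPos_bounds (hs : SlotMap A a c η L pt) (hk : 3 ≤ k) (hu : Adm L (k - 1) n u)
    {i : ℕ} (hi : i ∈ rPos η k (ofSlots pt n u)) : k - 1 ≤ i + 1 ∧ i < n := by
  obtain ⟨μ, h1, h2⟩ := hs.exists_reverseGordonMarks hk hu
  rw [rPos, h1, mem_positions] at hi
  exact ⟨((h2 i hi.1).2.1 hi.2).1.1, hi.1⟩

/-- The starts of the windows that end at a `(k - 1)`-marked part of the reverse marking. -/
def rStart (η k : ℕ) (π : List Part) (i : ℕ) : Prop := i + (k - 1) - 1 ∈ rPos η k π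

theorem SlotMap.topGreedy (hs : SlotMap A a c η L pt) (hk : 3 ≤ k) (hu : Adm L (k - 1) n u) :
    TopGreedy (k - 1) (KS L (k - 1) n u) (rStart η k (ofSlots pt n u)) := by
  obtain ⟨μ, h1, h2⟩ := hs.exists_reverseGordonMarks hk hu
  intro i
  simp only [rStart, rPos, h1, mem_positions]
  have e : i + (k - 1) - 1 + 1 - (k - 1) = i := by omega
  constructor
  · rintro ⟨hi, h3⟩
    have h4 := (h2 _ hi).2.1 h3
    rw [e] at h4
    exact ⟨h4.1.2, fun i' h5 h6 h7 => h4.2 _ (by omega) (by omega) h7.2⟩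
  · rintro ⟨h3, h4⟩
    have h5 := h3.1
    refine ⟨by omega, (h2 _ (by omega)).2.2 ⟨⟨by omega, by rwa [e]⟩, fun i' h6 h7 h8 => ?_⟩⟩
    have h9 := ((h2 i' (by omega)).2.1 h8).1.1
    refine h4 (i' + 1 - (k - 1)) (by omega) (by omega) ?_
    rw [show i' + 1 - (k - 1) + (k - 1) - 1 = i' by omega]
    exact ⟨by omega, h8⟩

theorem rPos_sorted (η k : ℕ) (π : List Part) : (rPos η k π).Pairwise (· < ·) :=
  positions_sorted _ _

theorem gPos_sorted (η k : ℕ) (π : List Part) : (gPos η k π).Pairwise (· < ·) :=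
  positions_sorted _ _

theorem nodup_of_sorted {l : List ℕ} (h : l.Pairwise (· < ·)) : l.Nodup := h.imp fun h => h.ne

/-- The starts of the first `p` windows of the reverse marking. -/
def rTake (η k p : ℕ) (π : List Part) (i : ℕ) : Prop := i + (k - 1) - 1 ∈ (rPos η k π).take p

/-- The first `p` marked positions of the Gordon marking. -/
def gTake (η k p : ℕ) (π : List Part) (i : ℕ) : Prop := i ∈ (gPos η k π).take p

theorem ini_rTake (η k p : ℕ) (π : List Part) : Ini (rStart η k π) (rTake η k p π) where
  sub _ h := List.mem_of_mem_take h
  down _ _ h h1 h2 := mem_take_of_le (rPos_sorted η k π) h h1 (by omega)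

theorem ini_gTake (η k p : ℕ) (π : List Part) :
    Ini (fun i => i ∈ gPos η k π) (gTake η k p π) where
  sub _ h := List.mem_of_mem_take h
  down _ _ h h1 h2 := mem_take_of_le (gPos_sorted η k π) h h1 h2

/-! ### Moves as rotations of positions -/

open Classical in
/-- The permutation of positions that rotates the windows that start in `M`. -/
noncomputable def rot (K : ℕ) (M : ℕ → Prop) (i : ℕ) : ℕ :=
  if M i then i + K - 1 else if ∃ m, M m ∧ m < i ∧ i < m + K then i - 1 else i

section rot

variable {K : ℕ} {M : ℕ → Prop} (hK : 2 ≤ K) (hsep : ∀ i j, M i → M j → i < j → i + K ≤ j)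

include hsep

theorem rot_inside {m i : ℕ} (hm : M m) (h1 : m < i) (h2 : i < m + K) : rot K M i = i - 1 := by
  rw [rot, if_neg fun hi => by have := hsep m i hm hi h1; omega, if_pos ⟨m, hm, h1, h2⟩]

omit hsep in
theorem rot_start {i : ℕ} (h : M i) : rot K M i = i + K - 1 := if_pos h

omit hsep in
include hK in
theorem rot_off {i : ℕ} (h : Off K M i) : rot K M i = i := by
  rw [rot, if_neg fun hi => by have := h i hi; omega, if_neg]
  rintro ⟨m, hm, h1, h2⟩
  have := h m hm
  omega

include hK in
theorem rot_lt (hn : ∀ i, M i → i + K ≤ n) {i : ℕ} (hi : i < n) : rot K M i < n := by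
  rcases off_cases K M i with h | ⟨m, hm, h1, h2⟩ | h
  · rw [rot_start h]; have := hn i h; omega
  · rw [rot_inside hsep hm h1 h2]; omega
  · rw [rot_off hK h]; exact hi

include hK in
theorem rot_injective {i j : ℕ} (h : rot K M i = rot K M j) : i = j := by
  have key : ∀ m m', M m → M m' → m + K ≤ m' ∨ m = m' ∨ m' + K ≤ m := fun m m' hm hm' => by
    rcases lt_trichotomy m m' with h | h | h
    · exact Or.inl (hsep m m' hm hm' h)
    · exact Or.inr (Or.inl h)
    · exact Or.inr (Or.inr (hsep m' m hm' hm h))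
  rcases off_cases K M i with hi | ⟨m, hm, h1, h2⟩ | hi <;>
  rcases off_cases K M j with hj | ⟨m', hm', h3, h4⟩ | hj
  · rw [rot_start hi, rot_start hj] at h; omega
  · rw [rot_start hi, rot_inside hsep hm' h3 h4] at h
    have := key i m' hi hm'
    omega
  · rw [rot_start hi, rot_off hK hj] at h
    have := hj i hi
    omega
  · rw [rot_inside hsep hm h1 h2, rot_start hj] at h
    have := key m j hm hj
    omega
  · rw [rot_inside hsep hm h1 h2, rot_inside hsep hm' h3 h4] at h
    omega
  · rw [rot_inside hsep hm h1 h2, rot_off hK hj] at h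
    have := hj m hm
    omega
  · rw [rot_off hK hi, rot_start hj] at h
    have := hi j hj
    omega
  · rw [rot_off hK hi, rot_inside hsep hm' h3 h4] at h
    have := hi m' hm'
    omega
  · rw [rot_off hK hi, rot_off hK hj] at h
    exact h

end rot

/-- The unsorted result of a move. -/
theorem mapIdx_ofSlots (f : Part → Part) (f' : ℕ → ℕ) (T : List ℕ)
    (hf : ∀ i ∈ T, f (pt (u i)) = pt (f' (u i))) :
    (ofSlots pt n u).mapIdx (fun i x => if i ∈ T then f x else x)
      = (List.range n).map fun i => pt (if i ∈ T then f' (u i) else u i) := by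
  refine List.ext_getElem? fun i => ?_
  rw [List.getElem?_mapIdx]
  by_cases h : i < n
  · rw [getElem?_ofSlots h, List.getElem?_map, List.getElem?_range h]
    simp only [Option.map_some]
    split_ifs with h1
    · rw [hf i h1]
    · rfl
  · rw [List.getElem?_eq_none (by simpa using h), List.getElem?_eq_none (by simpa using h)]
    rfl

section

variable (hs : SlotMap A a c η L pt) (hk : 3 ≤ k) (hu : Adm L (k - 1) n u)

include hs hk hu

theorem rTake_last {i : ℕ} (hi : i ∈ (rPos η k (ofSlots pt n u)).take p) :
    ∃ m, rTake η k p (ofSlots pt n u) m ∧ i + 1 = m + (k - 1) := by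
  have := hs.rPos_bounds hk hu (List.mem_of_mem_take hi)
  refine ⟨i + 1 - (k - 1), ?_, by omega⟩
  rw [rTake, show i + 1 - (k - 1) + (k - 1) - 1 = i by omega]
  exact hi

theorem forward_perm : ((ofSlots pt n u).mapIdx fun i x =>
      if i ∈ (rPos η k (ofSlots pt n u)).take p then raise η x else x).Perm
    (ofSlots pt n (fw L (k - 1) (rTake η k p (ofSlots pt n u)) u)) := by
  have hr := hs.topGreedy hk hu
  have hM := ini_rTake η k p (ofSlots pt n u)
  set T := (rPos η k (ofSlots pt n u)).take p with hT
  set M := rTake η k p (ofSlots pt n u) with hMdef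
  have hsep : ∀ i j, M i → M j → i < j → i + (k - 1) ≤ j := fun i j hi hj =>
    hr.sep (hM.sub _ hi) (hM.sub _ hj)
  rw [mapIdx_ofSlots (raise η) (fun t => t + L) T fun i _ => hs.raise _]
  refine List.Perm.symm (List.Perm.trans (List.Perm.of_eq ?_) (perm_of_injOn (n := n)
    (rot (k - 1) M)
    (fun i hi => rot_lt (by omega) hsep (fun m hm => (ks_of_mem hr hM hm).1) hi)
    (fun i _ j _ h => rot_injective (by omega) hsep h)
    (fun i => pt (if i ∈ T then u i + L else u i))))
  refine List.map_congr_left fun i hi => ?_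
  congr 1
  have hlast := fun i => rTake_last (p := p) hs hk hu (i := i)
  rcases off_cases (k - 1) M i with h | ⟨m, hm, h1, h2⟩ | h
  · rw [fw_start h, rot_start h, if_pos (show i + (k - 1) - 1 ∈ T from h)]
  · rw [fw_inside hr hM hm h1 h2, rot_inside hsep hm h1 h2, if_neg fun hc => ?_]
    obtain ⟨m', hm', h3⟩ := hlast _ hc
    have := hsep m' m hm' hm (by omega)
    omega
  · rw [fw_off (by omega) h, rot_off (by omega) h, if_neg fun hc => ?_]
    obtain ⟨m', hm', h3⟩ := hlast _ hc
    have := h m' hm'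
    omega

theorem forwardMove_ofSlots : forwardMove η k p (ofSlots pt n u)
    = ofSlots pt n (fw L (k - 1) (rTake η k p (ofSlots pt n u)) u) :=
  sortParts_eq (forward_perm hs hk hu) (pairwise_ofSlots hs
    (fw_adm (by omega) hu (hs.topGreedy hk hu) (ini_rTake η k p _)))

theorem weight_forwardMove (hp : p ≤ (rPos η k (ofSlots pt n u)).length) :
    weight (ofSlots pt n (fw L (k - 1) (rTake η k p (ofSlots pt n u)) u))
      = weight (ofSlots pt n u) + p * η := by
  have h := ((forward_perm (p := p) hs hk hu).map size).sum_eq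
  rw [mapIdx_ofSlots (raise η) (fun t => t + L) _ fun i _ => hs.raise _] at h
  have hnd : ((rPos η k (ofSlots pt n u)).take p).Nodup :=
    (nodup_of_sorted (rPos_sorted η k _)).sublist (List.take_sublist _ _)
  have h1 := sum_map_range_add (n := n) (η := η) hnd
    (fun i hi => (hs.rPos_bounds hk hu (List.mem_of_mem_take hi)).2) fun i => size (pt (u i))
  rw [List.length_take, min_eq_left hp] at h1
  have h2 : (ofSlots pt n u).map size = (List.range n).map fun i => size (pt (u i)) := by
    rw [ofSlots, List.map_map]; rfl
  rw [weight, weight, ← h, h2, ← h1, List.map_map]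
  congr 1
  refine List.map_congr_left fun i _ => ?_
  simp only [Function.comp]
  split_ifs
  · rw [← hs.raise]; rfl
  · rfl

/-- `Lowerable.ge` ensures that the truncated subtraction of `η` from a part really is the shift by
`L` slots. -/
theorem backwardMove_ofSlots (hl : Lowerable L (k - 1) n u (gTake η k p (ofSlots pt n u))) :
    backwardMove η k p (ofSlots pt n u)
      = ofSlots pt n (bw L (k - 1) (gTake η k p (ofSlots pt n u)) u) := by
  have hg := hs.botGreedy hk hu
  have hM := ini_gTake η k p (ofSlots pt n u)
  refine sortParts_eq ?_ (pairwise_ofSlots hs (bw_adm (by omega) hu hg hM hl))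
  set T := (gPos η k (ofSlots pt n u)).take p with hT
  set M := gTake η k p (ofSlots pt n u) with hMdef
  have hsep : ∀ i j, M i → M j → i < j → i + (k - 1) ≤ j := fun i j hi hj =>
    hg.sep (hM.sub _ hi) (hM.sub _ hj)
  have hlower : ∀ i ∈ T, lower η (pt (u i)) = pt (u i - L) := fun i hi => by
    have h1 := hl.ge i hi
    have h2 := hs.raise (u i - L)
    rw [Nat.sub_add_cancel (by omega)] at h2
    rw [← h2]
    simp [lower, raise, size]
  rw [mapIdx_ofSlots (lower η) (fun t => t - L) T hlower]
  refine List.Perm.trans (List.Perm.of_eq ?_) (perm_of_injOn (n := n) (rot (k - 1) M)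
    (fun i hi => rot_lt (by omega) hsep (fun m hm => (hM.ks_bot hg hm).1) hi)
    (fun i _ j _ h => rot_injective (by omega) hsep h)
    (fun i => pt (bw L (k - 1) M u i)))
  refine List.map_congr_left fun i hi => ?_
  congr 1
  rcases off_cases (k - 1) M i with h | ⟨m, hm, h1, h2⟩ | h
  · rw [rot_start h, bw_last (by omega) h, if_pos (show i ∈ T from h)]
  · rw [rot_inside hsep hm h1 h2, bw_inside hg hM hm (by omega) (by omega),
      if_neg fun hc => by have := hsep m i hm hc h1; omega, Nat.sub_add_cancel (by omega)]
  · rw [rot_off (by omega) h, bw_off (by omega) h, if_neg fun hc => by have := h i hc; omega]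

end

/-! ### Replacing one part -/

theorem replace_perm {j : ℕ} (hj : j < n) (t : ℕ) :
    (pt t :: (ofSlots pt n u).erase (pt (u j))).Perm (ofSlots pt n (Function.update u j t)) := by
  have hjl : j < (ofSlots pt n u).length := by simpa using hj
  have h1 : ofSlots pt n (Function.update u j t) = (ofSlots pt n u).set j (pt t) := by
    refine List.ext_getElem? fun i => ?_
    by_cases h : i < n
    · rw [getElem?_ofSlots h, List.getElem?_set]
      by_cases hij : j = i
      · subst hij
        rw [if_pos rfl, if_pos (by simpa using h), Function.update_self]
      · rw [if_neg hij, Function.update_of_ne (Ne.symm hij), getElem?_ofSlots h]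
    · rw [List.getElem?_eq_none (by simpa using h), List.getElem?_eq_none (by simpa using h)]
  have h2 : (ofSlots pt n u)[j] = pt (u j) := by simp [ofSlots]
  have h3 := List.getElem_cons_eraseIdx_perm hjl
  rw [h2] at h3
  have h4 := List.perm_cons_erase (a := pt (u j)) (l := ofSlots pt n u) (mem_ofSlots.2 ⟨j, hj, rfl⟩)
  have h5 := (h3.trans h4).cons_inv
  rw [h1]
  exact (h5.symm.cons _).trans (List.set_perm_cons_eraseIdx hjl _).symm

theorem replacePart_ofSlots (hs : SlotMap A a c η L pt) {K j t : ℕ} (hj : j < n)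
    (hu : Adm L K n (Function.update u j t)) :
    replacePart (pt (u j)) (pt t) (ofSlots pt n u) = ofSlots pt n (Function.update u j t) :=
  sortParts_eq (replace_perm hj t) (pairwise_ofSlots hs hu)

theorem weight_update (hs : SlotMap A a c η L pt) {j : ℕ} (hj : j < n)
    (h0 : u j % L = L - 1) : weight (ofSlots pt n (Function.update u j (u j + 1)))
      = weight (ofSlots pt n u) + a := by
  have h1 := ((replace_perm (pt := pt) (u := u) hj (u j + 1)).map size).sum_eq
  have h2 := ((List.perm_cons_erase (a := pt (u j)) (l := ofSlots pt n u)
    (mem_ofSlots.2 ⟨j, hj, rfl⟩)).map size).sum_eq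
  rw [List.map_cons, List.sum_cons] at h1 h2
  rw [weight, weight, ← h1, h2, hs.size_succ _ h0]
  omega

/-! ### Counting the small parts -/

theorem SlotMap.countP_eq (hs : SlotMap A a c η L pt) :
    (ofSlots pt n u).countP (· ≤ plain η) = (List.range n).countP (fun i => u i ≤ L) := by
  rw [ofSlots, List.countP_map]
  refine List.countP_congr fun i _ => ?_
  simp [← hs.plain_eta, hs.strictMono.le_iff_le]

theorem SlotMap.countP_congr (hs : SlotMap A a c η L pt) {v : ℕ → ℕ}
    (h : ∀ i < n, (u i ≤ L ↔ v i ≤ L)) : (ofSlots pt n u).countP (· ≤ plain η)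
      = (ofSlots pt n v).countP (· ≤ plain η) := by
  rw [hs.countP_eq, hs.countP_eq]
  refine List.countP_congr fun i hi => ?_
  simpa using h i (List.mem_range.1 hi)

theorem SlotMap.countP_mono (hs : SlotMap A a c η L pt) {v : ℕ → ℕ}
    (h : ∀ i < n, u i ≤ L → v i ≤ L) : (ofSlots pt n u).countP (· ≤ plain η)
      ≤ (ofSlots pt n v).countP (· ≤ plain η) := by
  rw [hs.countP_eq, hs.countP_eq]
  refine List.countP_mono_left fun i hi => ?_
  simpa using h i (List.mem_range.1 hi)

/-- The small parts are the last ones. -/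
theorem SlotMap.le_iff_countP (hs : SlotMap A a c η L pt) {K : ℕ} (hu : Adm L K n u) {s : ℕ}
    (h : (ofSlots pt n u).countP (· ≤ plain η) = s) : s ≤ n ∧ ∀ i < n, u i ≤ L ↔ n ≤ i + s := by
  classical
  rw [hs.countP_eq] at h
  have hex : ∃ t, n ≤ t ∨ u t ≤ L := ⟨n, Or.inl le_rfl⟩
  have h1 := Nat.find_spec hex
  have h2 := fun i => Nat.find_min hex (m := i)
  have h3 : Nat.find hex ≤ n := Nat.find_min' hex (Or.inl le_rfl)
  generalize Nat.find hex = t at h1 h2 h3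
  have h4 : ∀ i < n, u i ≤ L ↔ t ≤ i := fun i hi => by
    constructor
    · intro h
      by_contra hc
      exact h2 i (by omega) (Or.inr h)
    · intro h
      rcases h1 with h1 | h1
      · omega
      · exact (hu.anti t i h hi).trans h1
  have h5 : (List.range n).countP (fun i => u i ≤ L) = n - t := by
    rw [List.countP_congr (q := fun i => decide (t ≤ i)) fun i hi => by
      simpa using h4 i (List.mem_range.1 hi)]
    obtain ⟨d, rfl⟩ := Nat.exists_eq_add_of_le h3
    rw [List.range_add, List.countP_append, List.countP_eq_zero.2, List.countP_eq_length.2]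
    · simp
    · intro i hi
      obtain ⟨x, _, rfl⟩ := List.mem_map.1 hi
      simp
    · intro i hi
      have := List.mem_range.1 hi
      simpa using this
  refine ⟨by omega, fun i hi => (h4 i hi).trans (by omega)⟩

/-! ### The set `B̄₁` in terms of slots -/

theorem SlotMap.exists_ofSlots (hs : SlotMap A a c η L pt) {r : ℕ} {π : List Part}
    (h : IsB1 A η k r π) : ∃ n u, π = ofSlots pt n u ∧ Adm L (k - 1) n u := by
  have hex : ∀ i, ∃ t, i < π.length → π[i]? = some (pt t) := fun i => by
    by_cases hi : i < π.length
    · obtain ⟨t, ht⟩ := hs.surj π[i] (h.residue _ (List.getElem_mem hi))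
        (h.plain_dvd _ (List.getElem_mem hi))
      exact ⟨t, fun _ => by rw [List.getElem?_eq_getElem hi, ht]⟩
    · exact ⟨0, fun h => absurd h hi⟩
  choose u hu using hex
  have heq : π = ofSlots pt π.length u := by
    refine List.ext_getElem? fun i => ?_
    by_cases hi : i < π.length
    · rw [hu i hi, getElem?_ofSlots hi]
    · rw [List.getElem?_eq_none (by simpa using hi), List.getElem?_eq_none (by simpa using hi)]
  have hle : ∀ i j, i < j → j < π.length → u j ≤ u i := fun i j hij hj => by
    have h1 := List.pairwise_iff_getElem.1 h.isOverpartition.sorted i j (by omega) hj hij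
    have h2 := hu i (by omega)
    have h3 := hu j hj
    rw [List.getElem?_eq_getElem (by omega), Option.some_inj] at h2 h3
    rw [h2, h3] at h1
    exact hs.strictMono.le_iff_le.1 h1
  have hmem : ∀ i < π.length, pt (u i) ∈ π := fun i hi => List.mem_of_getElem? (hu i hi)
  refine ⟨π.length, u, heq, ⟨fun i j hij hj => ?_, fun i hi he => ?_, fun i hi hn => ?_,
    fun i hi => (hs.pos _).1 (h.isOverpartition.pos _ (hmem i hi))⟩⟩
  · rcases hij.lt_or_eq with h1 | rfl
    · exact hle i j h1 hj
    · exact le_rfl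
  · by_contra h0
    have h1 := h.isOverpartition.over_once _ (hmem i (by omega)) ((hs.isOver _).2 h0)
    have h2 := two_le_count_iff.2 ⟨i, i + 1, by omega, hu i (by omega), he ▸ hu (i + 1) hi⟩
    omega
  · have h1 := h.gap i _ (hu i (by omega)) _ (hu (i + (k - 1)) hi)
    rw [hs.raise, hs.strictMono.le_iff_le, hs.strictMono.lt_iff_lt] at h1
    simp only [hs.isOver] at h1
    split_ifs at h1 with h2
    · have := hn.lt h2
      omega
    · have := hn.le
      omega

theorem SlotMap.isB1 (hs : SlotMap A a c η L pt) {r : ℕ} (hu : Adm L (k - 1) n u)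
    (hc : (ofSlots pt n u).countP (· ≤ plain η) ≤ r - 1) : IsB1 A η k r (ofSlots pt n u) where
  isOverpartition := hs.isOverpartition hu
  residue x hx := by
    obtain ⟨i, hi, rfl⟩ := mem_ofSlots.1 hx
    exact hs.residue _
  plain_dvd x hx ho := by
    obtain ⟨i, hi, rfl⟩ := mem_ofSlots.1 hx
    rw [hs.isOver, not_not] at ho
    obtain ⟨q, hq⟩ := Nat.dvd_of_mod_eq_zero ho
    rw [hq]
    clear ho hq
    -- The sizes in these slots are computed upwards from the slot `L`; the slot `0` is obtained
    -- from it by going back one period.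
    have h0 : η ∣ size (pt (L * q)) := by
      have key : ∀ q, size (pt (L * (q + 1))) = η * (q + 1) := fun q => by
        induction q with
        | zero => rw [zero_add, mul_one, hs.plain_eta]; simp [size, plain]
        | succ q ih =>
          rw [show L * (q + 1 + 1) = L * (q + 1) + L by ring, ← hs.raise]
          simp only [Bressoud.raise, size, ofLex_toLex]
          rw [size] at ih
          rw [ih]; ring
      rcases q with _ | q
      · have h1 := hs.raise 0
        rw [zero_add, hs.plain_eta] at h1
        have h2 : size (Bressoud.raise η (pt 0)) = η := by rw [h1]; rfl
        have h3 : size (pt 0) = 0 := by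
          simp only [Bressoud.raise, size, ofLex_toLex] at h2
          rw [size]
          omega
        rw [mul_zero, h3]
        exact dvd_zero _
      · rw [key q]; exact Dvd.intro _ rfl
    exact h0
  gap i x hx y hy := by
    obtain ⟨h1, rfl⟩ := mem_getElem?_ofSlots.1 hx
    obtain ⟨h2, rfl⟩ := mem_getElem?_ofSlots.1 hy
    have h3 := hu.gap i h2
    rw [hs.raise, hs.strictMono.le_iff_le, hs.strictMono.lt_iff_lt]
    simp only [hs.isOver]
    simp only [Nr, not_or, not_and] at h3
    split_ifs with h4
    · omega
    · rw [not_not] at h4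
      have := h3.2
      by_contra h5
      exact h3.2 (by omega) h4
  small := hc

end

/-! ### The slots for the residues `0, α₂, …, α_λ` -/

/-- The residue of the overlined parts in the slot `s` of a period. -/
def slotResidue (α : ℕ → ℕ) (s : ℕ) : ℕ := if s = 1 then 0 else α s

/-- The part in the slot `t`; a period consists of the non-overlined multiple of `η`, the overlined
one, and the overlined parts with residues `α₂, …, α_λ`. -/
def slotPart (lam η : ℕ) (α : ℕ → ℕ) (t : ℕ) : Part :=
  if t % (lam + 1) = 0 then plain (η * (t / (lam + 1)))
  else bar (η * (t / (lam + 1)) + slotResidue α (t % (lam + 1)))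

theorem bar_lt_bar {m n : ℕ} : bar m < bar n ↔ m < n := by
  simp [bar, Prod.Lex.toLex_lt_toLex]

theorem bar_lt_plain {m n : ℕ} : bar m < plain n ↔ m < n := by
  simp [bar, plain, Prod.Lex.toLex_lt_toLex]

theorem plain_lt_bar {m n : ℕ} : plain m < bar n ↔ m ≤ n := by
  simp only [bar, plain, Prod.Lex.toLex_lt_toLex, Bool.false_lt_true, and_true]
  omega

/-- The slots `0` and `1` hold the two fictitious parts of size `0`, so genuine parts begin at the
slot `2`. The relation `α 1 + α lam = η` makes the last slot of a period differ in size from the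
next multiple of `η` by `α 1`. -/
theorem slotMap_slotPart {lam η : ℕ} {α : ℕ → ℕ} (hlam : 2 ≤ lam) (hα_pos : 0 < α 1)
    (hα_lt : ∀ i, 1 ≤ i → i < lam → α i < α (i + 1)) (hα_η : α lam < η)
    (hα_symm : ∀ i, 1 ≤ i → i ≤ lam → α i + α (lam + 1 - i) = η) :
    SlotMap (α '' Set.Icc 2 lam) (α 1) (α lam) η (lam + 1) (slotPart lam η α) := by
  have hac : α 1 + α lam = η := by
    have := hα_symm 1 le_rfl (by omega)
    rwa [Nat.add_sub_cancel] at this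
  have hαmono : ∀ i j, 1 ≤ i → i < j → j ≤ lam → α i < α j := fun i j hi hij hj => by
    induction j, hij using Nat.le_induction with
    | base => exact hα_lt i hi (by omega)
    | succ j hij ih => exact (ih (by omega)).trans (hα_lt j (by omega) (by omega))
  have hβmono : ∀ i j, 1 ≤ i → i < j → j ≤ lam → slotResidue α i < slotResidue α j :=
    fun i j hi hij hj => by
      rw [slotResidue, slotResidue, if_neg (show j ≠ 1 by omega)]
      split_ifs with h
      · exact hα_pos.trans (hαmono 1 j le_rfl (by omega) hj)
      · exact hαmono i j hi hij hj
  have hβ1 : slotResidue α 1 = 0 := if_pos rfl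
  have hβlam : slotResidue α lam = α lam := if_neg (by omega)
  have hβle : ∀ i, 1 ≤ i → i ≤ lam → slotResidue α i ≤ α lam := fun i hi hi' => by
    rcases hi'.lt_or_eq with h | rfl
    · exact hβlam ▸ (hβmono i lam hi h le_rfl).le
    · exact hβlam.le
  have hpt0 : ∀ q, slotPart lam η α ((lam + 1) * q) = plain (η * q) := fun q => by
    rw [slotPart, Nat.mul_mod_right, if_pos rfl, Nat.mul_div_cancel_left _ (by omega)]
  have hpt : ∀ q s, 1 ≤ s → s ≤ lam →
      slotPart lam η α ((lam + 1) * q + s) = bar (η * q + slotResidue α s) := fun q s h1 h2 => by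
    rw [slotPart, Nat.mul_add_mod, Nat.mod_eq_of_lt (by omega), if_neg (by omega),
      Nat.mul_add_div (by omega), Nat.div_eq_of_lt (by omega), add_zero]
  have hex : ∀ t, (∃ q, t = (lam + 1) * q) ∨ ∃ q s, 1 ≤ s ∧ s ≤ lam ∧ t = (lam + 1) * q + s :=
    fun t => by
      have h1 := Nat.div_add_mod t (lam + 1)
      have h2 := Nat.mod_lt t (show 0 < lam + 1 by omega)
      rcases Nat.eq_zero_or_pos (t % (lam + 1)) with h | h
      · exact Or.inl ⟨_, by rw [h, add_zero] at h1; exact h1.symm⟩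
      · exact Or.inr ⟨_, _, h, by omega, h1.symm⟩
  have hm : ∀ q s, s ≤ lam → ((lam + 1) * q + s) % (lam + 1) = s := fun q s h => by
    rw [Nat.mul_add_mod, Nat.mod_eq_of_lt (by omega)]
  have hm0 : ∀ q, ((lam + 1) * q) % (lam + 1) = 0 := fun q => Nat.mul_mod_right _ _
  have hres : ∀ q s, 1 ≤ s → s ≤ lam → (η * q + slotResidue α s) % η = slotResidue α s :=
    fun q s h1 h2 => by
      rw [Nat.mul_add_mod, Nat.mod_eq_of_lt ((hβle s h1 h2).trans_lt hα_η)]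
  have hsp : ∀ m, size (plain m) = m := fun _ => rfl
  have hsb : ∀ m, size (bar m) = m := fun _ => rfl
  refine ⟨strictMono_nat_of_lt_succ fun t => ?_, fun t => ?_, fun t => ?_, fun t => ?_,
    fun t ht => ?_, fun t ht => ?_, fun t ht => ?_, ?_, ?_, ?_, ?_, fun t => ?_, fun t => ?_,
    fun x h1 h2 => ?_, by omega⟩
  · rcases hex t with ⟨q, rfl⟩ | ⟨q, s, h1, h2, rfl⟩
    · rw [hpt0, hpt q 1 le_rfl (by omega), plain_lt_bar, hβ1, add_zero]
    · rw [hpt q s h1 h2]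
      rcases h2.lt_or_eq with h3 | rfl
      · rw [add_assoc, hpt q (s + 1) (by omega) h3, bar_lt_bar]
        have := hβmono s (s + 1) h1 (by omega) h3
        omega
      · rw [show (s + 1) * q + s + 1 = (s + 1) * (q + 1) by ring, hpt0, bar_lt_plain, hβlam,
          mul_add, mul_one]
        omega
  · rcases hex t with ⟨q, rfl⟩ | ⟨q, s, h1, h2, rfl⟩
    · rw [show (lam + 1) * q + (lam + 1) = (lam + 1) * (q + 1) by ring, hpt0, hpt0]
      simp [raise, plain, size, mul_add]
    · rw [show (lam + 1) * q + s + (lam + 1) = (lam + 1) * (q + 1) + s by ring, hpt q s h1 h2,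
        hpt _ s h1 h2]
      simp only [raise, bar, size, ofLex_toLex]
      congr 2
      ring
  · rcases hex t with ⟨q, rfl⟩ | ⟨q, s, h1, h2, rfl⟩
    · rw [hpt0, hm0]
      simp [plain]
    · rw [hpt q s h1 h2, hm q s h2]
      exact ⟨fun _ => by omega, fun _ => rfl⟩
  · rcases hex t with ⟨q, rfl⟩ | ⟨q, s, h1, h2, rfl⟩
    · rw [hpt0, hm0, hsp, Nat.ModEq, Nat.mul_mod_right, Nat.mod_eq_of_lt hα_η]
      have := hαmono 1 lam le_rfl (by omega) le_rfl
      omega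
    · rw [hpt q s h1 h2, hm q s h2, hsb, Nat.ModEq, hres q s h1 h2, Nat.mod_eq_of_lt hα_η]
      constructor
      · intro h
        by_contra hne
        have := hβmono s lam h1 (by omega) le_rfl
        omega
      · intro h
        rw [← hβlam]
        congr 1
  · rcases hex t with ⟨q, rfl⟩ | ⟨q, s, h1, h2, rfl⟩
    · rw [hm0] at ht
      omega
    · rw [hm q s h2] at ht
      obtain rfl : s = lam := by omega
      rw [hpt q s h1 h2, show (s + 1) * q + s + 1 = (s + 1) * (q + 1) by ring, hpt0, hsp, hsb,
        hβlam, mul_add, mul_one]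
      omega
  · rcases hex t with ⟨q, rfl⟩ | ⟨q, s, h1, h2, rfl⟩
    · rw [hpt0, hsp]
    · rw [hm q s h2] at ht
      omega
  · rcases hex t with ⟨q, rfl⟩ | ⟨q, s, h1, h2, rfl⟩
    · exact absurd (hm0 q) ht
    · rw [hpt q s h1 h2, hsb]
  · have := hpt0 1
    rwa [mul_one, mul_one] at this
  · have := hpt 0 lam (by omega) le_rfl
    rw [hβlam, mul_zero, mul_zero, zero_add, zero_add] at this
    rw [Nat.add_sub_cancel]
    exact this
  · have := hpt 1 lam (by omega) le_rfl
    rw [hβlam, mul_one, mul_one] at this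
    rw [← this]
    congr 1
    omega
  · rw [show 2 * (lam + 1) = (lam + 1) * 2 by ring, hpt0, bar_lt_plain]
    have := hαmono 1 lam le_rfl (by omega) le_rfl
    omega
  · rcases hex t with ⟨q, rfl⟩ | ⟨q, s, h1, h2, rfl⟩
    · rw [hpt0, hsp]
      rcases q with _ | q
      · simp
      · have h3 : 0 < η * (q + 1) := Nat.mul_pos (by omega) (by omega)
        have h4 : lam + 1 ≤ (lam + 1) * (q + 1) := Nat.le_mul_of_pos_right _ (by omega)
        exact ⟨fun _ => by omega, fun _ => h3⟩
    · rw [hpt q s h1 h2, hsb]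
      rcases q with _ | q
      · simp only [mul_zero, zero_add]
        rcases h1.lt_or_eq with h3 | rfl
        · have := hβmono 1 s le_rfl h3 h2
          omega
        · rw [hβ1]
          omega
      · have h3 : 0 < η * (q + 1) := Nat.mul_pos (by omega) (by omega)
        have h4 : lam + 1 ≤ (lam + 1) * (q + 1) := Nat.le_mul_of_pos_right _ (by omega)
        exact ⟨fun _ => by omega, fun _ => by omega⟩
  · rcases hex t with ⟨q, rfl⟩ | ⟨q, s, h1, h2, rfl⟩
    · left
      rw [hpt0, hsp, Nat.ModEq, Nat.mul_mod_right, Nat.zero_mod]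
    · rw [hpt q s h1 h2, hsb, Nat.ModEq, hres q s h1 h2]
      rcases h1.lt_or_eq with h3 | rfl
      · right
        refine ⟨α s, ⟨s, ⟨h3, h2⟩, rfl⟩, ?_⟩
        rw [Nat.ModEq, hres q s h1 h2]
        have h4 : slotResidue α s = α s := if_neg (by omega)
        rw [h4, Nat.mod_eq_of_lt (h4 ▸ (hβle s h1 h2).trans_lt hα_η)]
      · left
        rw [hβ1, Nat.zero_mod]
  · obtain ⟨m, b⟩ : ∃ m b, x = toLex (m, b) := ⟨(ofLex x).1, (ofLex x).2, rfl⟩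
    rcases b with ⟨b, rfl⟩
    have hsize : size (toLex (m, b)) = m := rfl
    rw [hsize] at h1 h2
    have hq := Nat.div_add_mod m η
    rcases h1 with h1 | ⟨_, ⟨i, ⟨hi1, hi2⟩, rfl⟩, h1⟩
    · rw [Nat.ModEq, Nat.zero_mod] at h1
      rw [h1, add_zero] at hq
      cases b
      · exact ⟨_, (hpt0 (m / η)).trans (by rw [hq]; rfl)⟩
      · exact ⟨_, (hpt (m / η) 1 le_rfl (by omega)).trans (by rw [hβ1, add_zero, hq]; rfl)⟩
    · have h4 : slotResidue α i = α i := if_neg (by omega)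
      have h5 := h4 ▸ hβle i (by omega) hi2
      have h6 := hαmono 1 i le_rfl (by omega) hi2
      rw [Nat.ModEq, Nat.mod_eq_of_lt (by omega : α i < η)] at h1
      cases b
      · have := Nat.mod_eq_zero_of_dvd (h2 (by simp))
        omega
      · exact ⟨_, (hpt (m / η) i (by omega) hi2).trans (by rw [h4, ← h1, hq]; rfl)⟩

section

variable {A : Set ℕ} {a c η L : ℕ} {pt : ℕ → Part} {k n p : ℕ} {u : ℕ → ℕ}

/-! ### Marked parts -/

theorem parts_ofSlots {l : List ℕ} (h : ∀ i ∈ l, i < n) :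
    l.filterMap (fun i => (ofSlots pt n u)[i]?) = l.map fun i => pt (u i) := by
  induction l with
  | nil => rfl
  | cons x l ih =>
    rw [List.filterMap_cons_some (getElem?_ofSlots (h x List.mem_cons_self)),
      ih fun i hi => h i (List.mem_cons_of_mem _ hi), List.map_cons]

variable (hs : SlotMap A a c η L pt) (hk : 3 ≤ k) (hu : Adm L (k - 1) n u)

include hs hk hu

theorem gPos_lt {i : ℕ} (hi : i ∈ gPos η k (ofSlots pt n u)) : i < n := by
  have := ((hs.botGreedy hk hu i).1 hi).1.1
  omega

theorem gParts_ofSlots : gParts η k (ofSlots pt n u)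
    = (gPos η k (ofSlots pt n u)).map fun i => pt (u i) :=
  parts_ofSlots fun _ => gPos_lt hs hk hu

theorem rParts_ofSlots : rParts η k (ofSlots pt n u)
    = (rPos η k (ofSlots pt n u)).map fun i => pt (u i) :=
  parts_ofSlots fun _ hi => (hs.rPos_bounds hk hu hi).2

theorem mem_rStarts {q i : ℕ} :
    i ∈ ((rPos η k (ofSlots pt n u)).take q).map (fun x => x + 1 - (k - 1))
      ↔ rTake η k q (ofSlots pt n u) i := by
  rw [List.mem_map]
  constructor
  · rintro ⟨x, hx, rfl⟩
    have := hs.rPos_bounds hk hu (List.mem_of_mem_take hx)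
    rw [rTake, show x + 1 - (k - 1) + (k - 1) - 1 = x by omega]
    exact hx
  · intro h
    exact ⟨_, h, by omega⟩

theorem rStarts_sorted (q : ℕ) :
    (((rPos η k (ofSlots pt n u)).take q).map (fun x => x + 1 - (k - 1))).Pairwise (· < ·) := by
  rw [List.pairwise_map]
  refine ((rPos_sorted η k _).sublist (List.take_sublist _ _)).imp_of_mem fun h1 h2 h => ?_
  have := hs.rPos_bounds hk hu (List.mem_of_mem_take h1)
  omega

/-- The rotated starts form an initial segment of the bottom-greedy starts, and there are `p` of
them; hence they are the first `p`. -/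
theorem gTake_fw (hp : p ≤ (rPos η k (ofSlots pt n u)).length) :
    gTake η k p (ofSlots pt n (fw L (k - 1) (rTake η k p (ofSlots pt n u)) u))
      = rTake η k p (ofSlots pt n u) := by
  have hr := hs.topGreedy hk hu
  have hM := ini_rTake η k p (ofSlots pt n u)
  have hadm := fw_adm (by omega) hu hr hM
  have hg := hs.botGreedy hk hadm
  have h := take_eq_of_mem_iff (gPos_sorted η k
    (ofSlots pt n (fw L (k - 1) (rTake η k p (ofSlots pt n u)) u)))
    (rStarts_sorted hs hk hu p)
    (fun i hi => fw_mem_bot (by omega) hu hr hM hg ((mem_rStarts hs hk hu).1 hi))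
    (fun i hi j hj hji => (mem_rStarts hs hk hu).2 (fw_bot_mem (by omega) hu hr hM hg
      ((mem_rStarts hs hk hu).1 hi) hj (by omega)))
  rw [List.length_map, List.length_take, min_eq_left hp] at h
  ext i
  rw [gTake, h, mem_rStarts hs hk hu]

theorem length_gPos_fw :
    (gPos η k (ofSlots pt n (fw L (k - 1) (rTake η k p (ofSlots pt n u)) u))).length
      = (rPos η k (ofSlots pt n u)).length := by
  have hr := hs.topGreedy hk hu
  have hM := ini_rTake η k p (ofSlots pt n u)
  have hadm := fw_adm (by omega) hu hr hM
  have hg := hs.botGreedy hk hadm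
  have hmem : ∀ i, i ∈ ((rPos η k (ofSlots pt n u)).take
      (rPos η k (ofSlots pt n u)).length).map (fun x => x + 1 - (k - 1))
        ↔ rStart η k (ofSlots pt n u) i := fun i => by
    rw [mem_rStarts hs hk hu, rTake, List.take_length, rStart]
  have hsort := rStarts_sorted hs hk hu (rPos η k (ofSlots pt n u)).length
  have hlen : (((rPos η k (ofSlots pt n u)).take (rPos η k (ofSlots pt n u)).length).map
      (fun x => x + 1 - (k - 1))).length = (rPos η k (ofSlots pt n u)).length := by simp
  rw [← hlen]
  apply le_antisymm
  · refine length_le_of_windows' (K := k - 1) (nodup_of_sorted (gPos_sorted _ _ _))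
      (fun i hi j hj => hg.sep hi hj) fun i hi => ?_
    obtain ⟨x, h1, h2⟩ := fw_exists_top (by omega) hu hr hM hg hi
    exact ⟨x, (hmem x).2 h1, h2⟩
  · refine length_le_of_windows (K := k - 1) (nodup_of_sorted hsort)
      (fun i hi j hj => hr.sep ((hmem i).1 hi) ((hmem j).1 hj)) fun i hi => ?_
    obtain ⟨x, h1, h2⟩ := fw_exists_bot (by omega) hu hr hM hg ((hmem i).1 hi)
    exact ⟨x, h1, h2⟩

theorem rTake_bw (hl : Lowerable L (k - 1) n u (gTake η k p (ofSlots pt n u)))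
    (hp : p ≤ (gPos η k (ofSlots pt n u)).length) :
    rTake η k p (ofSlots pt n (bw L (k - 1) (gTake η k p (ofSlots pt n u)) u))
      = gTake η k p (ofSlots pt n u) := by
  have hg := hs.botGreedy hk hu
  have hM := ini_gTake η k p (ofSlots pt n u)
  have hadm := bw_adm (by omega) hu hg hM hl
  have hr := hs.topGreedy hk hadm
  have hsort : (((gPos η k (ofSlots pt n u)).take p).map
      (fun x => x + (k - 1) - 1)).Pairwise (· < ·) := by
    rw [List.pairwise_map]
    exact ((gPos_sorted η k _).sublist (List.take_sublist _ _)).imp fun h => by omega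
  have h := take_eq_of_mem_iff (rPos_sorted η k
    (ofSlots pt n (bw L (k - 1) (gTake η k p (ofSlots pt n u)) u))) hsort
    (fun i hi => by
      obtain ⟨m, hm, rfl⟩ := List.mem_map.1 hi
      exact bw_mem_top (by omega) hu hg hM hl hr hm)
    (fun i hi j hj hji => by
      obtain ⟨m, hm, rfl⟩ := List.mem_map.1 hi
      have h1 := hs.rPos_bounds hk hadm hj
      refine List.mem_map.2 ⟨j + 1 - (k - 1), bw_top_mem (by omega) hu hg hM hl hr hm ?_
        (by omega), by omega⟩
      rw [rStart, show j + 1 - (k - 1) + (k - 1) - 1 = j by omega]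
      exact hj)
  rw [List.length_map, List.length_take, min_eq_left hp] at h
  ext i
  rw [rTake, h, List.mem_map, gTake]
  constructor
  · rintro ⟨x, hx, hxi⟩
    obtain rfl : x = i := by omega
    exact hx
  · exact fun h => ⟨i, h, rfl⟩

theorem length_rPos_bw (hl : Lowerable L (k - 1) n u (gTake η k p (ofSlots pt n u))) :
    (rPos η k (ofSlots pt n (bw L (k - 1) (gTake η k p (ofSlots pt n u)) u))).length
      = (gPos η k (ofSlots pt n u)).length := by
  have hg := hs.botGreedy hk hu
  have hM := ini_gTake η k p (ofSlots pt n u)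
  have hadm := bw_adm (by omega) hu hg hM hl
  have hr := hs.topGreedy hk hadm
  generalize hπ : ofSlots pt n (bw L (k - 1) (gTake η k p (ofSlots pt n u)) u) = π at hr ⊢
  have hmem : ∀ i, i ∈ ((rPos η k π).take (rPos η k π).length).map (fun x => x + 1 - (k - 1))
        ↔ rStart η k π i := fun i => by
    rw [← hπ, mem_rStarts hs hk hadm, rTake, List.take_length, rStart]
  have hsort := rStarts_sorted hs hk hadm (rPos η k π).length
  rw [hπ] at hsort
  have hlen : (((rPos η k π).take (rPos η k π).length).map
      (fun x => x + 1 - (k - 1))).length = (rPos η k π).length := by simp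
  rw [← hlen]
  apply le_antisymm
  · refine length_le_of_windows (K := k - 1) (nodup_of_sorted hsort)
      (fun i hi j hj => hr.sep ((hmem i).1 hi) ((hmem j).1 hj)) fun i hi => ?_
    obtain ⟨x, h1, h2⟩ := bw_exists_bot (by omega) hu hg hM hl hr ((hmem i).1 hi)
    exact ⟨x, h1, h2⟩
  · refine length_le_of_windows' (K := k - 1) (nodup_of_sorted (gPos_sorted _ _ _))
      (fun i hi j hj => hg.sep hi hj) fun i hi => ?_
    obtain ⟨x, h1, h2⟩ := bw_exists_top (by omega) hu hg hM hl hr hi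
    exact ⟨x, (hmem x).2 h1, h2⟩

/-! ### Conditions for the moves -/

theorem canForward (hp : p ≤ (rPos η k (ofSlots pt n u)).length) :
    CanForward η k p (ofSlots pt n u) where
  isOverpartition := hs.isOverpartition hu
  marks := hs.reverseGordonMarks_le hk hu
  le := by rwa [rParts_ofSlots hs hk hu, List.length_map]

theorem canBackward (hp : p ≤ (gPos η k (ofSlots pt n u)).length)
    (hl : Lowerable L (k - 1) n u (gTake η k p (ofSlots pt n u)))
    (hge : ∀ m, gTake η k p (ofSlots pt n u) m → 2 * L < u m) :
    CanBackward a η k p (ofSlots pt n u) := by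
  have key : 1 ≤ p → ∀ g ∈ (gParts η k (ofSlots pt n u))[p - 1]?, ∃ m, pt (u m) = g ∧
      gTake η k p (ofSlots pt n u) m ∧ ∀ m', gTake η k p (ofSlots pt n u) m' → m' ≤ m := by
    intro hp1 g hg
    rw [gParts_ofSlots hs hk hu, List.getElem?_map] at hg
    obtain ⟨m, hm, rfl⟩ := Option.map_eq_some_iff.1 hg
    refine ⟨m, rfl, ?_, fun m' hm' => ?_⟩
    · refine List.mem_iff_getElem?.2 ⟨p - 1, ?_⟩
      rw [List.getElem?_take, if_pos (by omega), hm]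
    · by_contra h
      have h1 : m ∈ (gPos η k (ofSlots pt n u)).take (p - 1) ∨ m' ≤ m := by
        right
        obtain ⟨q, hq⟩ := List.mem_iff_getElem?.1 hm'
        rw [List.getElem?_take] at hq
        split_ifs at hq with hqp
        obtain ⟨h1, rfl⟩ := List.getElem?_eq_some_iff.1 hm
        obtain ⟨h2, rfl⟩ := List.getElem?_eq_some_iff.1 hq
        rcases (show q ≤ p - 1 by omega).lt_or_eq with h3 | rfl
        · exact (List.pairwise_iff_getElem.1 (gPos_sorted η k _) q (p - 1) h2 h1 h3).le
        · exact le_rfl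
      rcases h1 with h1 | h1
      · exact notMem_take_getElem? (gPos_sorted η k _) hm h1
      · exact h h1
  refine ⟨hs.isOverpartition hu, hs.gordonMarks_le hk hu, ?_, fun hp1 g hg => ?_,
    fun hp1 g hg i hi => ?_⟩
  · rwa [gParts_ofSlots hs hk hu, List.length_map]
  · obtain ⟨m, rfl, hm, _⟩ := key hp1 g hg
    exact hs.bar_eta_add.le.trans (hs.strictMono.monotone (hge m hm).le)
  · obtain ⟨m, rfl, hm, hmax⟩ := key hp1 g hg
    rw [hs.isKSet hk] at hi
    rintro ⟨h1, h2⟩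
    have h3 := hi.1
    have h4 := h1 _ (mem_window.2 ⟨i, le_rfl, by omega, by omega, rfl⟩)
    have h5 := h2 _ (mem_window.2 ⟨i + (k - 1) - 1, by omega, by omega, by omega, rfl⟩)
    have h6 : raise (2 * η) (pt (u (i + (k - 1) - 1))) = pt (u (i + (k - 1) - 1) + L + L) := by
      rw [← hs.raise, ← hs.raise]
      simp only [raise, size, ofLex_toLex]
      congr 2
      ring
    rw [h6, hs.strictMono.lt_iff_lt, hs.strictMono.le_iff_le] at h5
    simp only [hs.isOver] at h5
    refine hl.no_set m hm hmax i hi (hs.strictMono.lt_iff_lt.1 h4) ?_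
    split_ifs at h5 with h7
    · exact Or.inl h5
    · rw [not_not] at h7
      rcases h5.lt_or_eq with h8 | h8
      · exact Or.inl h8
      · exact Or.inr ⟨h8, h7⟩

/-! ### Non-degenerate parts -/

omit hu in
theorem isNonDegSet_iff (m : ℕ) :
    IsNonDegSet c η k (ofSlots pt n u) m ↔ ND L (k - 1) n u m := by
  rw [IsNonDegSet, ND, hs.isKSet hk]
  refine and_congr_right fun h => ?_
  have h1 := h.1
  constructor
  · intro h2 l h3 h4 h5
    exact h2 _ (mem_window.2 ⟨l, h3, h4, by omega, rfl⟩) ((hs.mod _).2 h5)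
  · intro h2 y hy h5
    obtain ⟨l, h3, h4, _, rfl⟩ := mem_window.1 hy
    exact h2 l h3 h4 ((hs.mod _).1 h5)

/-- Any other non-degenerate window starts no later than `e`. If it contains `j`, its largest
multiple of `L` is at least `u j`; otherwise it ends before `j`, and all its entries are at least `u
j`. -/
theorem smallestNonDegPart_ofSlots {e j : ℕ} (h : LastND L (k - 1) n u e j) :
    smallestNonDegPart c η k (ofSlots pt n u) = some (pt (u j)) := by
  have hn := h.nd.1.1
  have hle := h.le
  have hlt := h.lt
  rw [smallestNonDegPart, List.min?_eq_some_iff]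
  constructor
  · refine List.mem_filter.2 ⟨mem_ofSlots.2 ⟨j, by omega, rfl⟩, decide_eq_true ?_⟩
    refine ⟨e, by rw [length_ofSlots]; omega, (isNonDegSet_iff hs hk e).2 h.nd, j,
      by rw [length_ofSlots]; omega, hle, by omega, getElem?_ofSlots (by omega), ?_, ?_, ?_⟩
    · rw [hs.isOver, not_not]; exact h.mod
    · intro y hy ho
      obtain ⟨l, h3, h4, _, rfl⟩ := mem_window.1 hy
      rw [hs.isOver, not_not] at ho
      exact hs.strictMono.monotone (h.largest l h3 h4 ho)
    · intro y hy
      obtain ⟨h3, rfl⟩ := mem_getElem?_ofSlots.1 hy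
      exact hs.strictMono (h.next h3)
  · intro x hx
    obtain ⟨m, _, h1, l, _, h2, h3, h4, h5, h6, _⟩ := of_decide_eq_true (List.mem_filter.1 hx).2
    obtain ⟨hl, rfl⟩ := mem_getElem?_ofSlots.1 h4
    have h7 := h.max m ((isNonDegSet_iff hs hk m).1 h1)
    by_cases h8 : j < m + (k - 1)
    · refine h6 _ (mem_window.2 ⟨j, by omega, h8, by omega, rfl⟩) ?_
      rw [hs.isOver, not_not]; exact h.mod
    · exact hs.strictMono.monotone (hu.anti l j (by omega) (by omega))

omit hk hu in
theorem subtractPart_ofSlots {K j : ℕ} (hj : j < n) (h0 : u j % L = 0) (hpos : 0 < u j)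
    (hadm : Adm L K n (unbump u j)) :
    subtractPart a (pt (u j)) (ofSlots pt n u) = ofSlots pt n (unbump u j) := by
  have h1 := sub_one_mod_eq hs.three_le h0 hpos
  have h2 := hs.size_succ _ h1
  rw [Nat.sub_add_cancel hpos] at h2
  have h3 := hs.three_le
  rw [subtractPart, h2, Nat.add_sub_cancel, hs.bar_size _ (by omega)]
  exact replacePart_ofSlots hs hj hadm

theorem degenerate_of_lt {N e j : ℕ} (hp : p < N) (h : LastND L (k - 1) n u e j) :
    degenerate a c η k N p (ofSlots pt n u) = ofSlots pt n (unbump u j) := by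
  have hj : j < n := by have := h.nd.1.1; have := h.lt; omega
  have := hu.pos j hj
  rw [degenerate, if_pos hp, smallestNonDegPart_ofSlots hs hk hu h]
  exact subtractPart_ofSlots hs hj h.mod (by omega) (h.unbump_adm hs.three_le (by omega) hu)

omit hk hu in
theorem degenerate_of_eq {N K j : ℕ} (hp : ¬ p < N) (hj : j < n) (h : u j = L)
    (hadm : Adm L K n (unbump u j)) :
    degenerate a c η k N p (ofSlots pt n u) = ofSlots pt n (unbump u j) := by
  have := hs.three_le
  rw [degenerate, if_neg hp, ← hs.plain_eta, ← h]
  exact subtractPart_ofSlots hs hj (by rw [h, Nat.mod_self]) (by omega) hadm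

/-! ### The part to which the addition applies -/

theorem mem_rSet {i : ℕ} (hi : i ∈ rPos η k (ofSlots pt n u)) {y : Part} :
    y ∈ rSet η (ofSlots pt n u) i ↔ ∃ l, i + 1 ≤ l + (k - 1) ∧ l ≤ i ∧ pt (u l) = y := by
  obtain ⟨h1, h2⟩ := hs.rPos_bounds hk hu hi
  rw [rSet, getElem?_ofSlots h2]
  simp only [List.mem_append, List.mem_filter, decide_eq_true_eq, List.mem_singleton]
  have hS : KS L (k - 1) n u (i + 1 - (k - 1)) := ((hs.topGreedy hk hu _).1 (by
    rw [rStart, show i + 1 - (k - 1) + (k - 1) - 1 = i by omega]; exact hi)).1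
  constructor
  · rintro (⟨h3, h4⟩ | rfl)
    · obtain ⟨l, hl⟩ := List.mem_iff_getElem?.1 h3
      rw [List.getElem?_take] at hl
      split_ifs at hl with hli
      obtain ⟨_, rfl⟩ := mem_getElem?_ofSlots.1 hl
      rw [hs.nearBot] at h4
      refine ⟨l, ?_, hli.le, rfl⟩
      by_contra hc
      exact hu.gap l (by omega) (h4.mono le_rfl (hu.anti _ _ (by omega) h2))
    · exact ⟨i, by omega, le_rfl, rfl⟩
  · rintro ⟨l, h3, h4, rfl⟩
    rcases h4.lt_or_eq with h5 | rfl
    · left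
      refine ⟨List.mem_iff_getElem?.2 ⟨l, ?_⟩, ?_⟩
      · rw [List.getElem?_take, if_pos h5, getElem?_ofSlots (by omega)]
      · rw [hs.nearBot]
        have := hS.2
        rw [show i + 1 - (k - 1) + (k - 1) - 1 = i by omega] at this
        exact this.mono (hu.anti _ _ (by omega) (by omega)) le_rfl
    · exact Or.inr rfl

theorem rPos_of_addAt {m' j : ℕ}
    (ha : AddAt L (k - 1) n u (rStart η k (ofSlots pt n u)) (rTake η k p (ofSlots pt n u)) m' j) :
    (rPos η k (ofSlots pt n u))[p]? = some (m' + (k - 1) - 1) := by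
  have h1 : m' + (k - 1) - 1 ∈ rPos η k (ofSlots pt n u) := ha.mem
  have h2 : m' + (k - 1) - 1 ∉ (rPos η k (ofSlots pt n u)).take p := ha.notMem
  obtain ⟨q, hq⟩ := List.mem_iff_getElem?.1 h1
  have hpq : p ≤ q := by
    by_contra h
    refine h2 (List.mem_iff_getElem?.2 ⟨q, ?_⟩)
    rw [List.getElem?_take, if_pos (by omega), hq]
  obtain ⟨h3, _⟩ := List.getElem?_eq_some_iff.1 hq
  have h4 := List.getElem?_eq_getElem (hpq.trans_lt h3)
  generalize (rPos η k (ofSlots pt n u))[p]'(hpq.trans_lt h3) = i at h4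
  have h5 := getElem?_le_of_notMem_take (rPos_sorted η k _) h4 h1 h2
  have h6 := List.mem_of_getElem? h4
  have h7 := notMem_take_getElem? (rPos_sorted η k _) h4
  have h8 := hs.rPos_bounds hk hu h6
  have e : i + 1 - (k - 1) + (k - 1) - 1 = i := by omega
  have h9 := ha.min (i + 1 - (k - 1)) (by rw [rStart, e]; exact h6) (by rw [rTake, e]; exact h7)
  rw [h4]
  congr 1
  omega

/-- The search finds the right part since a window has at most one entry congruent to `-1`. -/
theorem additionPart_of_addAt {m' j : ℕ}
    (ha : AddAt L (k - 1) n u (rStart η k (ofSlots pt n u)) (rTake η k p (ofSlots pt n u)) m' j) :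
    additionPart c η k p (ofSlots pt n u) = pt (u j) := by
  have hr := hs.topGreedy hk hu
  have h3 := hs.three_le
  have hle := ha.le
  have hlt := ha.lt
  rw [additionPart, rPos_of_addAt hs hk hu ha]
  simp only
  have hmem : ∀ y, y ∈ rSet η (ofSlots pt n u) (m' + (k - 1) - 1) ↔ _ :=
    fun y => mem_rSet hs hk hu ha.mem
  have hex : ((rSet η (ofSlots pt n u) (m' + (k - 1) - 1)).find?
      fun x => size x ≡ c [MOD η]).isSome = true := by
    refine List.find?_isSome.2 ⟨pt (u j), (hmem _).2 ⟨j, by omega, by omega, rfl⟩, ?_⟩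
    simpa using (hs.mod _).2 ha.mod
  obtain ⟨y, hy⟩ := Option.isSome_iff_exists.1 hex
  rw [hy, Option.getD_some]
  have h1 := List.find?_some hy
  obtain ⟨l, h4, h5, rfl⟩ := (hmem y).1 (List.mem_of_find?_eq_some hy)
  have h6 := (hs.mod (u l)).1 (by simpa using h1)
  rw [eq_of_mod_eq_of_ks hu (ha.ks hr) (i := l) (j := j) (by omega) (by omega) hle hlt
    (h6.trans ha.mod.symm) (by rw [ha.mod]; omega)]

theorem exists_addAt {i : ℕ} (hi : (rPos η k (ofSlots pt n u))[p]? = some i) {x : Part}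
    (hx : x ∈ rSet η (ofSlots pt n u) i) (hxc : size x ≡ c [MOD η])
    (hdeg : ∀ m, IsKSet η k (ofSlots pt n u) m → (∀ y ∈ window k (ofSlots pt n u) m, y < x) →
      ∃ y ∈ window k (ofSlots pt n u) m, size y ≡ c [MOD η]) :
    ∃ m' j, AddAt L (k - 1) n u (rStart η k (ofSlots pt n u)) (rTake η k p (ofSlots pt n u))
      m' j := by
  have h1 := List.mem_of_getElem? hi
  have h2 := hs.rPos_bounds hk hu h1
  have h3 := hs.three_le
  have e : i + 1 - (k - 1) + (k - 1) - 1 = i := by omega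
  obtain ⟨j, h4, h5, rfl⟩ := (mem_rSet hs hk hu h1).1 hx
  have h6 := (hs.mod _).1 hxc
  refine ⟨i + 1 - (k - 1), j, ?_, ?_, fun l hl hl' => ?_, by omega, by omega, h6, fun l hl hS => ?_⟩
  · rw [rStart, e]; exact h1
  · rw [rTake, e]; exact notMem_take_getElem? (rPos_sorted η k _) hi
  · have := getElem?_le_of_notMem_take (rPos_sorted η k _) hi hl hl'
    omega
  · have hn := hS.1
    obtain ⟨y, hy, hyc⟩ := hdeg l ((hs.isKSet hk l).2 hS) fun y hy => by
      obtain ⟨x, h7, h8, h9, rfl⟩ := mem_window.1 hy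
      exact hs.strictMono (hu.lt_of_strict_left (by omega) h9 (by omega))
    obtain ⟨x, h7, h8, h9, rfl⟩ := mem_window.1 hy
    exact ⟨x, h7, h8, (hs.mod _).1 hyc⟩

theorem degenerate_sets_of_addAt {m' j : ℕ}
    (ha : AddAt L (k - 1) n u (rStart η k (ofSlots pt n u)) (rTake η k p (ofSlots pt n u)) m' j) :
    ∃ i ∈ (rPos η k (ofSlots pt n u))[p]?, ∃ x ∈ rSet η (ofSlots pt n u) i, size x ≡ c [MOD η] ∧
      ∀ m, IsKSet η k (ofSlots pt n u) m → (∀ y ∈ window k (ofSlots pt n u) m, y < x) →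
        ∃ y ∈ window k (ofSlots pt n u) m, size y ≡ c [MOD η] := by
  have hle := ha.le
  have hlt := ha.lt
  refine ⟨_, rPos_of_addAt hs hk hu ha, pt (u j), (mem_rSet hs hk hu ha.mem).2
    ⟨j, by omega, by omega, rfl⟩, (hs.mod _).2 ha.mod, fun m hm hlt => ?_⟩
  rw [hs.isKSet hk] at hm
  have hn := hm.1
  have h1 := hlt _ (mem_window.2 ⟨m, le_rfl, by omega, by omega, rfl⟩)
  have hjm : j < m := by
    by_contra h
    have := hu.anti m j (by omega) (ha.j_lt (hs.topGreedy hk hu))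
    have := hs.strictMono.lt_iff_lt.1 h1
    omega
  obtain ⟨l, h2, h3, h4⟩ := ha.deg m hjm hm
  exact ⟨_, mem_window.2 ⟨l, h2, h3, by omega, rfl⟩, (hs.mod _).2 h4⟩

/-! ### The addition as an operation on slots -/

theorem addition_ofSlots {j : ℕ} (hj : j < n) (h0 : u j % L = L - 1)
    (hMj : ∀ m, rTake η k p (ofSlots pt n u) m → m + (k - 1) ≤ j)
    (hpart : additionPart c η k p (ofSlots pt n u) = pt (u j))
    (hadm : Adm L (k - 1) n (addSeq L (k - 1) (rTake η k p (ofSlots pt n u)) u j)) :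
    addition a c η k p (ofSlots pt n u)
      = ofSlots pt n (addSeq L (k - 1) (rTake η k p (ofSlots pt n u)) u j) := by
  have h1 := fw_eq_of_ge (L := L) (u := u) (show 2 ≤ k - 1 by omega) hMj
  rw [addition, hpart, forwardMove_ofSlots hs hk hu, ← hs.size_succ _ h0,
    hs.plain_size _ (add_one_mod_eq_zero hs.three_le h0)]
  conv_lhs => rw [← h1]
  exact replacePart_ofSlots hs hj hadm

theorem additionPart_mem {j : ℕ} (hj : j < n)
    (hMj : ∀ m, rTake η k p (ofSlots pt n u) m → m + (k - 1) ≤ j)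
    (hpart : additionPart c η k p (ofSlots pt n u) = pt (u j)) :
    additionPart c η k p (ofSlots pt n u) ∈ forwardMove η k p (ofSlots pt n u) := by
  rw [hpart, forwardMove_ofSlots hs hk hu]
  exact mem_ofSlots.2 ⟨j, hj, by rw [fw_eq_of_ge (by omega) hMj]⟩

theorem weight_addSeq {j : ℕ} (hp : p ≤ (rPos η k (ofSlots pt n u)).length) (hj : j < n)
    (h0 : u j % L = L - 1) (hMj : ∀ m, rTake η k p (ofSlots pt n u) m → m + (k - 1) ≤ j) :
    weight (ofSlots pt n (addSeq L (k - 1) (rTake η k p (ofSlots pt n u)) u j))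
      = weight (ofSlots pt n u) + p * η + a := by
  rw [addSeq, weight_update hs hj (by rw [fw_eq_of_ge (by omega) hMj]; exact h0),
    weight_forwardMove hs hk hu hp]

omit hk hu in
theorem countP_bump {j : ℕ} (h0 : u j % L = L - 1) :
    (ofSlots pt n (Function.update u j (u j + 1))).countP (· ≤ plain η)
      = (ofSlots pt n u).countP (· ≤ plain η) := by
  have h3 := hs.three_le
  refine hs.countP_congr fun i _ => ?_
  by_cases h : i = j
  · subst h
    rw [Function.update_self]
    have : u i ≠ L := fun h => by rw [h, Nat.mod_self] at h0; omega
    omega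
  · rw [Function.update_of_ne h]

omit hk hu in
theorem countP_unbump {K j : ℕ} (hu : Adm L K n u) (hj : j < n) (h0 : u j % L = 0) :
    (ofSlots pt n (unbump u j)).countP (· ≤ plain η)
      = (ofSlots pt n u).countP (· ≤ plain η) := by
  have h1 := hu.pos j hj
  rw [← countP_bump hs (unbump_mod hs.three_le hu hj h0), bump_unbump (by omega)]

/-- A first entry above `2 L`, lowered by `L`, is still above `L` and is the smallest entry of its
rotated window; no part becomes small. -/
theorem countP_bw (hl : Lowerable L (k - 1) n u (gTake η k p (ofSlots pt n u)))
    (hge : ∀ m, gTake η k p (ofSlots pt n u) m → 2 * L < u m) :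
    (ofSlots pt n (bw L (k - 1) (gTake η k p (ofSlots pt n u)) u)).countP (· ≤ plain η)
      = (ofSlots pt n u).countP (· ≤ plain η) := by
  have hg := hs.botGreedy hk hu
  have hM := ini_gTake η k p (ofSlots pt n u)
  refine hs.countP_congr fun i hi => ⟨fun h => ?_, fun h => ?_⟩
  · rcases off_cases (k - 1) (gTake η k p (ofSlots pt n u)) i with h1 | ⟨m, hm, h1, h2⟩ | h1
    · have h3 := bw_anti (by omega) hu hg hM hl i (i + (k - 1) - 1) (by omega)
        (by have := (hM.ks_bot hg h1).1; omega)
      rw [bw_last (by omega) h1] at h3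
      have := hge i h1
      omega
    · have h3 := bw_anti (by omega) hu hg hM hl i (m + (k - 1) - 1) (by omega)
        (by have := (hM.ks_bot hg hm).1; omega)
      rw [bw_last (by omega) hm] at h3
      have := hge m hm
      omega
    · rwa [bw_off (by omega) h1] at h
  · exact (bw_le (by omega) hu hg hM hi).trans h

end

/-! ### Lowering on slots for `p = N` -/

theorem unbump_addSeq {L K : ℕ} {M : ℕ → Prop} {u : ℕ → ℕ} {j : ℕ} :
    unbump (addSeq L K M u j) j = fw L K M u := by
  ext i
  by_cases h : i = j
  · subst h
    rw [unbump_self, addSeq, Function.update_self, Nat.add_sub_cancel]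
  · rw [unbump_of_ne h, addSeq_of_ne h]

/-- Below a sequence whose windows are all above the slot `2 L - 1`, the windows after lowering an
entry `L` end before that entry. -/
theorem lt_of_ks_unbump {L K n : ℕ} {u : ℕ → ℕ} {j : ℕ} (hL : 3 ≤ L) (hK : 2 ≤ K)
    (hu : Adm L K n u) (hj : j < n) (hjL : u j = L) (hadm : Adm L K n (unbump u j))
    (hno : ∀ x, KS L K n u x → 2 * L - 1 ≤ u x) {x : ℕ} (hx : KS L K n (unbump u j) x) :
    x + K ≤ j ∧ 2 * L < unbump u j x := by
  have hn := hx.1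
  have hmod := unbump_mod hL hu hj (by rw [hjL, Nat.mod_self])
  have hS : KS L K n u x := by
    have h := bump_ks hL hmod hx
    rwa [bump_unbump (by omega)] at h
  have h1 := hno x hS
  have hxj : x ≠ j := fun h => by rw [h] at h1; omega
  have h2 : x + K ≤ j := by
    by_contra hc
    have h3 : unbump u j (x + K - 1) ≤ L - 1 := by
      rcases le_total j (x + K - 1) with h | h
      · have := hadm.anti j (x + K - 1) h (by omega)
        rwa [unbump_self, hjL] at this
      · rw [show x + K - 1 = j by omega, unbump_self, hjL]
    have h4 := hx.2
    have h5 := h4.le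
    rw [unbump_of_ne hxj] at h4 h5
    -- Only the slot `2 L - 1` is left for the first entry; it is congruent to `-1`, so distance
    -- exactly `L` is not near.
    have h6 : u x = L - 1 + L := by omega
    have h7 := h4.lt (by rw [h6, Nat.add_mod_right, Nat.mod_eq_of_lt (by omega)]; omega)
    omega
  refine ⟨h2, ?_⟩
  rw [unbump_of_ne hxj]
  have h3 := hu.gap (j - K) (by omega)
  rw [Nat.sub_add_cancel (by omega), hjL] at h3
  have h4 := hu.anti x (j - K) (by omega) (by omega)
  by_contra h5
  apply h3
  by_cases h6 : u (j - K) < L + L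
  · exact Or.inl h6
  · have h7 : u (j - K) = L + L := by omega
    exact Or.inr ⟨h7, by rw [h7, Nat.add_mod_right, Nat.mod_self]⟩

/-- Every window meets a bottom-greedy one, and all of these are rotated; so no window lies strictly
below the last rotated first entry. -/
theorem lowerable_of_all {L K n : ℕ} {u : ℕ → ℕ} {g M : ℕ → Prop} (hK : 2 ≤ K) (hL : 3 ≤ L)
    (hg : BotGreedy K (KS L K n u) g) (hM : Ini g M) (hall : ∀ i, g i → M i)
    (hge : ∀ m, M m → 2 * L < u m) (hanti : Adm L K n u) : Lowerable L K n u M where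
  ge m hm := by have := hge m hm; omega
  no_set m hm hmax i hS hi _ := by
    obtain ⟨i', h1, h2, h3⟩ := hg.exists_ge (by omega) hS
    have h4 := hmax i' (hall i' h1)
    have := hanti.anti i m (by omega) (by have := (hM.ks_bot hg hm).1; omega)
    omega

section

variable {A : Set ℕ} {a c η L : ℕ} {pt : ℕ → Part} {k n p r N : ℕ} {u : ℕ → ℕ}
  (hs : SlotMap A a c η L pt) (hk : 3 ≤ k)

/-! ### The set `B̄_η` in terms of slots -/

include hs hk

theorem isBEta_of_subAt (hu : Adm L (k - 1) n u)
    (hc : (ofSlots pt n u).countP (· ≤ plain η) ≤ r - 1) (hp : p < N) {e j d : ℕ}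
    (hN : (gPos η k (ofSlots pt n (unbump u j))).length = N)
    (h : SubAt L (k - 1) n u (fun i => i ∈ gPos η k (ofSlots pt n (unbump u j)))
      (gTake η k p (ofSlots pt n (unbump u j))) e j d) :
    IsBEta A a c η k r N p (ofSlots pt n u) := by
  have hadm := h.last.unbump_adm hs.three_le (show 2 ≤ k - 1 by omega) hu
  refine ⟨hs.isB1 hu hc, ?_, fun _ => ⟨e, (isNonDegSet_iff hs hk e).2 h.last.nd,
    fun m' hm' => h.last.max m' ((isNonDegSet_iff hs hk m').1 hm'), fun x hx => ?_⟩,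
    fun h => absurd h hp.ne⟩
  · rw [degenerate_of_lt hs hk hu hp h.last, gParts_ofSlots hs hk hadm, List.length_map, hN]
  · obtain ⟨_, rfl⟩ := mem_getElem?_ofSlots.1 hx
    rw [degenerate_of_lt hs hk hu hp h.last, gParts_ofSlots hs hk hadm, hs.raise]
    constructor
    · intro g hg
      rw [List.getElem?_map] at hg
      obtain ⟨i, hi, rfl⟩ := Option.map_eq_some_iff.1 hg
      have h1 := getElem?_le_of_notMem_take (gPos_sorted η k _) hi h.mem h.notMem
      have h2 := h.min i (List.mem_of_getElem? hi) (notMem_take_getElem? (gPos_sorted η k _) hi)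
      obtain rfl : i = d := le_antisymm h1 h2
      exact hs.strictMono h.lt
    · intro hp1 g hg
      rw [List.getElem?_map] at hg
      obtain ⟨i, hi, rfl⟩ := Option.map_eq_some_iff.1 hg
      refine hs.strictMono (h.gt i (List.mem_iff_getElem?.2 ⟨p - 1, ?_⟩))
      rw [List.getElem?_take, if_pos (by omega), hi]

theorem exists_subAt (hLk : L ≤ k) (hu : Adm L (k - 1) n u) (hp : p < N)
    (h : IsBEta A a c η k r N p (ofSlots pt n u)) : ∃ e j d,
      SubAt L (k - 1) n u (fun i => i ∈ gPos η k (ofSlots pt n (unbump u j)))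
        (gTake η k p (ofSlots pt n (unbump u j))) e j d ∧
      (gPos η k (ofSlots pt n (unbump u j))).length = N := by
  obtain ⟨e, he, hmax, hx⟩ := h.lt hp
  rw [isNonDegSet_iff hs hk] at he
  obtain ⟨j, hlast⟩ := exists_lastND hs.three_le (show L ≤ k - 1 + 1 by omega) hu he
    fun i hi => hmax i ((isNonDegSet_iff hs hk i).2 hi)
  have hadm := hlast.unbump_adm hs.three_le (show 2 ≤ k - 1 by omega) hu
  have hcount := h.count
  rw [degenerate_of_lt hs hk hu hp hlast, gParts_ofSlots hs hk hadm, List.length_map] at hcount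
  obtain ⟨h1, h2⟩ := hx _ (getElem?_ofSlots (by have := he.1.1; omega))
  rw [degenerate_of_lt hs hk hu hp hlast, gParts_ofSlots hs hk hadm, hs.raise] at h1 h2
  have hd := List.getElem?_eq_getElem (hcount.symm ▸ hp)
  generalize (gPos η k (ofSlots pt n (unbump u j)))[p]'(hcount.symm ▸ hp) = d at hd
  refine ⟨e, j, d, ⟨hlast, List.mem_of_getElem? hd, notMem_take_getElem? (gPos_sorted η k _) hd,
    fun i hi hi' => getElem?_le_of_notMem_take (gPos_sorted η k _) hd hi hi', ?_,
    fun m hm => ?_⟩, hcount⟩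
  · exact hs.strictMono.lt_iff_lt.1 (h1 _ (by rw [List.getElem?_map, hd]; rfl))
  · obtain ⟨q, hq⟩ := List.mem_iff_getElem?.1 hm
    rw [List.getElem?_take] at hq
    split_ifs at hq with hqp
    have h3 := List.getElem?_eq_getElem (l := gPos η k (ofSlots pt n (unbump u j)))
      (i := p - 1) (by omega)
    have h5 := hs.strictMono.lt_iff_lt.1
      (h2 (by omega) (pt (unbump u j _)) (by rw [List.getElem?_map, h3]; rfl))
    obtain ⟨h4, rfl⟩ := List.getElem?_eq_some_iff.1 hq
    -- The given inequality concerns `g̃_p`, the smallest of the entries to be lowered; the earlier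
    -- ones are at least as large.
    refine h5.trans_le (hadm.anti _ _ ?_ ?_)
    · rcases (show q ≤ p - 1 by omega).lt_or_eq with h6 | rfl
      · exact (List.pairwise_iff_getElem.1 (gPos_sorted η k _) q (p - 1) _ _ h6).le
      · exact le_rfl
    · exact gPos_lt hs hk hadm (List.getElem_mem _)

theorem hasNonDegRPart_iff (hu : Adm L (k - 1) n u) :
    HasNonDegRPart c η k r (ofSlots pt n u) ↔
      (ofSlots pt n u).countP (· ≤ plain η) = r - 1 ∧ (∀ i < n, u i ≠ L - 1) ∧
      ∀ x, KS L (k - 1) n u x → 2 * L - 1 ≤ u x := by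
  rw [HasNonDegRPart]
  refine and_congr_right fun _ => and_congr ?_ (forall_congr' fun x => ?_)
  · rw [← hs.bar_c, mem_ofSlots]
    constructor
    · exact fun h i hi he => h ⟨i, hi, by rw [he]⟩
    · rintro h ⟨i, hi, he⟩
      exact h i hi (hs.strictMono.injective he)
  · rw [hs.isKSet hk, ← hs.bar_add]
    refine imp_congr_right fun hx => ?_
    have hn := hx.1
    constructor
    · intro h
      by_contra hc
      refine h fun y hy => ?_
      obtain ⟨l, h1, _, h2, rfl⟩ := mem_window.1 hy
      have := hu.anti x l h1 h2
      exact hs.strictMono (by omega)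
    · intro h h'
      have := hs.strictMono.lt_iff_lt.1
        (h' _ (mem_window.2 ⟨x, le_rfl, by omega, by omega, rfl⟩))
      omega

omit hk in
/-- The last occurrence of the slot `L`. -/
theorem exists_last_eta {K : ℕ} (hu : Adm L K n u) (hr : L - 1 ≤ r)
    (hc : (ofSlots pt n u).countP (· ≤ plain η) = r - 1) (hL1 : ∀ i < n, u i ≠ L - 1) :
    ∃ j < n, u j = L ∧ (j + 1 < n → u (j + 1) + 1 < u j) := by
  have h3 := hs.three_le
  obtain ⟨h1, h2⟩ := hs.le_iff_countP hu hc
  have h0 : u (n - (r - 1)) = L := by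
    have h4 := (h2 (n - (r - 1)) (by omega)).2 (by omega)
    by_contra hne
    -- Otherwise the `r - 1` small entries would be distinct slots in `2, ..., L - 2`; there are
    -- only `L - 3 < r - 1` of these.
    have h5 := hu.add_le (n - (r - 1)) (r - 2) (by omega) fun l hl hl' => by
      have h6 := hu.anti (n - (r - 1)) l (by omega) (by omega)
      have h7 := hu.pos l (by omega)
      rw [Nat.mod_eq_of_lt (by omega)]
      omega
    have h6 := hu.pos (n - (r - 1) + (r - 2)) (by omega)
    have h7 := hL1 (n - (r - 1)) (by omega)
    omega
  classical
  have hP : (n - (r - 1) < n ∧ u (n - (r - 1)) = L) := ⟨by omega, h0⟩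
  have h4 := Nat.findGreatest_spec (P := fun i => i < n ∧ u i = L) (n := n) (by omega) hP
  have h5 := fun i => Nat.le_findGreatest (P := fun i => i < n ∧ u i = L) (n := n) (m := i)
  generalize Nat.findGreatest (fun i => i < n ∧ u i = L) n = j at h4 h5
  refine ⟨j, h4.1, h4.2, fun hj => ?_⟩
  have h6 := hu.anti j (j + 1) (by omega) hj
  have h7 := hL1 (j + 1) hj
  have h8 : u (j + 1) ≠ L := fun h => by
    have := h5 (j + 1) (by omega) ⟨hj, h⟩
    omega
  omega

/-! ### The two maps -/

/-- Properties of the subtraction that hold for `p < N` as well as for `p = N`. -/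
theorem subtraction_ofSlots {j : ℕ} (hadm : Adm L (k - 1) n (unbump u j))
    (hdeg : degenerate a c η k N p (ofSlots pt n u) = ofSlots pt n (unbump u j))
    (hl : Lowerable L (k - 1) n (unbump u j) (gTake η k p (ofSlots pt n (unbump u j)))) :
    subtraction a c η k N p (ofSlots pt n u) = ofSlots pt n
      (bw L (k - 1) (gTake η k p (ofSlots pt n (unbump u j))) (unbump u j)) := by
  rw [subtraction, hdeg, backwardMove_ofSlots hs hk hadm hl]

theorem subtraction_addSeq (hu : Adm L (k - 1) n u) {j : ℕ}
    (hp : p ≤ (rPos η k (ofSlots pt n u)).length)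
    (hdeg : degenerate a c η k N p
        (ofSlots pt n (addSeq L (k - 1) (rTake η k p (ofSlots pt n u)) u j))
      = ofSlots pt n (fw L (k - 1) (rTake η k p (ofSlots pt n u)) u))
    (hl : Lowerable L (k - 1) n (fw L (k - 1) (rTake η k p (ofSlots pt n u)) u)
      (rTake η k p (ofSlots pt n u))) :
    subtraction a c η k N p
      (ofSlots pt n (addSeq L (k - 1) (rTake η k p (ofSlots pt n u)) u j)) = ofSlots pt n u := by
  have hr := hs.topGreedy hk hu
  have hM := ini_rTake η k p (ofSlots pt n u)
  have hadm := fw_adm (by omega) hu hr hM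
  have hT := gTake_fw hs hk hu hp
  rw [subtraction, hdeg, backwardMove_ofSlots hs hk hadm (by rw [hT]; exact hl), hT]
  exact ofSlots_congr fun i _ => bw_fw (by omega) hr hM i

theorem addition_bw {j : ℕ} (hu : Adm L (k - 1) n u) (hj : j < n) (h0 : u j % L = 0)
    (hadm : Adm L (k - 1) n (unbump u j))
    (hp : p ≤ (gPos η k (ofSlots pt n (unbump u j))).length)
    (hl : Lowerable L (k - 1) n (unbump u j) (gTake η k p (ofSlots pt n (unbump u j))))
    (hMj : ∀ m, gTake η k p (ofSlots pt n (unbump u j)) m → m + (k - 1) ≤ j)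
    (hpart : additionPart c η k p (ofSlots pt n
        (bw L (k - 1) (gTake η k p (ofSlots pt n (unbump u j))) (unbump u j)))
      = pt (unbump u j j)) :
    addition a c η k p (ofSlots pt n
        (bw L (k - 1) (gTake η k p (ofSlots pt n (unbump u j))) (unbump u j)))
      = ofSlots pt n u := by
  have hg := hs.botGreedy hk hadm
  have hM := ini_gTake η k p (ofSlots pt n (unbump u j))
  have hbadm := bw_adm (by omega) hadm hg hM hl
  have hT := rTake_bw hs hk hadm hl hp
  have hbj := bw_eq_of_ge (L := L) (u := unbump u j) (show 2 ≤ k - 1 by omega) hMj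
  have hfw : fw L (k - 1) (gTake η k p (ofSlots pt n (unbump u j)))
      (bw L (k - 1) (gTake η k p (ofSlots pt n (unbump u j))) (unbump u j)) = unbump u j :=
    funext (fw_bw (by omega) hg hM hl)
  have hpos := hu.pos j hj
  have hadd : addSeq L (k - 1) (gTake η k p (ofSlots pt n (unbump u j)))
      (bw L (k - 1) (gTake η k p (ofSlots pt n (unbump u j))) (unbump u j)) j = u := by
    rw [addSeq, hfw, bump_unbump (by omega)]
  rw [addition_ofSlots hs hk hbadm hj (by rw [hbj]; exact unbump_mod hs.three_le hu hj h0)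
    (by rw [hT]; exact hMj) (by rw [hpart, hbj]) (by rw [hT, hadd]; exact hu), hT, hadd]

/-- The conclusions about the addition. -/
structure AdditionSpec (A : Set ℕ) (a c η k r N p : ℕ) (π : List Part) : Prop where
  canForward : CanForward η k p π
  isOverpartition : IsOverpartition (forwardMove η k p π)
  mem : additionPart c η k p π ∈ forwardMove η k p π
  isBEta : IsBEta A a c η k r N p (addition a c η k p π)
  weight_eq : weight (addition a c η k p π) = weight π + p * η + a
  left_inv : subtraction a c η k N p (addition a c η k p π) = π

/-- The conclusions about the subtraction. -/
structure SubtractionSpec (A : Set ℕ) (a c η k r N p : ℕ) (τ : List Part) : Prop where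
  canBackward : CanBackward a η k p (degenerate a c η k N p τ)
  isBLambda : IsBLambda A c η k r N p (subtraction a c η k N p τ)
  right_inv : addition a c η k p (subtraction a c η k N p τ) = τ

theorem additionSpec_of_lt (hLk : L ≤ k) (hp : p < N) {π : List Part}
    (h : IsBLambda A c η k r N p π) : AdditionSpec A a c η k r N p π := by
  obtain ⟨n, u, rfl, hu⟩ := hs.exists_ofSlots h.isB1
  have hL := hs.three_le
  have hK : 2 ≤ k - 1 := by omega
  have hN := h.count
  rw [rParts_ofSlots hs hk hu, List.length_map] at hN
  obtain ⟨i, hi, x, hx, hxc, hdeg⟩ := h.lt hp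
  obtain ⟨m', j, ha⟩ := exists_addAt hs hk hu hi hx hxc hdeg
  have hr := hs.topGreedy hk hu
  have hM := ini_rTake η k p (ofSlots pt n u)
  have hpl : p ≤ (rPos η k (ofSlots pt n u)).length := by omega
  have hj := ha.j_lt hr
  have hMj := ha.add_le_j hr hM
  have hadm := ha.adm hL hK hu hr hM
  have hpart := additionPart_of_addAt hs hk hu ha
  have hadd := addition_ofSlots hs hk hu hj ha.mod hMj hpart hadm
  obtain ⟨e, h1, h2, he, hmax⟩ := ha.exists_last hL hK hu hr hM
  have hlast := ha.lastND hL hK hu hr hM h1 h2 he hmax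
  have hun := unbump_addSeq (L := L) (K := k - 1) (M := rTake η k p (ofSlots pt n u)) (u := u)
    (j := j)
  have hfadm := fw_adm hK hu hr hM
  have hg := hs.botGreedy hk hfadm
  have hT := gTake_fw hs hk hu hpl
  have hlen := length_gPos_fw (p := p) hs hk hu
  have hgl : p < (gPos η k (ofSlots pt n
    (fw L (k - 1) (rTake η k p (ofSlots pt n u)) u))).length := by omega
  have hd := List.getElem?_eq_getElem hgl
  generalize (gPos η k (ofSlots pt n (fw L (k - 1) (rTake η k p (ofSlots pt n u)) u)))[p] = d at hd
  have hdM : ¬ rTake η k p (ofSlots pt n u) d := by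
    rw [← hT]; exact notMem_take_getElem? (gPos_sorted η k _) hd
  have hsub : SubAt L (k - 1) n (addSeq L (k - 1) (rTake η k p (ofSlots pt n u)) u j)
      (fun i => i ∈ gPos η k (ofSlots pt n (fw L (k - 1) (rTake η k p (ofSlots pt n u)) u)))
      (rTake η k p (ofSlots pt n u)) e j d := by
    refine ⟨hlast, List.mem_of_getElem? hd, hdM, fun l hl hl' => ?_, ?_, fun m hm => ?_⟩
    · rw [← hT] at hl'
      exact getElem?_le_of_notMem_take (gPos_sorted η k _) hd hl hl'
    · rw [hun]
      exact ha.lt_next hL hK hu hr hM hg h2 d (List.mem_of_getElem? hd) hdM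
    · rw [hun]
      exact ha.lt_start hL hK hu hr hM h1 h2 he m hm
  have hMg : Ini (fun i => i ∈ gPos η k (ofSlots pt n
      (fw L (k - 1) (rTake η k p (ofSlots pt n u)) u))) (rTake η k p (ofSlots pt n u)) := by
    have h0 := ini_gTake η k p (ofSlots pt n (fw L (k - 1) (rTake η k p (ofSlots pt n u)) u))
    rwa [hT] at h0
  have hlow := hsub.lowerable hL hK (by omega) hadm (by rw [hun]; exact hg) hMg
  rw [hun] at hlow
  refine ⟨canForward hs hk hu hpl, ?_, additionPart_mem hs hk hu hj hMj hpart, ?_, ?_, ?_⟩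
  · rw [forwardMove_ofSlots hs hk hu]
    exact hs.isOverpartition hfadm
  · rw [hadd]
    refine isBEta_of_subAt hs hk hadm ?_ hp (j := j) (e := e) (d := d) (by rw [hun, hlen, hN])
      (by rw [hun, hT]; exact hsub)
    -- No entry decreases under the addition, so the number of small parts cannot grow.
    refine le_trans (hs.countP_mono fun i hi hle => ?_) h.isB1.small
    refine (le_fw hK hu hr hM hi).trans (le_trans ?_ hle)
    by_cases hij : i = j
    · subst hij
      rw [addSeq, Function.update_self]
      omega
    · rw [addSeq_of_ne hij]
  · rw [hadd, weight_addSeq hs hk hu hpl hj ha.mod hMj]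
  · rw [hadd]
    refine subtraction_addSeq hs hk hu hpl ?_ hlow
    rw [degenerate_of_lt hs hk hadm hp hlast, hun]

theorem subtractionSpec_of_lt (hLk : L ≤ k) (hp : p < N) {τ : List Part}
    (h : IsBEta A a c η k r N p τ) : SubtractionSpec A a c η k r N p τ := by
  obtain ⟨n, u, rfl, hu⟩ := hs.exists_ofSlots h.isB1
  have hL := hs.three_le
  have hK : 2 ≤ k - 1 := by omega
  obtain ⟨e, j, d, hsub, hN⟩ := exists_subAt hs hk hLk hu hp h
  have hj := hsub.j_lt
  have hadm := hsub.last.unbump_adm hL hK hu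
  have hg := hs.botGreedy hk hadm
  have hM := ini_gTake η k p (ofSlots pt n (unbump u j))
  have hlow := hsub.lowerable hL hK (by omega) hu hg hM
  have hdeg := degenerate_of_lt hs hk hu hp hsub.last
  have hpl : p ≤ (gPos η k (ofSlots pt n (unbump u j))).length := by omega
  have hMj := fun m hm => (hsub.add_le hu hg hM m hm).trans hsub.last.le
  have hge : ∀ m, gTake η k p (ofSlots pt n (unbump u j)) m → 2 * L < unbump u j m :=
    fun m hm => by
      have h1 := hsub.gt m hm
      have h2 := hu.anti e j hsub.last.le hj
      have h3 := hu.pos j hj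
      have h4 : L ≤ u j := Nat.le_of_dvd (by omega) (Nat.dvd_of_mod_eq_zero hsub.last.mod)
      omega
  have hbadm := bw_adm hK hadm hg hM hlow
  have hr := hs.topGreedy hk hbadm
  have hT := rTake_bw hs hk hadm hlow hpl
  obtain ⟨m', ha⟩ := hsub.addAt hL hK (by omega) hu hg hM hr
  rw [← hT] at ha
  have hsubt := subtraction_ofSlots hs hk hadm hdeg hlow
  have hrl := length_rPos_bw hs hk hadm hlow
  rw [hT] at ha
  refine ⟨by rw [hdeg]; exact canBackward hs hk hadm hpl hlow hge, ?_, ?_⟩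
  · rw [hsubt]
    refine ⟨hs.isB1 hbadm ?_, ?_, fun _ => ?_, fun h => absurd h hp.ne⟩
    · rw [countP_bw hs hk hadm hlow hge, countP_unbump hs hu hj hsub.last.mod]
      exact h.isB1.small
    · rw [rParts_ofSlots hs hk hbadm, List.length_map, hrl, hN]
    · exact degenerate_sets_of_addAt hs hk hbadm (by rw [hT]; exact ha)
  · rw [hsubt]
    refine addition_bw hs hk hu hj hsub.last.mod hadm hpl hlow hMj ?_
    rw [additionPart_of_addAt hs hk hbadm (by rw [hT]; exact ha),
      bw_eq_of_ge hK hMj]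

theorem additionSpec_of_eq {π : List Part} (h : IsBLambda A c η k r N N π) :
    AdditionSpec A a c η k r N N π := by
  obtain ⟨n, u, rfl, hu⟩ := hs.exists_ofSlots h.isB1
  have hL := hs.three_le
  have hK : 2 ≤ k - 1 := by omega
  have hN := h.count
  rw [rParts_ofSlots hs hk hu, List.length_map] at hN
  obtain ⟨hcount, hbar, hlowr⟩ := h.eq rfl
  obtain ⟨j, hj, hjb⟩ := mem_ofSlots.1 hbar
  rw [← hs.bar_c] at hjb
  have hj0 : u j = L - 1 := hs.strictMono.injective hjb
  have hjm : u j % L = L - 1 := by rw [hj0, Nat.mod_eq_of_lt (by omega)]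
  have hr := hs.topGreedy hk hu
  have hM := ini_rTake η k N (ofSlots pt n u)
  have hall : ∀ i, rStart η k (ofSlots pt n u) i → rTake η k N (ofSlots pt n u) i :=
    fun i hi => by rw [rTake, ← hN, List.take_length]; exact hi
  have hlow : ∀ m, rTake η k N (ofSlots pt n u) m → L < u (m + (k - 1) - 1) := fun m hm => by
    have h1 := hlowr (pt (u (m + (k - 1) - 1))) (by
      rw [rParts_ofSlots hs hk hu]
      exact List.mem_map_of_mem (f := fun i => pt (u i)) (List.mem_of_mem_take hm))
    rw [← hs.plain_eta] at h1
    exact hs.strictMono.lt_iff_lt.1 h1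
  have hMj : ∀ m, rTake η k N (ofSlots pt n u) m → m + (k - 1) ≤ j := fun m hm => by
    by_contra hc
    have h1 := hlow m hm
    have h2 := hu.anti j (m + (k - 1) - 1) (by omega) (by have := (ks_of_mem hr hM hm).1; omega)
    omega
  have hadm := addSeq_adm hL hK hu hr hM hj hjm hMj (fun i hi _ => hall i hi) fun m hm hmj he => by
    have h1 := hlow m hm
    rw [show m + (k - 1) - 1 = j - 1 by omega] at h1
    omega
  -- There is no marked position of index `N`, so `additionPart` takes its value `bar c`, the slot
  -- `L - 1`.
  have hpart : additionPart c η k N (ofSlots pt n u) = pt (u j) := by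
    rw [additionPart, List.getElem?_eq_none hN.le, hj0, hs.bar_c]
  have hadd := addition_ofSlots hs hk hu hj hjm hMj hpart hadm
  have hself := addSeq_self (L := L) (u := u) hK hMj
  have hun := unbump_addSeq (L := L) (K := k - 1) (M := rTake η k N (ofSlots pt n u)) (u := u)
    (j := j)
  have hfadm := fw_adm hK hu hr hM
  have hT := gTake_fw hs hk hu hN.ge
  have hlen := length_gPos_fw (p := N) hs hk hu
  have hdeg : degenerate a c η k N N
        (ofSlots pt n (addSeq L (k - 1) (rTake η k N (ofSlots pt n u)) u j))
      = ofSlots pt n (fw L (k - 1) (rTake η k N (ofSlots pt n u)) u) := by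
    rw [← hun]
    exact degenerate_of_eq hs (lt_irrefl N) hj (by omega) (by rw [hun]; exact hfadm)
  have hno := not_ks_addSeq_of_all hL hK hu hr hM hj hall hlow hj0 hMj
  have hg := hs.botGreedy hk hfadm
  have hMg : Ini (fun i => i ∈ gPos η k (ofSlots pt n
      (fw L (k - 1) (rTake η k N (ofSlots pt n u)) u))) (rTake η k N (ofSlots pt n u)) := by
    have h0 := ini_gTake η k N (ofSlots pt n (fw L (k - 1) (rTake η k N (ofSlots pt n u)) u))
    rwa [hT] at h0
  have hlowf : Lowerable L (k - 1) n (fw L (k - 1) (rTake η k N (ofSlots pt n u)) u)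
      (rTake η k N (ofSlots pt n u)) := by
    refine lowerable_of_all hK hL hg hMg (fun i hi => ?_) (fun m hm => ?_) hfadm
    · have h3 : gTake η k N
          (ofSlots pt n (fw L (k - 1) (rTake η k N (ofSlots pt n u)) u)) i := by
        rw [gTake, List.take_of_length_le (by omega)]
        exact hi
      rwa [hT] at h3
    · rw [fw_start hm]
      have := hlow m hm
      omega
  refine ⟨canForward hs hk hu hN.ge, ?_, additionPart_mem hs hk hu hj hMj hpart, ?_, ?_, ?_⟩
  · rw [forwardMove_ofSlots hs hk hu]
    exact hs.isOverpartition hfadm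
  · have hc : (ofSlots pt n (addSeq L (k - 1) (rTake η k N (ofSlots pt n u)) u j)).countP
        (· ≤ plain η) = r - 1 := by
      rw [addSeq, countP_bump hs (by rw [fw_eq_of_ge hK hMj]; exact hjm), ← hcount]
      refine hs.countP_congr fun i hi => ⟨fun h1 => (le_fw hK hu hr hM hi).trans h1, fun h1 => ?_⟩
      rw [fw_eq_of_ge hK fun m hm => ?_]
      · exact h1
      · by_contra hc
        have h2 := hlow m hm
        have h3 := hu.anti i (m + (k - 1) - 1) (by omega)
          (by have := (ks_of_mem hr hM hm).1; omega)
        omega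
    rw [hadd]
    refine ⟨hs.isB1 hadm hc.le, ?_, fun h => absurd h (lt_irrefl N), fun _ => ?_⟩
    · rw [hdeg, gParts_ofSlots hs hk hfadm, List.length_map, hlen, hN]
    · refine (hasNonDegRPart_iff hs hk hadm).2 ⟨hc, fun i hi he => ?_, hno⟩
      have hij : i ≠ j := fun hij => by rw [hij] at he; omega
      rw [addSeq_of_ne hij] at he
      have hfj := fw_eq_of_ge (L := L) (u := u) hK hMj
      rcases lt_or_gt_of_ne hij with h1 | h1
      · have := hfadm.lt_of_strict' h1 hj (by rw [hfj, hjm]; omega)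
        omega
      · have := hfadm.lt_of_strict_left h1 hi (by rw [hfj, hjm]; omega)
        omega
  · rw [hadd, weight_addSeq hs hk hu hN.ge hj hjm hMj]
  · rw [hadd]
    exact subtraction_addSeq hs hk hu hN.ge hdeg hlowf

theorem subtractionSpec_of_eq (hr : L - 1 ≤ r) {τ : List Part}
    (h : IsBEta A a c η k r N N τ) : SubtractionSpec A a c η k r N N τ := by
  obtain ⟨n, u, rfl, hu⟩ := hs.exists_ofSlots h.isB1
  have hL := hs.three_le
  have hK : 2 ≤ k - 1 := by omega
  obtain ⟨hcount, hL1, hno⟩ := (hasNonDegRPart_iff hs hk hu).1 (h.eq rfl)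
  obtain ⟨j, hj, hjL, hnext⟩ := exists_last_eta hs hu hr hcount hL1
  have hj0 : u j % L = 0 := by rw [hjL, Nat.mod_self]
  have hadm : Adm L (k - 1) n (unbump u j) := unbump_adm hL hK hu hj hj0 hnext
  have hdeg := degenerate_of_eq (a := a) (c := c) (k := k) hs (lt_irrefl N) hj hjL hadm
  have hN := h.count
  rw [hdeg, gParts_ofSlots hs hk hadm, List.length_map] at hN
  have hg := hs.botGreedy hk hadm
  have hM := ini_gTake η k N (ofSlots pt n (unbump u j))
  have hwin := fun x => lt_of_ks_unbump hL hK hu hj hjL hadm hno (x := x)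
  have hMj := fun m hm => (hwin m (hM.ks_bot hg hm)).1
  have hge := fun m hm => (hwin m (hM.ks_bot hg hm)).2
  have hlow := lowerable_of_all hK hL hg hM (fun i hi => by
    rw [gTake, ← hN, List.take_length]; exact hi) hge hadm
  have hbadm := bw_adm hK hadm hg hM hlow
  have hT := rTake_bw hs hk hadm hlow hN.ge
  have hsubt := subtraction_ofSlots hs hk hadm hdeg hlow
  have hrl := length_rPos_bw hs hk hadm hlow
  have hbj := bw_eq_of_ge (L := L) (u := unbump u j) hK hMj
  have hunj : unbump u j j = L - 1 := by rw [unbump_self, hjL]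
  refine ⟨by rw [hdeg]; exact canBackward hs hk hadm hN.ge hlow hge, ?_, ?_⟩
  · have hc : (ofSlots pt n (bw L (k - 1) (gTake η k N (ofSlots pt n (unbump u j)))
        (unbump u j))).countP (· ≤ plain η) = r - 1 := by
      rw [countP_bw hs hk hadm hlow hge, countP_unbump hs hu hj hj0, hcount]
    rw [hsubt]
    refine ⟨hs.isB1 hbadm hc.le, ?_, fun h => absurd h (lt_irrefl N), fun _ => ⟨hc, ?_, ?_⟩⟩
    · rw [rParts_ofSlots hs hk hbadm, List.length_map, hrl, hN]
    · exact mem_ofSlots.2 ⟨j, hj, by rw [hbj, hunj, hs.bar_c]⟩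
    · intro x hx
      rw [rParts_ofSlots hs hk hbadm] at hx
      obtain ⟨i, hi, rfl⟩ := List.mem_map.1 hx
      rw [← List.take_length (l := rPos η k _), hrl, hN] at hi
      obtain ⟨m, hm, hmi⟩ := rTake_last hs hk hbadm hi
      rw [hT] at hm
      obtain rfl : i = m + (k - 1) - 1 := by omega
      rw [← hs.plain_eta]
      refine hs.strictMono ?_
      rw [bw_last hK hm]
      have := hge m hm
      omega
  · rw [hsubt]
    refine addition_bw hs hk hu hj hj0 hadm hN.ge hlow hMj ?_
    rw [additionPart, List.getElem?_eq_none (by rw [hrl, hN]), hunj, hs.bar_c]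

end

end Bressoud

/-! ### The theorem for the residues `α` -/

theorem mainTheorem7 (lam k r η : ℕ) (α : ℕ → ℕ)
    (hlam : 2 ≤ lam) (hr : lam ≤ r) (hrk : r ≤ k) (hk : lam < k)
    (hα_pos : 0 < α 1)
    (hα_lt : ∀ i, 1 ≤ i → i < lam → α i < α (i + 1))
    (hα_η : α lam < η)
    (hα_symm : ∀ i, 1 ≤ i → i ≤ lam → α i + α (lam + 1 - i) = η)
    (N p : ℕ) (hN : 1 ≤ N) (hp : p ≤ N) :
    (∀ π, Bressoud.IsBLambda (α '' Set.Icc 2 lam) (α lam) η k r N p π →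
      Bressoud.CanForward η k p π ∧
      Bressoud.IsOverpartition (Bressoud.forwardMove η k p π) ∧
      Bressoud.additionPart (α lam) η k p π ∈ Bressoud.forwardMove η k p π ∧
      Bressoud.IsBEta (α '' Set.Icc 2 lam) (α 1) (α lam) η k r N p
        (Bressoud.addition (α 1) (α lam) η k p π) ∧
      Bressoud.weight (Bressoud.addition (α 1) (α lam) η k p π)
        = Bressoud.weight π + p * η + α 1) ∧
    (∀ τ, Bressoud.IsBEta (α '' Set.Icc 2 lam) (α 1) (α lam) η k r N p τ →
      Bressoud.CanBackward (α 1) η k p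
        (Bressoud.degenerate (α 1) (α lam) η k N p τ) ∧
      Bressoud.IsBLambda (α '' Set.Icc 2 lam) (α lam) η k r N p
        (Bressoud.subtraction (α 1) (α lam) η k N p τ)) ∧
    Set.InvOn (Bressoud.subtraction (α 1) (α lam) η k N p)
      (Bressoud.addition (α 1) (α lam) η k p)
      {π | Bressoud.IsBLambda (α '' Set.Icc 2 lam) (α lam) η k r N p π}
      {τ | Bressoud.IsBEta (α '' Set.Icc 2 lam) (α 1) (α lam) η k r N p τ} ∧
    Set.BijOn (Bressoud.addition (α 1) (α lam) η k p)
      {π | Bressoud.IsBLambda (α '' Set.Icc 2 lam) (α lam) η k r N p π}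
      {τ | Bressoud.IsBEta (α '' Set.Icc 2 lam) (α 1) (α lam) η k r N p τ} := by
  have hs := Bressoud.slotMap_slotPart hlam hα_pos hα_lt hα_η hα_symm
  -- With `L = lam + 1`, the inequality `lam < k` supplies `3 ≤ k` and `L ≤ k`, and `lam ≤ r`
  -- supplies `L - 1 ≤ r`.
  have hA : ∀ π, Bressoud.IsBLambda (α '' Set.Icc 2 lam) (α lam) η k r N p π →
      Bressoud.AdditionSpec (α '' Set.Icc 2 lam) (α 1) (α lam) η k r N p π := fun π h => by
    rcases hp.lt_or_eq with hp | rfl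
    · exact Bressoud.additionSpec_of_lt hs (by omega) (by omega) hp h
    · exact Bressoud.additionSpec_of_eq hs (by omega) h
  have hS : ∀ τ, Bressoud.IsBEta (α '' Set.Icc 2 lam) (α 1) (α lam) η k r N p τ →
      Bressoud.SubtractionSpec (α '' Set.Icc 2 lam) (α 1) (α lam) η k r N p τ := fun τ h => by
    rcases hp.lt_or_eq with hp | rfl
    · exact Bressoud.subtractionSpec_of_lt hs (by omega) (by omega) hp h
    · exact Bressoud.subtractionSpec_of_eq hs (by omega) (by omega) h
  have hinv : Set.InvOn (Bressoud.subtraction (α 1) (α lam) η k N p)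
      (Bressoud.addition (α 1) (α lam) η k p)
      {π | Bressoud.IsBLambda (α '' Set.Icc 2 lam) (α lam) η k r N p π}
      {τ | Bressoud.IsBEta (α '' Set.Icc 2 lam) (α 1) (α lam) η k r N p τ} :=
    ⟨fun π h => (hA π h).left_inv, fun τ h => (hS τ h).right_inv⟩
  refine ⟨fun π h => ?_, fun τ h => ⟨(hS τ h).canBackward, (hS τ h).isBLambda⟩, hinv,
    hinv.bijOn (fun π h => (hA π h).isBEta) fun τ h => (hS τ h).isBLambda⟩
  have h1 := hA π h
  exact ⟨h1.canForward, h1.isOverpartition, h1.mem, h1.isBEta, h1.weight_eq⟩
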